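/- Let $n\ge 4$ and let $P$ be a convex $n$-gon with vertices $1,\dots,n$ in cyclic order; the $i$-th side joins $i$ to $i+1$ (cyclically). Let $\Gamma,\Gamma'$ be triangulations of $P$ (sets of pairwise non-crossing diagonals) related by a Whitehead move in a quadrilateral $P_0$ with vertices $a<b<c<d$: $\Gamma'$ is obtained from $\Gamma$ by replacing the diagonal $ac$ by $bd$. Let $\Gamma''=\Gamma\cap\Gamma'$ be the common subdivision. It cuts $P$ into $P_0$ and $n-4$ triangles $P_1,\dots,P_{n-4}$. Let $\gamma(i,j)$ be the path in the dual tree joining the leaves of the $i$-th and $j$-th sides. **The family.** For a diagonal $e\in\Gamma$ let $w_e(i,j)=\tfrac12$ if $\gamma(i,j)$ crosses $e$, and $0$ otherwise. For each Plücker relation $F_{ijkl}=p_{ij}p_{kl}-p_{ik}p_{jl}+p_{il}p_{jk}$, $i<j<k<l$, put $F^{\Gamma}_{ijkl}(p,t)=t^{w(F_{ijkl})}F_{ijkl}(t^{-w(i,j)}p_{ij})$, where $w_e(F)$ is the largest $e$-weight of a monomial of $F$. Let $\mathfrak X_\Gamma=\{(p,t)\in\mathbb P(\bigwedge^2\mathbb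 C^n)\times\mathbb C^{\Gamma} : F^\Gamma_{ijkl}(p,t)=0 \text{ for all } i<j<k<l\}$. Let $f_{\Gamma''}:\mathfrak X_{\Gamma''}\to\mathbb C^{\Gamma''}$ be the subfamily $t_{ac}=1$; it is also the subfamily $t_{bd}=1$ of $\mathfrak X_{\Gamma'}$. Let $X_0=f_{\Gamma''}^{-1}(0)$ be its central fiber, regarded as a projective variety, and let $D_0=\bigcup_{i=1}^n\{p_{i,i+1}=0\}$ (indices cyclic). **Cones and tori.** Let $\Gamma_\alpha$ be the set of sides of $P_\alpha$, so that a diagonal $\epsilon\in\Gamma''$ gives two elements $\epsilon^+,\epsilon^-$ of $\coprod_\alpha\Gamma_\alpha$. Let $\widetilde{\mathrm{Gr}}(P_\alpha)\subset\bigwedge^2\mathbb C^{\Gamma_\alpha}$ be the cone over $\mathrm{Gr}(2,\mathbb C^{\Gamma_\alpha})$, with Plücker coordinates $p^{P_\alpha}_{\epsilon,\epsilon'}$; this Grassmannian is $\mathrm{Gr}(2,4)$ for $\alpha=0$ and $\mathbb P^2$ otherwise. Let $\widetilde{\mathrm{Gr}}^\circ(P_\alpha)$ be the part of the cone where $p^{P_\alpha}_{\epsilon,\epsilon'}\neq0$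 for all adjacent sides $\epsilon,\epsilon'$ of $P_\alpha$, and let $\mathrm{Gr}^\circ(P_0)$ be the image of $\widetilde{\mathrm{Gr}}^\circ(P_0)$ in $\mathrm{Gr}(P_0)$. Likewise $\mathrm{Gr}^\circ(2,4)=\{p_{12}p_{23}p_{34}p_{14}\ne0\}\subset \mathrm{Gr}(2,4)$. The torus $(\mathbb C^\times)^{\coprod_\alpha\Gamma_\alpha}$ acts on $\prod_\alpha\widetilde{\mathrm{Gr}}(P_\alpha)$ by $p^{P_\alpha}_{\epsilon,\epsilon'}\mapsto\tau_\epsilon\tau_{\epsilon'}p^{P_\alpha}_{\epsilon,\epsilon'}$. Let $H=\mathbb C^\times_{\partial P}\times\prod_{\epsilon\in\Gamma''}\mathbb C^\times_{\epsilon^+,\epsilon^-}$, where $\mathbb C^\times_{\partial P}$ is diagonal in the coordinates of the $n$ sides of $P$, and $\mathbb C^\times_{\epsilon^+,\epsilon^-}=\{(\tau,\tau^{-1})\}\subset\mathbb C^\times_{\epsilon^+}\times\mathbb C^\times_{\epsilon^-}$. **Statement.** 1. $X_0$ is isomorphic to the GIT quotient $\prod_{\alpha=0}^{n-4}\widetilde{\mathrm{Gr}}(P_\alpha)/\!\!/H$,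 linearized by the character of $H$ that projects to $\mathbb C^\times_{\partial P}$. The isomorphism is induced by $$p_{ij}=\prod_{\epsilon,\epsilon'\subset\gamma(i,j)}p^{P_\alpha}_{\epsilon,\epsilon'},$$ the product being over the pairs of sides of the same subpolygon $P_\alpha$ that are crossed by $\gamma(i,j)$. 2. The same formula induces an isomorphism of the geometric quotient $\prod_{\alpha=0}^{n-4}\widetilde{\mathrm{Gr}}^\circ(P_\alpha)/H$ with $X_0\setminus D_0$. 3. As varieties, $$X_0\setminus D_0\;\cong\;\mathrm{Gr}^\circ(P_0)\times\mathbb T^{\mathbb C}_{\Gamma''\setminus\Gamma_0}\;\cong\;\mathrm{Gr}^\circ(2,4)\times(\mathbb C^\times)^{2(n-4)},$$ where $\mathbb T^{\mathbb C}_{\Gamma''\setminus\Gamma_0}$ is the torus of all $(\tau_e)$, $e$ running over the sides of $P$ and the diagonals in $\Gamma''$, with $\tau_e=1$ for the four sides $ab,bc,cd,ad$ of $P_0$. -/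

import Mathlib

namespace PolygonDegeneration

open scoped LinearAlgebra.Projectivization

/-! ## Complex varieties as spaces with functions -/

/-- A set with a (Zariski) topology and a notion of complex-valued function regular on an open
set.  `regular U f` only concerns the values of `f` on `U`; it is meant for open `U`. -/
structure SpaceWithFunctions where
  carrier : Type
  top : TopologicalSpace carrier
  regular : Set carrier → (carrier → ℂ) → Prop

namespace SpaceWithFunctions

/-- An isomorphism: a homeomorphism under which the regular functions correspond. -/
structure Iso (X Y : SpaceWithFunctions) where
  toEquiv : X.carrier ≃ Y.carrier
  isOpen_iff : ∀ U : Set Y.carrier, Y.top.IsOpen U ↔ X.top.IsOpen (toEquiv ⁻¹' U)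
  regular_iff : ∀ U : Set Y.carrier, Y.top.IsOpen U → ∀ f : Y.carrier → ℂ,
    Y.regular U f ↔ X.regular (toEquiv ⁻¹' U) (f ∘ toEquiv)

/-- Affine space with the Zariski topology; regular functions are locally quotients of
polynomials. -/
def affine (κ : Type) : SpaceWithFunctions where
  carrier := κ → ℂ
  top := TopologicalSpace.generateFrom
    {U | ∃ f : MvPolynomial κ ℂ, U = {x | MvPolynomial.eval x f ≠ 0}}
  regular U F := ∀ x ∈ U, ∃ f g : MvPolynomial κ ℂ, MvPolynomial.eval x g ≠ 0 ∧
    ∀ y ∈ U, MvPolynomial.eval y g ≠ 0 →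
      F y = MvPolynomial.eval y f / MvPolynomial.eval y g

/-- The projective space of lines in `κ → ℂ` with the Zariski topology; regular functions are
locally quotients of homogeneous polynomials of the same degree. -/
noncomputable def projective (κ : Type) : SpaceWithFunctions where
  carrier := ℙ ℂ (κ → ℂ)
  top := TopologicalSpace.generateFrom
    {U | ∃ (m : ℕ) (f : MvPolynomial κ ℂ), f.IsHomogeneous m ∧
      U = {x | MvPolynomial.eval x.rep f ≠ 0}}
  regular U F := ∀ x ∈ U, ∃ (m : ℕ) (f g : MvPolynomial κ ℂ),
    f.IsHomogeneous m ∧ g.IsHomogeneous m ∧ MvPolynomial.eval x.rep g ≠ 0 ∧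
    ∀ y ∈ U, MvPolynomial.eval y.rep g ≠ 0 →
      F y = MvPolynomial.eval y.rep f / MvPolynomial.eval y.rep g

/-- A (locally closed) subset with its induced structure: the subspace topology, and functions
that extend locally to regular functions of the ambient space. -/
def restrict (X : SpaceWithFunctions) (s : Set X.carrier) : SpaceWithFunctions where
  carrier := s
  top := X.top.induced Subtype.val
  regular U F := ∀ x ∈ U, ∃ W : Set X.carrier, X.top.IsOpen W ∧ x.1 ∈ W ∧
    ∃ G : X.carrier → ℂ, X.regular W G ∧ ∀ y ∈ U, y.1 ∈ W → F y = G y.1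

/-- The quotient by the equivalence relation generated by `r`: the quotient topology, and
functions whose pull-back is regular. -/
def quot (X : SpaceWithFunctions) (r : X.carrier → X.carrier → Prop) : SpaceWithFunctions where
  carrier := Quot r
  top := X.top.coinduced (Quot.mk r)
  regular U F := X.regular (Quot.mk r ⁻¹' U) (F ∘ Quot.mk r)

/-- The product of varieties: on products `U × V` of open sets, the functions
`∑ fᵢ(x) gᵢ(y)` with `fᵢ`, `gᵢ` regular on `U`, `V` are regular, their non-vanishing loci
generate the topology, and regular functions are locally quotients of such functions. -/
def prod (X Y : SpaceWithFunctions) : SpaceWithFunctions where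
  carrier := X.carrier × Y.carrier
  top := TopologicalSpace.generateFrom
    {S | ∃ (U : Set X.carrier) (V : Set Y.carrier) (m : ℕ)
      (f : Fin m → X.carrier → ℂ) (g : Fin m → Y.carrier → ℂ),
      X.top.IsOpen U ∧ Y.top.IsOpen V ∧ (∀ i, X.regular U (f i)) ∧ (∀ i, Y.regular V (g i)) ∧
      S = {z | z.1 ∈ U ∧ z.2 ∈ V ∧ ∑ i, f i z.1 * g i z.2 ≠ 0}}
  regular S F := ∀ z ∈ S, ∃ (U : Set X.carrier) (V : Set Y.carrier) (m m' : ℕ)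
    (f : Fin m → X.carrier → ℂ) (g : Fin m → Y.carrier → ℂ)
    (f' : Fin m' → X.carrier → ℂ) (g' : Fin m' → Y.carrier → ℂ),
    X.top.IsOpen U ∧ Y.top.IsOpen V ∧ (∀ i, X.regular U (f i)) ∧ (∀ i, Y.regular V (g i)) ∧
    (∀ i, X.regular U (f' i)) ∧ (∀ i, Y.regular V (g' i)) ∧
    z.1 ∈ U ∧ z.2 ∈ V ∧ ∑ i, f' i z.1 * g' i z.2 ≠ 0 ∧
    ∀ y ∈ S, y.1 ∈ U → y.2 ∈ V → ∑ i, f' i y.1 * g' i y.2 ≠ 0 →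
      F y = (∑ i, f i y.1 * g i y.2) / ∑ i, f' i y.1 * g' i y.2

/-- The orbit space of a group acting through `act` on a subset `Y` of affine space.  A variety
isomorphic to it (with its topology and its functions) is a geometric quotient of `Y`. -/
def geometricQuotient {κ H : Type} (act : H → (κ → ℂ) → (κ → ℂ)) (Y : Set (κ → ℂ)) :
    SpaceWithFunctions :=
  ((affine κ).restrict Y).quot fun y z => ∃ h, act h y.1 = z.1

/-- The semistable points of an affine variety `Y` for the linearization given by a character
`χ`: those at which some semi-invariant polynomial function of weight `χ ^ m`, `m > 0`, is not
zero. -/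
def semistable {κ H : Type} [Group H] (act : H → (κ → ℂ) → (κ → ℂ)) (χ : H →* ℂˣ)
    (Y : Set (κ → ℂ)) : Set (κ → ℂ) :=
  {y | y ∈ Y ∧ ∃ (m : ℕ) (f : MvPolynomial κ ℂ), 0 < m ∧
    (∀ h, ∀ z ∈ Y, MvPolynomial.eval (act h z) f = (χ h : ℂ) ^ m * MvPolynomial.eval z f) ∧
    MvPolynomial.eval y f ≠ 0}

/-- The closure, inside the semistable locus, of the orbit of a semistable point. -/
def orbitClosure {κ H : Type} [Group H] (act : H → (κ → ℂ) → (κ → ℂ)) (χ : H →* ℂˣ)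
    (Y : Set (κ → ℂ)) (y : semistable act χ Y) : Set (semistable act χ Y) :=
  @closure _ ((affine κ).restrict (semistable act χ Y)).top {z | ∃ h, act h y.1 = z.1}

/-- The GIT quotient of an affine variety `Y` linearized by a character `χ`: semistable points,
two of them being identified when the closures of their orbits in the semistable locus meet. -/
def gitQuotient {κ H : Type} [Group H] (act : H → (κ → ℂ) → (κ → ℂ)) (χ : H →* ℂˣ)
    (Y : Set (κ → ℂ)) : SpaceWithFunctions :=
  ((affine κ).restrict (semistable act χ Y)).quot fun y z =>
    (orbitClosure act χ Y y ∩ orbitClosure act χ Y z).Nonempty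

end SpaceWithFunctions

open SpaceWithFunctions

/-! ## Plücker coordinates -/

/-- The index set of the coordinates `p_{ij}`, `i < j`, of `⋀² ℂ^I`. -/
abbrev Pairs (I : Type) [LinearOrder I] : Type := {q : I × I // q.1 < q.2}

/-- For `i < j` in a finite linear order, seen as a cyclic order: `i` and `j` are adjacent. -/
def CyclicallyAdjacent {I : Type} [LinearOrder I] (i j : I) : Prop :=
  (∀ k, ¬ (i < k ∧ k < j)) ∨ (∀ k, i ≤ k ∧ k ≤ j)

instance {n : ℕ} (i j : Fin n) : Decidable (CyclicallyAdjacent i j) := by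
  unfold CyclicallyAdjacent; infer_instance

/-- The cone over the Grassmannian `Gr(2, ℂ^I)`, cut out by the Plücker relations. -/
def grassCone (I : Type) [LinearOrder I] : Set (Pairs I → ℂ) :=
  {p | ∀ (i j k l : I) (hij : i < j) (hjk : j < k) (hkl : k < l),
    p ⟨(i, j), hij⟩ * p ⟨(k, l), hkl⟩
      - p ⟨(i, k), hij.trans hjk⟩ * p ⟨(j, l), hjk.trans hkl⟩
      + p ⟨(i, l), (hij.trans hjk).trans hkl⟩ * p ⟨(j, k), hjk⟩ = 0}

/-- `Gr°(2, ℂ^I)`: the points of the Grassmannian in `ℙ(⋀² ℂ^I)` at which no coordinate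
`p_{ij}` with `i`, `j` cyclically adjacent vanishes. -/
noncomputable def openGrass (I : Type) [LinearOrder I] : SpaceWithFunctions :=
  (projective (Pairs I)).restrict
    {x : ℙ ℂ (Pairs I → ℂ) | x.rep ∈ grassCone I ∧
      ∀ q : Pairs I, CyclicallyAdjacent q.1.1 q.1.2 → x.rep q ≠ 0}

/-! ## Subdivisions of the polygon with vertices `Fin n`

The chord joining the vertices `k < l` is the pair `(k, l)`.  The `i`-th side joins the vertex
`i` to its cyclic successor. -/

variable {n : ℕ}

/-- A diagonal: a chord that is not a side. -/
def IsDiagonal (e : Fin n × Fin n) : Prop :=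
  e.1 < e.2 ∧ ¬ CyclicallyAdjacent e.1 e.2

/-- Chords that do not cross inside the polygon, by means of the sets `{i, …, j - 1}` of the sides
cut off by a chord `(i, j)`. -/
def NonCrossing (e f : Fin n × Fin n) : Prop :=
  Finset.Ico e.1 e.2 ⊆ Finset.Ico f.1 f.2 ∨ Finset.Ico f.1 f.2 ⊆ Finset.Ico e.1 e.2 ∨
    Disjoint (Finset.Ico e.1 e.2) (Finset.Ico f.1 f.2)

/-- A triangulation, as its set of diagonals: a maximal set of non-crossing diagonals. -/
def IsTriangulation (Γ : Finset (Fin n × Fin n)) : Prop :=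
  (∀ e ∈ Γ, IsDiagonal e) ∧ (∀ e ∈ Γ, ∀ f ∈ Γ, NonCrossing e f) ∧
    ∀ e, IsDiagonal e → (∀ f ∈ Γ, NonCrossing e f) → e ∈ Γ

/-- `Γ'` arises from `Γ` by replacing the diagonal `ac` of the quadrilateral `abcd` by `bd`. -/
def IsWhiteheadMove (Γ Γ' : Finset (Fin n × Fin n)) (a b c d : Fin n) : Prop :=
  a < b ∧ b < c ∧ c < d ∧ (a, c) ∈ Γ ∧ (b, d) ∈ Γ' ∧ Γ.erase (a, c) = Γ'.erase (b, d)

/-- The path in the dual tree joining the leaves of the `i`-th and the `j`-th side crosses the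
chord with ends `v`, `w`: exactly one of the two sides is cut off by the chord. -/
def OnPath (v w i j : Fin n) : Prop :=
  ¬ (i ∈ Finset.Ico (min v w) (max v w) ↔ j ∈ Finset.Ico (min v w) (max v w))

instance (v w i j : Fin n) : Decidable (OnPath v w i j) := by
  unfold OnPath; infer_instance

/-! ## The degenerating family -/

/-- Twice the weight of `p_{ij}` with respect to `t_e`. -/
def weight (e : Fin n × Fin n) (i j : Fin n) : ℕ := if OnPath e.1 e.2 i j then 1 else 0

/-- Twice the largest weight with respect to `t_e` of a monomial of
`F_{ijkl} = p_{ij} p_{kl} - p_{ik} p_{jl} + p_{il} p_{jk}`. -/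
def maxWeight (e : Fin n × Fin n) (i j k l : Fin n) : ℕ :=
  max (weight e i j + weight e k l)
    (max (weight e i k + weight e j l) (weight e i l + weight e j k))

/-- The coefficient `∏ t_e ^ (w_e(F) - w_e(p_{xy} p_{zw}))` which the monomial `p_{xy} p_{zw}` of
`F = F_{ijkl}` gets in `t ^ w(F) F(t ^ (-w) p)`.  The difference of the doubled weights is even. -/
def tCoeff (Γ : Finset (Fin n × Fin n)) (t : Γ → ℂ) (i j k l x y z w : Fin n) : ℂ :=
  ∏ e : Γ, t e ^ ((maxWeight e.1 i j k l - (weight e.1 x y + weight e.1 z w)) / 2)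

/-- The total space of the family attached to a set of diagonals `Γ`, cut out by the equations
`t ^ w(F) F(t ^ (-w) p) = 0` for the Plücker relations `F = F_{ijkl}`. -/
noncomputable def family (Γ : Finset (Fin n × Fin n)) :
    Set (ℙ ℂ (Pairs (Fin n) → ℂ) × (Γ → ℂ)) :=
  {x | ∀ (i j k l : Fin n) (hij : i < j) (hjk : j < k) (hkl : k < l),
    tCoeff Γ x.2 i j k l i j k l * (x.1.rep ⟨(i, j), hij⟩ * x.1.rep ⟨(k, l), hkl⟩)
      - tCoeff Γ x.2 i j k l i k j l *
        (x.1.rep ⟨(i, k), hij.trans hjk⟩ * x.1.rep ⟨(j, l), hjk.trans hkl⟩)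
      + tCoeff Γ x.2 i j k l i l j k *
        (x.1.rep ⟨(i, l), (hij.trans hjk).trans hkl⟩ * x.1.rep ⟨(j, k), hjk⟩) = 0}

/-- The subfamily of the family of `Γ` on which `t_e = 1` for the diagonals `e` of `Γ` outside
`S`. -/
noncomputable def subfamily (Γ S : Finset (Fin n × Fin n)) :
    Set (ℙ ℂ (Pairs (Fin n) → ℂ) × (S → ℂ)) :=
  {x | (x.1, fun e : Γ => if h : e.1 ∈ S then x.2 ⟨e.1, h⟩ else 1) ∈ family Γ}

/-- The central fiber `X₀` of the subfamily. -/
noncomputable def centralFiber (Γ S : Finset (Fin n × Fin n)) :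
    Set (ℙ ℂ (Pairs (Fin n) → ℂ)) :=
  {x | (x, 0) ∈ subfamily Γ S}

/-- The divisor `D₀ = ⋃ {p_{i,i+1} = 0}`, indices being cyclic. -/
noncomputable def boundaryDivisor (n : ℕ) : Set (ℙ ℂ (Pairs (Fin n) → ℂ)) :=
  {x | ∃ q : Pairs (Fin n), CyclicallyAdjacent q.1.1 q.1.2 ∧ x.rep q = 0}

/-! ## The forest -/

/-- The vertex of the polygon with vertex set `V` that follows `v` cyclically.  The edge of `V`
from `v` to this vertex is labelled by `v`. -/
def nextVertex (V : Finset (Fin n)) (v : V) : Fin n :=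
  if h : (V.filter (v.1 < ·)).Nonempty then (V.filter (v.1 < ·)).min' h else V.min' ⟨v.1, v.2⟩

/-- The chord with ends `v`, `w` is a side of the polygon. -/
def IsSide (v w : Fin n) : Prop := CyclicallyAdjacent (min v w) (max v w)

instance (v w : Fin n) : Decidable (IsSide v w) := by unfold IsSide; infer_instance

/-- `V` is the vertex set of one of the polygons obtained by cutting along the diagonals in `S`:
its edges are sides or belong to `S`, and its diagonals do not belong to `S`. -/
def IsCell (S : Finset (Fin n × Fin n)) (V : Finset (Fin n)) : Prop :=
  3 ≤ V.card ∧
    (∀ v : V, IsSide v.1 (nextVertex V v) ∨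
      (min v.1 (nextVertex V v), max v.1 (nextVertex V v)) ∈ S) ∧
    ∀ v w : V, (v.1, w.1) ∈ S → nextVertex V v = w.1 ∨ nextVertex V w = v.1

instance (S : Finset (Fin n × Fin n)) : DecidablePred (IsCell S) := fun V => by
  unfold IsCell; infer_instance

/-- The subpolygons into which `S` cuts the polygon. -/
abbrev Cell (S : Finset (Fin n × Fin n)) : Type := {V : Finset (Fin n) // IsCell S V}

/-- The disjoint union of the sets of edges of all subpolygons (each edge labelled by the vertex
where it starts). -/
abbrev ForestEdge (S : Finset (Fin n × Fin n)) : Type := Σ α : Cell S, (α.1 : Finset (Fin n))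

/-- The index set of all coordinates `p_{ε,ε'}`, for `ε`, `ε'` edges of one subpolygon. -/
abbrev ForestPair (S : Finset (Fin n × Fin n)) : Type :=
  Σ α : Cell S, Pairs (α.1 : Finset (Fin n))

/-- The product over the subpolygons of the cones over the Grassmannians of their edges. -/
def coneProduct (S : Finset (Fin n × Fin n)) : Set (ForestPair S → ℂ) :=
  {y | ∀ α : Cell S, (fun q => y ⟨α, q⟩) ∈ grassCone (α.1 : Finset (Fin n))}

/-- The product of the open parts of the cones where `p_{ε,ε'} ≠ 0` for adjacent edges. -/
def openConeProduct (S : Finset (Fin n × Fin n)) : Set (ForestPair S → ℂ) :=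
  {y | y ∈ coneProduct S ∧ ∀ (α : Cell S) (q : Pairs (α.1 : Finset (Fin n))),
    CyclicallyAdjacent q.1.1 q.1.2 → y ⟨α, q⟩ ≠ 0}

/-- The action of the torus of the forest: `p_{ε,ε'} ↦ τ_ε τ_ε' p_{ε,ε'}`. -/
def forestAct (S : Finset (Fin n × Fin n)) (τ : ForestEdge S → ℂˣ) (y : ForestPair S → ℂ) :
    ForestPair S → ℂ :=
  fun q => (τ ⟨q.1, q.2.1.1⟩ : ℂ) * (τ ⟨q.1, q.2.1.2⟩ : ℂ) * y q

/-- The torus `ℂˣ_{∂P} × ∏_{ε ∈ S} ℂˣ_{ε⁺,ε⁻}`. -/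
abbrev GluingTorus (S : Finset (Fin n × Fin n)) : Type := ℂˣ × (S → ℂˣ)

/-- The inclusion of the gluing torus into the torus of the forest: the first factor is diagonal
in the sides of the polygon, and the factor of `ε ∈ S` acts on the two copies of `ε` by `σ` and
`σ⁻¹`. -/
def gluingEmbed (S : Finset (Fin n × Fin n)) : GluingTorus S →* (ForestEdge S → ℂˣ) where
  toFun h := fun ε =>
    if h₁ : (ε.2.1, nextVertex ε.1.1 ε.2) ∈ S then h.2 ⟨_, h₁⟩
    else if h₂ : (nextVertex ε.1.1 ε.2, ε.2.1) ∈ S then (h.2 ⟨_, h₂⟩)⁻¹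
    else h.1
  map_one' := by
    funext ε
    simp only [Prod.fst_one, Prod.snd_one, Pi.one_apply]
    split_ifs <;> simp
  map_mul' h k := by
    funext ε
    simp only [Pi.mul_apply]
    split_ifs <;> simp [mul_comm]

/-- The action of the gluing torus on the space of all coordinates of the forest. -/
def gluingAct (S : Finset (Fin n × Fin n)) (h : GluingTorus S) (y : ForestPair S → ℂ) :
    ForestPair S → ℂ :=
  forestAct S (gluingEmbed S h) y

/-- `p_{ij} = ∏ p_{ε,ε'}`, over the pairs of edges `ε`, `ε'` of the same subpolygon that lie on the
path from the `i`-th to the `j`-th leaf. -/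
noncomputable def gluedPlucker (S : Finset (Fin n × Fin n)) (y : ForestPair S → ℂ) :
    Pairs (Fin n) → ℂ :=
  fun ij => ∏ α : Cell S, ∏ q : Pairs (α.1 : Finset (Fin n)),
    if OnPath q.1.1.1 (nextVertex α.1 q.1.1) ij.1.1 ij.1.2 ∧
        OnPath q.1.2.1 (nextVertex α.1 q.1.2) ij.1.1 ij.1.2
    then y ⟨α, q⟩ else 1

/-! ## Tori as varieties -/

/-- The edges of the dual tree of the subdivision `S`: the diagonals in `S` and the sides. -/
abbrev TreeEdge (S : Finset (Fin n × Fin n)) : Type :=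
  {e : Fin n × Fin n // e ∈ S ∨ (e.1 < e.2 ∧ IsSide e.1 e.2)}

/-- The torus of those `τ = (τ_e)`, `e` running over the edges of the dual tree, with `τ_e = 1`
for the four sides `e` of the quadrilateral `abcd`. -/
noncomputable def complementaryTorus (S : Finset (Fin n × Fin n)) (a b c d : Fin n) :
    SpaceWithFunctions :=
  (affine (TreeEdge S)).restrict
    {τ : TreeEdge S → ℂ | (∀ e, τ e ≠ 0) ∧
      ∀ e, (e.1 = (a, b) ∨ e.1 = (b, c) ∨ e.1 = (c, d) ∨ e.1 = (a, d)) → τ e = 1}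

/-- The algebraic torus `(ℂˣ)^m`. -/
noncomputable def algTorus (m : ℕ) : SpaceWithFunctions :=
  (affine (Fin m)).restrict {τ : Fin m → ℂ | ∀ i, τ i ≠ 0}

end PolygonDegeneration

open PolygonDegeneration PolygonDegeneration.SpaceWithFunctions

/-! ### Spaces with functions: morphisms, rational maps and products. -/

namespace PolygonDegeneration

open scoped LinearAlgebra.Projectivization
open MvPolynomial (eval IsHomogeneous)

namespace SpaceWithFunctions

/-! ## Morphisms -/

/-! Write S for the common subdivision. At `t = 0` the middle monomial of a three-term Plücker
relation always survives, and each outer monomial dies exactly when a diagonal of S separates its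
two pairs of indices. Hence the central fibre is cut out by two kinds of equations (`IsInitial`,
`mem_centralFiber_iff`): for each diagonal in S the block of coordinates joining its two sides has
rank one, and quadruples not split by S satisfy the full Plücker relation.

Glued coordinates satisfy these equations because every cell is a bottleneck: if two leaves reach a
cell through different edges, their coordinate is the cell's own coordinate times one factor for
each leaf (`gluedPlucker_eq_reach`, `isInitial_gluedPlucker`). Conversely, rank-one factorizations
along all diagonals recover coordinates on the cells, so the gluing map hits every point of the
central fibre (`exists_gluedPlucker_eq`).

For the GIT quotient it remains to know the semi-invariants. The torus acts diagonally, so monomials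
suffice. Invariance under the factor of a diagonal forces equal degrees in its two copies. A
coordinate occurring in the monomial can therefore be continued from cell to cell until a path
between two leaves is complete, and the corresponding path monomial divides the given one
(`IsBalanced.exists_gluedExp_le`). By induction on the degree, the path monomials generate
(`IsBalanced.exists_eq_bind₁`). From generators and image, `QuotientData.iso` produces the quotient:
the Nullstellensatz separates disjoint closed sets, and passing to a weight component, justified by
independence of characters (`eval_weightComponent`), takes the place of averaging over the group.

Away from the boundary divisor, adjacent coordinates of every cell are non-zero
(`mem_openConeProduct_iff`), and every orbit contains a unique point whose first-and-last coordinate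
is `1` in each cell. The normalized point is given by ratios of the `p_{ij}`, so it is a regular
section (`exists_gluingAct_eq_sectionCoord`, `normalizedIso`). A quotient map with a section is an
isomorphism onto its image, which gives the geometric quotient. A triangle carries no Plücker
relation, so the normalized locus is the normalized Grassmannian of the quadrilateral times a torus
with two coordinates for each triangle (`normalizedConeIso`).

The numbers come from counting: cells correspond to the diagonals in S together with the chord from
the first to the last vertex (`card_cell`), and each other vertex is strictly inside exactly one
cell (`sum_card_cells`). -/

/-- A continuous map that pulls back regular functions to regular functions. -/
structure IsMorphism (X Y : SpaceWithFunctions) (φ : X.carrier → Y.carrier) : Prop where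
  isOpen_preimage : ∀ U, Y.top.IsOpen U → X.top.IsOpen (φ ⁻¹' U)
  regular_comp : ∀ U, Y.top.IsOpen U → ∀ f, Y.regular U f → X.regular (φ ⁻¹' U) (f ∘ φ)

theorem IsMorphism.comp {X Y Z : SpaceWithFunctions} {φ : X.carrier → Y.carrier}
    {ψ : Y.carrier → Z.carrier} (hψ : IsMorphism Y Z ψ) (hφ : IsMorphism X Y φ) :
    IsMorphism X Z (ψ ∘ φ) where
  isOpen_preimage U hU := hφ.isOpen_preimage _ (hψ.isOpen_preimage U hU)
  regular_comp U hU f hf :=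
    hφ.regular_comp _ (hψ.isOpen_preimage U hU) _ (hψ.regular_comp U hU f hf)

/-- Two mutually inverse morphisms form an isomorphism. -/
def Iso.ofMorphisms {X Y : SpaceWithFunctions} (e : X.carrier ≃ Y.carrier)
    (h : IsMorphism X Y e) (h' : IsMorphism Y X e.symm) : Iso X Y where
  toEquiv := e
  isOpen_iff U := ⟨h.isOpen_preimage U, fun hU => by
    have := h'.isOpen_preimage _ hU
    rwa [← Set.preimage_comp, Equiv.self_comp_symm, Set.preimage_id] at this⟩
  regular_iff U hU f := ⟨h.regular_comp U hU f, fun hf => by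
    have := h'.regular_comp _ (h.isOpen_preimage U hU) _ hf
    rwa [← Set.preimage_comp, Function.comp_assoc, Equiv.self_comp_symm, Set.preimage_id,
      Function.comp_id] at this⟩

theorem Iso.isMorphism {X Y : SpaceWithFunctions} (e : Iso X Y) : IsMorphism X Y e.toEquiv where
  isOpen_preimage U hU := (e.isOpen_iff U).1 hU
  regular_comp U hU f hf := (e.regular_iff U hU f).1 hf

theorem Iso.isMorphism_symm {X Y : SpaceWithFunctions} (e : Iso X Y) :
    IsMorphism Y X e.toEquiv.symm where
  isOpen_preimage U hU := by
    rw [e.isOpen_iff, ← Set.preimage_comp, Equiv.symm_comp_self]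
    exact hU
  regular_comp U hU f hf := by
    have hU' : Y.top.IsOpen (e.toEquiv.symm ⁻¹' U) := by
      rw [e.isOpen_iff, ← Set.preimage_comp, Equiv.symm_comp_self]
      exact hU
    rw [e.regular_iff _ hU', ← Set.preimage_comp, Function.comp_assoc, Equiv.symm_comp_self]
    exact hf

/-- The inverse isomorphism. -/
def Iso.symm {X Y : SpaceWithFunctions} (e : Iso X Y) : Iso Y X :=
  Iso.ofMorphisms e.toEquiv.symm e.isMorphism_symm e.isMorphism

/-- The composition of isomorphisms. -/
def Iso.trans {X Y Z : SpaceWithFunctions} (e : Iso X Y) (e' : Iso Y Z) : Iso X Z :=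
  Iso.ofMorphisms (e.toEquiv.trans e'.toEquiv) (e'.isMorphism.comp e.isMorphism)
    (e.isMorphism_symm.comp e'.isMorphism_symm)

/-! ## Local descriptions of affine and projective varieties -/

/-- Products of polynomials show that principal open sets are stable under intersection, so they
form a basis. Openness can then be tested with one polynomial at each point. -/
theorem affine_isOpen_iff {κ : Type} {U : Set (κ → ℂ)} :
    (affine κ).top.IsOpen U ↔
      ∀ x ∈ U, ∃ f : MvPolynomial κ ℂ, eval x f ≠ 0 ∧ ∀ y, eval y f ≠ 0 → y ∈ U := by
  constructor
  · intro h
    change TopologicalSpace.GenerateOpen _ U at h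
    induction h with
    | basic s hs =>
      obtain ⟨f, rfl⟩ := hs
      exact fun x hx => ⟨f, hx, fun y hy => hy⟩
    | univ => exact fun x _ => ⟨1, by simp, fun y _ => trivial⟩
    | inter s t _ _ hs ht =>
      intro x hx
      obtain ⟨f, hf, hf'⟩ := hs x hx.1
      obtain ⟨g, hg, hg'⟩ := ht x hx.2
      refine ⟨f * g, by simp [hf, hg], fun y hy => ?_⟩
      rw [map_mul] at hy
      exact ⟨hf' y (left_ne_zero_of_mul hy), hg' y (right_ne_zero_of_mul hy)⟩
    | sUnion S _ ih =>
      rintro x ⟨s, hs, hx⟩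
      obtain ⟨f, hf, hf'⟩ := ih s hs x hx
      exact ⟨f, hf, fun y hy => ⟨s, hs, hf' y hy⟩⟩
  · intro h
    choose! f hf hf' using h
    have : U = ⋃₀ {V | ∃ x ∈ U, V = {y | eval y (f x) ≠ 0}} := by
      ext y
      constructor
      · exact fun hy => ⟨_, ⟨y, hy, rfl⟩, hf y hy⟩
      · rintro ⟨_, ⟨x, hx, rfl⟩, hy⟩
        exact hf' x hx y hy
    rw [this]
    refine TopologicalSpace.GenerateOpen.sUnion _ ?_
    rintro _ ⟨x, _, rfl⟩
    exact TopologicalSpace.GenerateOpen.basic _ ⟨f x, rfl⟩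

theorem projective_isOpen_iff {κ : Type} {U : Set (ℙ ℂ (κ → ℂ))} :
    (projective κ).top.IsOpen U ↔
      ∀ x ∈ U, ∃ (m : ℕ) (f : MvPolynomial κ ℂ), f.IsHomogeneous m ∧ eval x.rep f ≠ 0 ∧
        ∀ y : ℙ ℂ (κ → ℂ), eval y.rep f ≠ 0 → y ∈ U := by
  constructor
  · intro h
    change TopologicalSpace.GenerateOpen _ U at h
    induction h with
    | basic s hs =>
      obtain ⟨m, f, hm, rfl⟩ := hs
      exact fun x hx => ⟨m, f, hm, hx, fun y hy => hy⟩
    | univ => exact fun x _ => ⟨0, 1, MvPolynomial.isHomogeneous_one _ _, by simp,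
        fun y _ => trivial⟩
    | inter s t _ _ hs ht =>
      intro x hx
      obtain ⟨m, f, hm, hf, hf'⟩ := hs x hx.1
      obtain ⟨k, g, hk, hg, hg'⟩ := ht x hx.2
      refine ⟨m + k, f * g, hm.mul hk, by simp [hf, hg], fun y hy => ?_⟩
      rw [map_mul] at hy
      exact ⟨hf' y (left_ne_zero_of_mul hy), hg' y (right_ne_zero_of_mul hy)⟩
    | sUnion S _ ih =>
      rintro x ⟨s, hs, hx⟩
      obtain ⟨m, f, hm, hf, hf'⟩ := ih s hs x hx
      exact ⟨m, f, hm, hf, fun y hy => ⟨s, hs, hf' y hy⟩⟩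
  · intro h
    choose! m f hm hf hf' using h
    have : U = ⋃₀ {V | ∃ x ∈ U, V = {y | eval y.rep (f x) ≠ 0}} := by
      ext y
      constructor
      · exact fun hy => ⟨_, ⟨y, hy, rfl⟩, hf y hy⟩
      · rintro ⟨_, ⟨x, hx, rfl⟩, hy⟩
        exact hf' x hx y hy
    rw [this]
    refine TopologicalSpace.GenerateOpen.sUnion _ ?_
    rintro _ ⟨x, hx, rfl⟩
    exact TopologicalSpace.GenerateOpen.basic _ ⟨m x, f x, hm x hx, rfl⟩

theorem restrict_isOpen_iff {X : SpaceWithFunctions} {s : Set X.carrier} {U : Set s} :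
    (X.restrict s).top.IsOpen U ↔ ∃ V, X.top.IsOpen V ∧ Subtype.val ⁻¹' V = U :=
  Iff.rfl

theorem affine_restrict_isOpen_iff {κ : Type} {s : Set (κ → ℂ)} {U : Set s} :
    ((affine κ).restrict s).top.IsOpen U ↔
      ∀ x ∈ U, ∃ f : MvPolynomial κ ℂ, eval x.1 f ≠ 0 ∧ ∀ y : s, eval y.1 f ≠ 0 → y ∈ U := by
  refine restrict_isOpen_iff.trans ?_
  constructor
  · rintro ⟨V, hV, rfl⟩ x hx
    obtain ⟨f, hf, hf'⟩ := affine_isOpen_iff.1 hV x.1 hx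
    exact ⟨f, hf, fun y hy => hf' _ hy⟩
  · intro h
    refine ⟨{z | ∃ f : MvPolynomial κ ℂ, eval z f ≠ 0 ∧ ∀ y : s, eval y.1 f ≠ 0 → y ∈ U},
      affine_isOpen_iff.2 ?_, ?_⟩
    · rintro z ⟨f, hf, hf'⟩
      exact ⟨f, hf, fun y hy => ⟨f, hy, hf'⟩⟩
    · ext x
      exact ⟨fun ⟨f, hf, hf'⟩ => hf' x hf, fun hx => h x hx⟩

theorem projective_restrict_isOpen_iff {κ : Type} {s : Set (ℙ ℂ (κ → ℂ))} {U : Set s} :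
    ((projective κ).restrict s).top.IsOpen U ↔
      ∀ x ∈ U, ∃ (m : ℕ) (f : MvPolynomial κ ℂ), f.IsHomogeneous m ∧ eval x.1.rep f ≠ 0 ∧
        ∀ y : s, eval y.1.rep f ≠ 0 → y ∈ U := by
  refine restrict_isOpen_iff.trans ?_
  constructor
  · rintro ⟨V, hV, rfl⟩ x hx
    obtain ⟨m, f, hm, hf, hf'⟩ := projective_isOpen_iff.1 hV x.1 hx
    exact ⟨m, f, hm, hf, fun y hy => hf' _ hy⟩
  · intro h
    refine ⟨{z : ℙ ℂ (κ → ℂ) | ∃ (m : ℕ) (f : MvPolynomial κ ℂ), f.IsHomogeneous m ∧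
      eval z.rep f ≠ 0 ∧ ∀ y : s, eval y.1.rep f ≠ 0 → y ∈ U}, projective_isOpen_iff.2 ?_, ?_⟩
    · rintro z ⟨m, f, hm, hf, hf'⟩
      exact ⟨m, f, hm, hf, fun y hy => ⟨m, f, hm, hy, hf'⟩⟩
    · ext x
      exact ⟨fun ⟨m, f, _, hf, hf'⟩ => hf' x hf, fun hx => h x hx⟩

/-- The auxiliary neighbourhood in the ambient space can be shrunk to a principal open set, whose
equation is then absorbed by multiplying numerator and denominator with it. -/
theorem affine_restrict_regular_iff {κ : Type} {s : Set (κ → ℂ)} {U : Set s} {F : s → ℂ} :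
    ((affine κ).restrict s).regular U F ↔
      ∀ x ∈ U, ∃ f g : MvPolynomial κ ℂ, eval x.1 g ≠ 0 ∧
        ∀ y ∈ U, eval y.1 g ≠ 0 → F y = eval y.1 f / eval y.1 g := by
  constructor
  · intro h x hx
    obtain ⟨W, hW, hxW, G, hG, hFG⟩ := h x hx
    obtain ⟨p, hp, hpW⟩ := affine_isOpen_iff.1 hW x.1 hxW
    obtain ⟨f, g, hg, hfg⟩ := hG x.1 hxW
    refine ⟨p * f, p * g, by simp [hp, hg], fun y hy hyg => ?_⟩
    rw [map_mul] at hyg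
    have hyp := left_ne_zero_of_mul hyg
    rw [hFG y hy (hpW _ hyp), hfg _ (hpW _ hyp) (right_ne_zero_of_mul hyg), map_mul, map_mul,
      mul_div_mul_left _ _ hyp]
  · intro h x hx
    obtain ⟨f, g, hg, hfg⟩ := h x hx
    refine ⟨{y | eval y g ≠ 0}, affine_isOpen_iff.2 fun y hy => ⟨g, hy, fun _ h => h⟩, hg,
      fun y => eval y f / eval y g, fun y hy => ⟨f, g, hy, fun _ _ _ => rfl⟩, hfg⟩

theorem projective_restrict_regular_iff {κ : Type} {s : Set (ℙ ℂ (κ → ℂ))} {U : Set s}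
    {F : s → ℂ} :
    ((projective κ).restrict s).regular U F ↔
      ∀ x ∈ U, ∃ (m : ℕ) (f g : MvPolynomial κ ℂ), f.IsHomogeneous m ∧ g.IsHomogeneous m ∧
        eval x.1.rep g ≠ 0 ∧
        ∀ y ∈ U, eval y.1.rep g ≠ 0 → F y = eval y.1.rep f / eval y.1.rep g := by
  constructor
  · intro h x hx
    obtain ⟨W, hW, hxW, G, hG, hFG⟩ := h x hx
    obtain ⟨k, p, hk, hp, hpW⟩ := projective_isOpen_iff.1 hW x.1 hxW
    obtain ⟨m, f, g, hf, hg, hgx, hfg⟩ := hG x.1 hxW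
    refine ⟨k + m, p * f, p * g, hk.mul hf, hk.mul hg, by simp [hp, hgx], fun y hy hyg => ?_⟩
    rw [map_mul] at hyg
    have hyp := left_ne_zero_of_mul hyg
    rw [hFG y hy (hpW _ hyp), hfg _ (hpW _ hyp) (right_ne_zero_of_mul hyg), map_mul, map_mul,
      mul_div_mul_left _ _ hyp]
  · intro h x hx
    obtain ⟨m, f, g, hf, hg, hgx, hfg⟩ := h x hx
    refine ⟨{y : ℙ ℂ (κ → ℂ) | eval y.rep g ≠ 0},
      projective_isOpen_iff.2 fun y hy => ⟨m, g, hg, hy, fun _ h => h⟩, hgx,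
      fun y : ℙ ℂ (κ → ℂ) => eval y.rep f / eval y.rep g,
      fun y hy => ⟨m, f, g, hf, hg, hy, fun _ _ _ => rfl⟩, hfg⟩

theorem eval_smul_of_isHomogeneous {κ : Type} {m : ℕ} {f : MvPolynomial κ ℂ}
    (hf : f.IsHomogeneous m) (c : ℂ) (v : κ → ℂ) : eval (c • v) f = c ^ m * eval v f := by
  rw [MvPolynomial.eval_eq, MvPolynomial.eval_eq, Finset.mul_sum]
  refine Finset.sum_congr rfl fun d hd => ?_
  have h := MvPolynomial.IsHomogeneous.degree_eq_sum_deg_support hf hd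
  simp only [Pi.smul_apply, smul_eq_mul, mul_pow, Finset.prod_mul_distrib,
    Finset.prod_pow_eq_pow_sum, ← h]
  ring

/-- Representatives of projective points are arbitrary choices. This is the only control over them,
and it suffices because zero loci and equal-degree ratios of homogeneous polynomials ignore the
scalar. -/
theorem exists_rep_mk_eq_smul {κ : Type} (v : κ → ℂ) (hv : v ≠ 0) :
    ∃ c : ℂ, c ≠ 0 ∧ (Projectivization.mk ℂ v hv).rep = c • v := by
  obtain ⟨a, ha⟩ := Projectivization.exists_smul_eq_mk_rep ℂ v hv
  exact ⟨a, a.ne_zero, ha.symm⟩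

theorem eval_rep_mk_ne_zero_iff {κ : Type} {m : ℕ} {f : MvPolynomial κ ℂ}
    (hf : f.IsHomogeneous m) (v : κ → ℂ) (hv : v ≠ 0) :
    eval (Projectivization.mk ℂ v hv).rep f ≠ 0 ↔ eval v f ≠ 0 := by
  obtain ⟨c, hc, h⟩ := exists_rep_mk_eq_smul v hv
  rw [h, eval_smul_of_isHomogeneous hf]
  simp [hc]

theorem eval_rep_mk_div {κ : Type} {m : ℕ} {f g : MvPolynomial κ ℂ}
    (hf : f.IsHomogeneous m) (hg : g.IsHomogeneous m) (v : κ → ℂ) (hv : v ≠ 0) :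
    eval (Projectivization.mk ℂ v hv).rep f / eval (Projectivization.mk ℂ v hv).rep g =
      eval v f / eval v g := by
  obtain ⟨c, hc, h⟩ := exists_rep_mk_eq_smul v hv
  rw [h, eval_smul_of_isHomogeneous hf, eval_smul_of_isHomogeneous hg,
    mul_div_mul_left _ _ (pow_ne_zero _ hc)]

/-! ## Polynomial and rational maps -/

theorem eval_bind₁_eq {κ ι : Type} (P : ι → MvPolynomial κ ℂ) (f : MvPolynomial ι ℂ)
    (x : κ → ℂ) : eval x (MvPolynomial.bind₁ P f) = eval (fun i => eval x (P i)) f := by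
  change MvPolynomial.eval₂Hom (RingHom.id ℂ) x (MvPolynomial.bind₁ P f) = _
  rw [MvPolynomial.eval₂Hom_bind₁]
  rfl

theorem isMorphism_affine_affine {κ ι : Type} {s : Set (κ → ℂ)} {t : Set (ι → ℂ)}
    (φ : s → t) (P : ι → MvPolynomial κ ℂ) (hφ : ∀ x i, (φ x).1 i = eval x.1 (P i)) :
    IsMorphism ((affine κ).restrict s) ((affine ι).restrict t) φ := by
  have key : ∀ x f, eval (φ x).1 f = eval x.1 (MvPolynomial.bind₁ P f) := fun x f => by
    rw [eval_bind₁_eq, funext (hφ x)]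
  constructor
  · intro U hU
    replace hU := affine_restrict_isOpen_iff.1 hU
    refine affine_restrict_isOpen_iff.2 ?_
    intro x hx
    obtain ⟨f, hf, hf'⟩ := hU _ hx
    refine ⟨MvPolynomial.bind₁ P f, by rwa [← key], fun y hy => hf' _ (by rwa [key])⟩
  · intro U hU F hF
    replace hF := affine_restrict_regular_iff.1 hF
    refine affine_restrict_regular_iff.2 ?_
    intro x hx
    obtain ⟨f, g, hg, hfg⟩ := hF _ hx
    refine ⟨MvPolynomial.bind₁ P f, MvPolynomial.bind₁ P g, by rwa [← key], fun y hy hyg => ?_⟩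
    rw [← key] at hyg
    refine (hfg _ hy hyg).trans ?_
    rw [key, key]

theorem isMorphism_affine_projective {κ ι : Type} {s : Set (κ → ℂ)} {t : Set (ℙ ℂ (ι → ℂ))}
    (φ : s → t) (P : ι → MvPolynomial κ ℂ) (hP : ∀ x : s, (fun i => eval x.1 (P i)) ≠ 0)
    (hφ : ∀ x, (φ x).1 = Projectivization.mk ℂ _ (hP x)) :
    IsMorphism ((affine κ).restrict s) ((projective ι).restrict t) φ := by
  constructor
  · intro U hU
    refine affine_restrict_isOpen_iff.2 ?_
    replace hU := projective_restrict_isOpen_iff.1 hU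
    intro x hx
    obtain ⟨m, f, hm, hf, hf'⟩ := hU _ hx
    refine ⟨MvPolynomial.bind₁ P f, ?_, fun y hy => hf' _ ?_⟩
    · rwa [eval_bind₁_eq, ← eval_rep_mk_ne_zero_iff hm _ (hP x), ← hφ]
    · rwa [eval_bind₁_eq, ← eval_rep_mk_ne_zero_iff hm _ (hP y), ← hφ] at hy
  · intro U hU F hF
    refine affine_restrict_regular_iff.2 ?_
    replace hF := projective_restrict_regular_iff.1 hF
    intro x hx
    obtain ⟨m, f, g, hfm, hgm, hg, hfg⟩ := hF _ hx
    refine ⟨MvPolynomial.bind₁ P f, MvPolynomial.bind₁ P g, ?_, fun y hy hyg => ?_⟩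
    · rwa [eval_bind₁_eq, ← eval_rep_mk_ne_zero_iff hgm _ (hP x), ← hφ]
    · rw [eval_bind₁_eq, ← eval_rep_mk_ne_zero_iff hgm _ (hP y), ← hφ] at hyg
      change F (φ y) = _
      rw [hfg _ hy hyg, eval_bind₁_eq, eval_bind₁_eq,
        ← eval_rep_mk_div hfm hgm _ (hP y), ← hφ]

/-- A function on `s` given globally by a quotient of homogeneous polynomials of the same
degree. -/
def IsRatio {κ : Type} (s : Set (ℙ ℂ (κ → ℂ))) (F : s → ℂ) : Prop :=
  ∃ (m : ℕ) (f g : MvPolynomial κ ℂ), f.IsHomogeneous m ∧ g.IsHomogeneous m ∧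
    ∀ x : s, eval x.1.rep g ≠ 0 ∧ F x = eval x.1.rep f / eval x.1.rep g

theorem IsRatio.add {κ : Type} {s : Set (ℙ ℂ (κ → ℂ))} {F G : s → ℂ} (hF : IsRatio s F)
    (hG : IsRatio s G) : IsRatio s (fun x => F x + G x) := by
  obtain ⟨m, f, g, hf, hg, h⟩ := hF
  obtain ⟨m', f', g', hf', hg', h'⟩ := hG
  refine ⟨m + m', f * g' + g * f', g * g', (hf.mul hg').add (hg.mul hf'), hg.mul hg',
    fun x => ⟨?_, ?_⟩⟩
  · rw [map_mul]
    exact mul_ne_zero (h x).1 (h' x).1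
  · change F x + G x = _
    rw [(h x).2, (h' x).2, div_add_div _ _ (h x).1 (h' x).1]
    simp

theorem IsRatio.mul {κ : Type} {s : Set (ℙ ℂ (κ → ℂ))} {F G : s → ℂ} (hF : IsRatio s F)
    (hG : IsRatio s G) : IsRatio s (fun x => F x * G x) := by
  obtain ⟨m, f, g, hf, hg, h⟩ := hF
  obtain ⟨m', f', g', hf', hg', h'⟩ := hG
  refine ⟨m + m', f * f', g * g', hf.mul hf', hg.mul hg', fun x => ⟨?_, ?_⟩⟩
  · rw [map_mul]
    exact mul_ne_zero (h x).1 (h' x).1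
  · change F x * G x = _
    rw [(h x).2, (h' x).2, div_mul_div_comm]
    simp

theorem IsRatio.eval {κ ι : Type} {s : Set (ℙ ℂ (κ → ℂ))} {φ : s → ι → ℂ}
    (hφ : ∀ i, IsRatio s fun x => φ x i) (f : MvPolynomial ι ℂ) :
    IsRatio s fun x => eval (φ x) f := by
  induction f using MvPolynomial.induction_on with
  | C a => exact ⟨0, .C a, 1, MvPolynomial.isHomogeneous_C _ _, MvPolynomial.isHomogeneous_one _ _,
      by simp⟩
  | add p q hp hq => simpa using hp.add hq
  | mul_X p i hp => simpa using hp.mul (hφ i)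

theorem IsRatio.exists_eval_eq_div {κ ι : Type} {s : Set (ℙ ℂ (κ → ℂ))} {φ : s → ι → ℂ}
    (hφ : ∀ i, IsRatio s fun x => φ x i) (F : MvPolynomial ι ℂ) :
    ∃ (m : ℕ) (f g : MvPolynomial κ ℂ), f.IsHomogeneous m ∧ g.IsHomogeneous m ∧
      ∀ x : s, MvPolynomial.eval x.1.rep g ≠ 0 ∧
        MvPolynomial.eval (φ x) F = MvPolynomial.eval x.1.rep f / MvPolynomial.eval x.1.rep g :=
  IsRatio.eval hφ F

theorem isMorphism_projective_affine {κ ι : Type} {s : Set (ℙ ℂ (κ → ℂ))} {t : Set (ι → ℂ)}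
    (φ : s → t) (hφ : ∀ i, IsRatio s fun x => (φ x).1 i) :
    IsMorphism ((projective κ).restrict s) ((affine ι).restrict t) φ := by
  constructor
  · intro U hU
    replace hU := affine_restrict_isOpen_iff.1 hU
    refine projective_restrict_isOpen_iff.2 ?_
    intro x hx
    obtain ⟨f, hf, hf'⟩ := hU _ hx
    obtain ⟨m, a, b, ha, hb, hab⟩ := IsRatio.exists_eval_eq_div hφ f
    refine ⟨m, a, ha, fun h0 => hf ?_, fun y hy => hf' _ ?_⟩
    · rw [(hab x).2, h0, zero_div]
    · rw [(hab y).2]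
      exact div_ne_zero hy (hab y).1
  · intro U hU F hF
    replace hF := affine_restrict_regular_iff.1 hF
    refine projective_restrict_regular_iff.2 ?_
    intro x hx
    obtain ⟨f, g, hg, hfg⟩ := hF _ hx
    obtain ⟨m, a, b, ha, hb, hab⟩ := IsRatio.exists_eval_eq_div hφ f
    obtain ⟨m', a', b', ha', hb', hab'⟩ := IsRatio.exists_eval_eq_div hφ g
    refine ⟨m + m', a * b', b * a', ha.mul hb', hb.mul ha', ?_, fun y hy hyg => ?_⟩
    · rw [map_mul]
      refine mul_ne_zero (hab x).1 fun h0 => hg ?_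
      rw [(hab' x).2, h0, zero_div]
    · rw [map_mul] at hyg
      have hg' : eval (φ y).1 g ≠ 0 := by
        rw [(hab' y).2]
        exact div_ne_zero (right_ne_zero_of_mul hyg) (hab' y).1
      change F (φ y) = _
      rw [hfg _ hy hg', (hab y).2, (hab' y).2, div_div_div_eq, map_mul,
        map_mul]

/-! ## Products -/

theorem IsMorphism.prodMap {X X' Y Y' : SpaceWithFunctions} {φ : X.carrier → X'.carrier}
    {ψ : Y.carrier → Y'.carrier} (hφ : IsMorphism X X' φ) (hψ : IsMorphism Y Y' ψ) :
    IsMorphism (prod X Y) (prod X' Y') (Prod.map φ ψ) := by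
  constructor
  · intro S hS
    change TopologicalSpace.GenerateOpen _ S at hS
    change TopologicalSpace.GenerateOpen _ _
    induction hS with
    | basic S hS =>
      obtain ⟨U, V, m, f, g, hU, hV, hf, hg, rfl⟩ := hS
      exact .basic _ ⟨φ ⁻¹' U, ψ ⁻¹' V, m, fun i => f i ∘ φ, fun i => g i ∘ ψ,
        hφ.isOpen_preimage U hU, hψ.isOpen_preimage V hV,
        fun i => hφ.regular_comp U hU _ (hf i), fun i => hψ.regular_comp V hV _ (hg i), rfl⟩
    | univ => exact .univ
    | inter s t _ _ hs ht => exact .inter _ _ hs ht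
    | sUnion T _ ih =>
      have : Prod.map φ ψ ⁻¹' ⋃₀ T = ⋃₀ ((fun s => Prod.map φ ψ ⁻¹' s) '' T) :=
        Set.ext fun z => by
          rw [Set.mem_sUnion]
          exact ⟨fun ⟨s, hs, hz⟩ => ⟨_, ⟨s, hs, rfl⟩, hz⟩, fun ⟨_, ⟨s, hs, h⟩, hz⟩ =>
            ⟨s, hs, by subst h; exact hz⟩⟩
      change TopologicalSpace.GenerateOpen _ (Prod.map φ ψ ⁻¹' ⋃₀ T)
      rw [this]
      refine .sUnion _ ?_
      rintro _ ⟨s, hs, rfl⟩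
      exact ih s hs
  · intro S _ F hF z hz
    obtain ⟨U, V, m, m', f, g, f', g', hU, hV, hf, hg, hf', hg', hzU, hzV, hne, h⟩ := hF _ hz
    exact ⟨φ ⁻¹' U, ψ ⁻¹' V, m, m', fun i => f i ∘ φ, fun i => g i ∘ ψ, fun i => f' i ∘ φ,
      fun i => g' i ∘ ψ, hφ.isOpen_preimage U hU, hψ.isOpen_preimage V hV,
      fun i => hφ.regular_comp U hU _ (hf i), fun i => hψ.regular_comp V hV _ (hg i),
      fun i => hφ.regular_comp U hU _ (hf' i), fun i => hψ.regular_comp V hV _ (hg' i),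
      hzU, hzV, hne, fun y hy => h _ hy⟩

/-- The product of isomorphisms. -/
def Iso.prodCongr {X X' Y Y' : SpaceWithFunctions} (e : Iso X X') (e' : Iso Y Y') :
    Iso (prod X Y) (prod X' Y') :=
  Iso.ofMorphisms (e.toEquiv.prodCongr e'.toEquiv) (e.isMorphism.prodMap e'.isMorphism)
    (e.isMorphism_symm.prodMap e'.isMorphism_symm)

/-- A monomial in two groups of variables is a product of a monomial in each; the index runs over
the monomials of `F`. This links polynomials on the product to the sums in the definition of `prod`.
-/
theorem exists_eval_sumElim_eq {κ ι : Type} [Fintype κ] [Fintype ι]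
    (F : MvPolynomial (κ ⊕ ι) ℂ) :
    ∃ (m : ℕ) (f : Fin m → MvPolynomial κ ℂ) (g : Fin m → MvPolynomial ι ℂ),
      ∀ x y, eval (Sum.elim x y) F = ∑ i, eval x (f i) * eval y (g i) := by
  refine ⟨F.support.card,
    fun i => .C (F.coeff (F.support.equivFin.symm i).1) *
      ∏ k, .X k ^ (F.support.equivFin.symm i).1 (Sum.inl k),
    fun i => ∏ k, .X k ^ (F.support.equivFin.symm i).1 (Sum.inr k), fun x y => ?_⟩
  rw [MvPolynomial.eval_eq', ← Finset.sum_coe_sort, ← Equiv.sum_comp F.support.equivFin.symm]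
  refine Finset.sum_congr rfl fun i _ => ?_
  simp [Fintype.prod_sum_type, mul_assoc]

/-- The product of two subsets of affine spaces. -/
def prodSet {κ ι : Type} (s : Set (κ → ℂ)) (t : Set (ι → ℂ)) : Set (κ ⊕ ι → ℂ) :=
  {z | z ∘ Sum.inl ∈ s ∧ z ∘ Sum.inr ∈ t}

theorem regular_eval {κ : Type} (s : Set (κ → ℂ)) (U : Set s) (f : MvPolynomial κ ℂ) :
    ((affine κ).restrict s).regular U (fun x : s => eval x.1 f) :=
  affine_restrict_regular_iff.2 fun _ _ => ⟨f, 1, by simp, by simp⟩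

/-- Summands are brought to a common denominator one at a time. The denominator of the empty sum
already cuts out a neighbourhood inside `U × V`, so all later denominators stay inside it. -/
theorem exists_sum_mul_eq_div {κ ι : Type} {s : Set (κ → ℂ)} {t : Set (ι → ℂ)} {U : Set s}
    {V : Set t} (hU : ((affine κ).restrict s).top.IsOpen U)
    (hV : ((affine ι).restrict t).top.IsOpen V) {m : ℕ} (f : Fin m → s → ℂ) (g : Fin m → t → ℂ)
    (hf : ∀ i, ((affine κ).restrict s).regular U (f i))
    (hg : ∀ i, ((affine ι).restrict t).regular V (g i)) {x : s} {y : t} (hx : x ∈ U) (hy : y ∈ V)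
    (J : Finset (Fin m)) :
    ∃ A B : MvPolynomial (κ ⊕ ι) ℂ, eval (Sum.elim x.1 y.1) B ≠ 0 ∧
      ∀ (x' : s) (y' : t), eval (Sum.elim x'.1 y'.1) B ≠ 0 → x' ∈ U ∧ y' ∈ V ∧
        ∑ i ∈ J, f i x' * g i y' =
          eval (Sum.elim x'.1 y'.1) A / eval (Sum.elim x'.1 y'.1) B := by
  have hl : ∀ (p : MvPolynomial κ ℂ) (z : κ → ℂ) (w : ι → ℂ),
      eval (Sum.elim z w) (MvPolynomial.rename Sum.inl p) = eval z p := fun p z w => by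
    rw [MvPolynomial.eval_rename, Sum.elim_comp_inl]
  have hr : ∀ (p : MvPolynomial ι ℂ) (z : κ → ℂ) (w : ι → ℂ),
      eval (Sum.elim z w) (MvPolynomial.rename Sum.inr p) = eval w p := fun p z w => by
    rw [MvPolynomial.eval_rename, Sum.elim_comp_inr]
  induction J using Finset.induction_on with
  | empty =>
    obtain ⟨p, hp, hp'⟩ := affine_restrict_isOpen_iff.1 hU x hx
    obtain ⟨q, hq, hq'⟩ := affine_restrict_isOpen_iff.1 hV y hy
    refine ⟨0, MvPolynomial.rename Sum.inl p * MvPolynomial.rename Sum.inr q, ?_,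
      fun x' y' h => ?_⟩
    · rw [map_mul, hl, hr]
      exact mul_ne_zero hp hq
    · rw [map_mul, hl, hr] at h
      exact ⟨hp' _ (left_ne_zero_of_mul h), hq' _ (right_ne_zero_of_mul h), by simp⟩
  | insert i J hi ih =>
    obtain ⟨A, B, hB, hAB⟩ := ih
    obtain ⟨a, b, hb, hab⟩ := affine_restrict_regular_iff.1 (hf i) x hx
    obtain ⟨c, d, hd, hcd⟩ := affine_restrict_regular_iff.1 (hg i) y hy
    refine ⟨MvPolynomial.rename Sum.inl a * MvPolynomial.rename Sum.inr c * B +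
        MvPolynomial.rename Sum.inl b * MvPolynomial.rename Sum.inr d * A,
      MvPolynomial.rename Sum.inl b * MvPolynomial.rename Sum.inr d * B, ?_, fun x' y' h => ?_⟩
    · rw [map_mul, map_mul, hl, hr]
      exact mul_ne_zero (mul_ne_zero hb hd) hB
    · rw [map_mul, map_mul, hl, hr] at h
      have hB' := right_ne_zero_of_mul h
      have hbd := left_ne_zero_of_mul h
      obtain ⟨hx', hy', hs⟩ := hAB x' y' hB'
      refine ⟨hx', hy', ?_⟩
      rw [Finset.sum_insert hi, hs, hab _ hx' (left_ne_zero_of_mul hbd),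
        hcd _ hy' (right_ne_zero_of_mul hbd), div_mul_div_comm, div_add_div _ _ hbd hB']
      simp only [map_mul, map_add, hl, hr]

/-- The bijection between a product of affine subvarieties and their product in affine space. -/
def prodSetEquiv {κ ι : Type} (s : Set (κ → ℂ)) (t : Set (ι → ℂ)) : s × t ≃ prodSet s t where
  toFun := fun z => ⟨Sum.elim z.1.1 z.2.1, z.1.2, z.2.2⟩
  invFun := fun z => (⟨z.1 ∘ Sum.inl, z.2.1⟩, ⟨z.1 ∘ Sum.inr, z.2.2⟩)
  left_inv := fun _ => rfl
  right_inv := fun z => Subtype.ext (Sum.elim_comp_inl_inr z.1)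

theorem isOpen_prod_of_forall {κ ι : Type} [Fintype κ] [Fintype ι] {s : Set (κ → ℂ)}
    {t : Set (ι → ℂ)} {S : Set (s × t)}
    (h : ∀ z ∈ S, ∃ f : MvPolynomial (κ ⊕ ι) ℂ, eval (Sum.elim z.1.1 z.2.1) f ≠ 0 ∧
      ∀ y : s × t, eval (Sum.elim y.1.1 y.2.1) f ≠ 0 → y ∈ S) :
    (prod ((affine κ).restrict s) ((affine ι).restrict t)).top.IsOpen S := by
  change TopologicalSpace.GenerateOpen _ S
  have : S = ⋃₀ {T : Set (s × t) | ∃ f : MvPolynomial (κ ⊕ ι) ℂ,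
      T = {z | eval (Sum.elim z.1.1 z.2.1) f ≠ 0} ∧ T ⊆ S} := by
    ext z
    constructor
    · intro hz
      obtain ⟨f, hf, hf'⟩ := h z hz
      exact ⟨_, ⟨f, rfl, fun y hy => hf' y hy⟩, hf⟩
    · rintro ⟨_, ⟨f, rfl, hS⟩, hz⟩
      exact hS hz
  rw [this]
  refine .sUnion _ ?_
  rintro _ ⟨f, rfl, -⟩
  obtain ⟨m, p, q, hpq⟩ := exists_eval_sumElim_eq f
  refine .basic _ ⟨Set.univ, Set.univ, m, fun i (z : s) => eval z.1 (p i),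
    fun i (z : t) => eval z.1 (q i), @isOpen_univ _ (_), @isOpen_univ _ (_),
    fun i => regular_eval _ _ _, fun i => regular_eval _ _ _, ?_⟩
  ext z
  change _ ≠ _ ↔ _ ∧ _ ∧ _ ≠ _
  rw [hpq]
  exact ⟨fun h => ⟨trivial, trivial, h⟩, fun h => h.2.2⟩

theorem isMorphism_prodSetEquiv {κ ι : Type} [Fintype κ] [Fintype ι] (s : Set (κ → ℂ))
    (t : Set (ι → ℂ)) :
    IsMorphism (prod ((affine κ).restrict s) ((affine ι).restrict t))
      ((affine (κ ⊕ ι)).restrict (prodSet s t)) (prodSetEquiv s t) := by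
  constructor
  · intro U hU
    refine isOpen_prod_of_forall fun z hz => ?_
    obtain ⟨f, hf, hf'⟩ := affine_restrict_isOpen_iff.1 hU _ hz
    exact ⟨f, hf, fun y hy => hf' (prodSetEquiv s t y) hy⟩
  · intro U hU F hF z hz
    obtain ⟨f, g, hg, hfg⟩ := affine_restrict_regular_iff.1 hF _ hz
    obtain ⟨m, p, q, hpq⟩ := exists_eval_sumElim_eq f
    obtain ⟨m', p', q', hpq'⟩ := exists_eval_sumElim_eq g
    refine ⟨Set.univ, Set.univ, m, m', fun i (z : s) => eval z.1 (p i),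
      fun i (z : t) => eval z.1 (q i), fun i (z : s) => eval z.1 (p' i),
      fun i (z : t) => eval z.1 (q' i), @isOpen_univ _ (_), @isOpen_univ _ (_),
      fun i => regular_eval _ _ _, fun i => regular_eval _ _ _,
      fun i => regular_eval _ _ _, fun i => regular_eval _ _ _, trivial, trivial, ?_, ?_⟩
    · exact (hpq' z.1.1 z.2.1).symm.trans_ne hg
    · intro y hy _ _ hne
      refine (hfg _ hy ((hpq' y.1.1 y.2.1).trans_ne hne)).trans ?_
      exact congrArg₂ _ (hpq _ _) (hpq' _ _)

theorem isMorphism_prodSetEquiv_symm {κ ι : Type} (s : Set (κ → ℂ)) (t : Set (ι → ℂ)) :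
    IsMorphism ((affine (κ ⊕ ι)).restrict (prodSet s t))
      (prod ((affine κ).restrict s) ((affine ι).restrict t)) (prodSetEquiv s t).symm := by
  constructor
  · intro S hS
    change TopologicalSpace.GenerateOpen _ S at hS
    induction hS with
    | basic S hS =>
      obtain ⟨U, V, m, f, g, hU, hV, hf, hg, rfl⟩ := hS
      refine affine_restrict_isOpen_iff.2 ?_
      rintro z ⟨hz1, hz2, hz⟩
      obtain ⟨A, B, hB, hAB⟩ :=
        exists_sum_mul_eq_div hU hV f g hf hg hz1 hz2 Finset.univ
      have hez : ∀ z : prodSet s t, Sum.elim (z.1 ∘ Sum.inl) (z.1 ∘ Sum.inr) = z.1 :=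
        fun z => Sum.elim_comp_inl_inr z.1
      refine ⟨A * B, ?_, fun y hy => ?_⟩
      · rw [← hez z, map_mul]
        refine mul_ne_zero (fun h0 => hz ?_) hB
        refine (hAB ⟨_, z.2.1⟩ ⟨_, z.2.2⟩ hB).2.2.trans ?_
        rw [h0, zero_div]
      · rw [← hez y, map_mul] at hy
        have hB' := right_ne_zero_of_mul hy
        obtain ⟨h1, h2, h3⟩ := hAB ⟨_, y.2.1⟩ ⟨_, y.2.2⟩ hB'
        exact ⟨h1, h2, h3.trans_ne (div_ne_zero (left_ne_zero_of_mul hy) hB')⟩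
    | univ => exact @isOpen_univ _ (_)
    | inter s t _ _ hs ht => exact ((affine _).restrict _).top.isOpen_inter _ _ hs ht
    | sUnion T _ ih =>
      refine affine_restrict_isOpen_iff.2 ?_
      rintro z ⟨s, hs, hz⟩
      obtain ⟨f, hf, hf'⟩ := affine_restrict_isOpen_iff.1 (ih s hs) z hz
      exact ⟨f, hf, fun y hy => ⟨s, hs, hf' y hy⟩⟩
  · intro S _ F hF
    refine affine_restrict_regular_iff.2 fun z hz => ?_
    obtain ⟨U, V, m, m', f, g, f', g', hU, hV, hf, hg, hf', hg', hzU, hzV, hne, h⟩ :=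
      hF _ hz
    obtain ⟨A, B, hB, hAB⟩ := exists_sum_mul_eq_div hU hV f g hf hg hzU hzV Finset.univ
    obtain ⟨A', B', hB', hAB'⟩ :=
      exists_sum_mul_eq_div hU hV f' g' hf' hg' hzU hzV Finset.univ
    have hez : ∀ z : prodSet s t, Sum.elim (z.1 ∘ Sum.inl) (z.1 ∘ Sum.inr) = z.1 :=
      fun z => Sum.elim_comp_inl_inr z.1
    -- The quotient of `A / B` by `A' / B'` is `A * B' / (B * A')`. The extra `B'` makes the
    -- non-vanishing of the denominator imply that both local expressions are valid.
    refine ⟨A * B' * B', B * A' * B', ?_, fun y hy hyg => ?_⟩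
    · rw [← hez z, map_mul, map_mul]
      refine mul_ne_zero (mul_ne_zero hB fun h0 => hne ?_) hB'
      refine (hAB' ⟨_, z.2.1⟩ ⟨_, z.2.2⟩ hB').2.2.trans ?_
      rw [h0, zero_div]
    · rw [← hez y, map_mul, map_mul] at hyg
      have h1 := left_ne_zero_of_mul (left_ne_zero_of_mul hyg)
      have h2 := right_ne_zero_of_mul (left_ne_zero_of_mul hyg)
      have h3 := right_ne_zero_of_mul hyg
      obtain ⟨hyU, hyV, e1⟩ := hAB ⟨_, y.2.1⟩ ⟨_, y.2.2⟩ h1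
      obtain ⟨_, _, e2⟩ := hAB' ⟨_, y.2.1⟩ ⟨_, y.2.2⟩ h3
      refine (h _ hy hyU hyV (e2.trans_ne (div_ne_zero h2 h3))).trans ?_
      refine (congrArg₂ _ e1 e2).trans ?_
      rw [hez y] at h1 h2 h3
      change eval (Sum.elim (y.1 ∘ Sum.inl) (y.1 ∘ Sum.inr)) A / _ /
        (eval (Sum.elim (y.1 ∘ Sum.inl) (y.1 ∘ Sum.inr)) A' / _) = _
      rw [hez y, map_mul, map_mul, map_mul, map_mul]
      field_simp

/-- The product of two affine subvarieties is their product in affine space. -/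
noncomputable def affineProdIso {κ ι : Type} [Fintype κ] [Fintype ι] (s : Set (κ → ℂ))
    (t : Set (ι → ℂ)) :
    Iso (prod ((affine κ).restrict s) ((affine ι).restrict t))
      ((affine (κ ⊕ ι)).restrict (prodSet s t)) :=
  Iso.ofMorphisms (prodSetEquiv s t) (isMorphism_prodSetEquiv s t)
    (isMorphism_prodSetEquiv_symm s t)

end SpaceWithFunctions
end PolygonDegeneration

/-! ### GIT quotients of affine varieties by diagonal actions. -/

namespace PolygonDegeneration

open scoped LinearAlgebra.Projectivization
open MvPolynomial (eval IsHomogeneous)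

namespace SpaceWithFunctions

/-! ## Weights of monomials under a diagonal action -/

theorem aeval_apply_eq_eval {κ : Type} (x : κ → ℂ) (f : MvPolynomial κ ℂ) :
    MvPolynomial.aeval x f = eval x f := by
  rw [← MvPolynomial.coe_aeval_eq_eval]
  rfl

section Weights

variable {κ H : Type} [Fintype κ] [Group H]

/-- The character by which a diagonal action multiplies a monomial. -/
def monomialWeight (c : H →* (κ → ℂˣ)) (M : κ →₀ ℕ) : H →* ℂˣ where
  toFun h := ∏ q, c h q ^ M q
  map_one' := by simp
  map_mul' h k := by simp [mul_pow, Finset.prod_mul_distrib]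

open Classical in
/-- The part of a polynomial of weight `ψ`. -/
noncomputable def weightComponent (c : H →* (κ → ℂˣ)) (ψ : H →* ℂˣ) (f : MvPolynomial κ ℂ) :
    MvPolynomial κ ℂ :=
  ∑ M ∈ f.support with monomialWeight c M = ψ, MvPolynomial.monomial M (f.coeff M)

theorem eval_scale (c : H →* (κ → ℂˣ)) (h : H) (y : κ → ℂ) (f : MvPolynomial κ ℂ) :
    eval (fun q => (c h q : ℂ) * y q) f =
      ∑ M ∈ f.support, (f.coeff M * ∏ q, y q ^ M q) * (monomialWeight c M h : ℂ) := by
  rw [MvPolynomial.eval_eq']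
  refine Finset.sum_congr rfl fun M _ => ?_
  simp only [monomialWeight, MonoidHom.coe_mk, OneHom.coe_mk, mul_pow, Finset.prod_mul_distrib,
    Units.coe_prod, Units.val_pow_eq_pow_val]
  ring

/-- Along the orbit of `y` the polynomial is a linear combination of characters of `H`, and distinct
characters are linearly independent (Dedekind). So the coefficient of `ψ` must be `A`. Only the
behaviour on this one orbit matters; `f` need not be semi-invariant elsewhere. -/
theorem eval_weightComponent (c : H →* (κ → ℂˣ)) (ψ : H →* ℂˣ) (f : MvPolynomial κ ℂ)
    (y : κ → ℂ) (A : ℂ)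
    (hf : ∀ h, eval (fun q => (c h q : ℂ) * y q) f = (ψ h : ℂ) * A) :
    eval y (weightComponent c ψ f) = A := by
  classical
  have hli : LinearIndependent ℂ (M := H → ℂ)
      (fun θ : H →* ℂˣ => ((((Units.coeHom ℂ).comp θ : H →* ℂ)) : H → ℂ)) :=
    (linearIndependent_monoidHom H ℂ).comp (fun θ : H →* ℂˣ => (Units.coeHom ℂ).comp θ)
      fun θ θ' h => MonoidHom.ext fun x => Units.ext (DFunLike.congr_fun h x)
  rw [linearIndependent_iff'] at hli
  let T : Finset (H →* ℂˣ) := insert ψ (f.support.image (monomialWeight c))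
  -- The coefficient of `θ` in the difference of the two sides of `hf`, as functions on `H`.
  let g : (H →* ℂˣ) → ℂ := fun θ =>
    (∑ M ∈ f.support with monomialWeight c M = θ, f.coeff M * ∏ q, y q ^ M q) -
      if θ = ψ then A else 0
  have h0 : ∑ θ ∈ T, g θ • ((((Units.coeHom ℂ).comp θ : H →* ℂ)) : H → ℂ) = 0 := by
    funext h
    simp only [Finset.sum_apply, Pi.smul_apply, smul_eq_mul, Pi.zero_apply, g, sub_mul,
      Finset.sum_sub_distrib]
    rw [sub_eq_zero]
    have h1 : ∑ θ ∈ T, (if θ = ψ then A else 0) * ((Units.coeHom ℂ).comp θ : H →* ℂ) h =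
        (ψ h : ℂ) * A := by
      simp [ite_mul, T, mul_comm]
    rw [h1, ← hf, eval_scale, ← Finset.sum_fiberwise_of_maps_to (t := T)
      (g := monomialWeight c) (fun M hM => Finset.mem_insert_of_mem (Finset.mem_image_of_mem _ hM))]
    refine Finset.sum_congr rfl fun θ _ => ?_
    rw [Finset.sum_mul]
    refine Finset.sum_congr rfl fun M hM => ?_
    rw [(Finset.mem_filter.1 hM).2]
    rfl
  have h1 := hli T g h0 ψ (Finset.mem_insert_self _ _)
  simp only [g, if_true, sub_eq_zero] at h1
  rw [← h1, weightComponent, map_sum]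
  refine Finset.sum_congr rfl fun M _ => ?_
  rw [MvPolynomial.eval_monomial, Finsupp.prod_fintype _ _ (by simp)]

end Weights

theorem affine_restrict_mem_closure_iff {κ : Type} {s : Set (κ → ℂ)} {T : Set s} {x : s} :
    x ∈ @closure _ ((affine κ).restrict s).top T ↔
      ∀ f : MvPolynomial κ ℂ, eval x.1 f ≠ 0 → ∃ z ∈ T, eval z.1 f ≠ 0 := by
  refine (@mem_closure_iff _ ((affine κ).restrict s).top _ _).trans ?_
  constructor
  · intro h f hf
    obtain ⟨z, hz, hzT⟩ := h {z : s | eval z.1 f ≠ 0}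
      (affine_restrict_isOpen_iff.2 fun y hy => ⟨f, hy, fun z hz => hz⟩) hf
    exact ⟨z, hzT, hz⟩
  · intro h U hU hx
    obtain ⟨f, hf, hf'⟩ := affine_restrict_isOpen_iff.1 hU x hx
    obtain ⟨z, hz, hzf⟩ := h f hf
    exact ⟨z, hf' z hzf, hz⟩

/-- Vanishing of the two-by-two minors means proportionality. In this form equality of projective
points is a polynomial condition, which passes to closures. -/
theorem mk_eq_mk_of_cross {ι : Type} {v w : ι → ℂ} (hv : v ≠ 0) (hw : w ≠ 0)
    (h : ∀ i j, v i * w j = v j * w i) :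
    Projectivization.mk ℂ v hv = Projectivization.mk ℂ w hw := by
  obtain ⟨j, hj⟩ := Function.ne_iff.1 hw
  rw [Projectivization.mk_eq_mk_iff']
  refine ⟨v j / w j, funext fun i => ?_⟩
  have hj' : w j ≠ 0 := hj
  rw [Pi.smul_apply, smul_eq_mul, div_mul_eq_mul_div, ← h i j, mul_div_cancel_right₀ _ hj']

/-- A diagonal action of a group on an affine variety `Y`, semi-invariant polynomials `P` of
weight `χ ^ d` that generate all semi-invariants whose weight is a power of `χ`, and the image `X`
of the rational map that `P` defines. -/
structure QuotientData (κ ι H : Type) [Fintype κ] [Group H] where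
  c : H →* (κ → ℂˣ)
  act : H → (κ → ℂ) → (κ → ℂ)
  act_eq : ∀ h y, act h y = fun q => (c h q : ℂ) * y q
  χ : H →* ℂˣ
  Y : Set (κ → ℂ)
  mem_of_forall : ∀ y, (∀ f : MvPolynomial κ ℂ, (∀ z ∈ Y, eval z f = 0) → eval y f = 0) → y ∈ Y
  act_mem : ∀ h, ∀ y ∈ Y, act h y ∈ Y
  P : ι → MvPolynomial κ ℂ
  d : ℕ
  d_pos : 0 < d
  eval_act : ∀ h y i, eval (act h y) (P i) = (χ h : ℂ) ^ d * eval y (P i)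
  generate : ∀ (M : κ →₀ ℕ) (m : ℕ), monomialWeight c M = χ ^ m →
    ∃ (N : ℕ) (G : MvPolynomial ι ℂ), G.IsHomogeneous N ∧ m = d * N ∧
      MvPolynomial.monomial M 1 = MvPolynomial.bind₁ P G
  X : Set (ℙ ℂ (ι → ℂ))
  mk_mem : ∀ y ∈ Y, ∀ hy : (fun i => eval y (P i)) ≠ 0, Projectivization.mk ℂ _ hy ∈ X
  exists_mk_eq : ∀ x ∈ X, ∃ y ∈ Y, ∃ hy : (fun i => eval y (P i)) ≠ 0,
    Projectivization.mk ℂ _ hy = x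

namespace QuotientData

variable {κ ι H : Type} [Fintype κ] [Group H] (D : QuotientData κ ι H)

/-- The values of the generating semi-invariants. -/
noncomputable def val (y : κ → ℂ) : ι → ℂ := fun i => eval y (D.P i)

theorem val_act (h : H) (y : κ → ℂ) : D.val (D.act h y) = ((D.χ h : ℂ) ^ D.d) • D.val y :=
  funext fun i => D.eval_act h y i

theorem act_one (y : κ → ℂ) : D.act 1 y = y := by
  rw [D.act_eq]
  funext q
  simp

theorem act_act (h k : H) (y : κ → ℂ) : D.act h (D.act k y) = D.act (h * k) y := by
  rw [D.act_eq, D.act_eq, D.act_eq]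
  funext q
  simp [mul_assoc]

theorem exists_eq_bind₁_of_monomialWeight (N : ℕ) (M : κ →₀ ℕ)
    (hM : monomialWeight D.c M = D.χ ^ (D.d * N)) :
    ∃ G : MvPolynomial ι ℂ, G.IsHomogeneous N ∧
      MvPolynomial.monomial M 1 = MvPolynomial.bind₁ D.P G := by
  obtain ⟨N', G, hG, hN, h⟩ := D.generate M _ hM
  obtain rfl := Nat.eq_of_mul_eq_mul_left D.d_pos hN
  exact ⟨G, hG, h⟩

theorem exists_weightComponent_eq (N : ℕ) (f : MvPolynomial κ ℂ) :
    ∃ G : MvPolynomial ι ℂ, G.IsHomogeneous N ∧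
      weightComponent D.c (D.χ ^ (D.d * N)) f = MvPolynomial.bind₁ D.P G := by
  obtain ⟨T, hT', hT⟩ : ∃ T : Finset (κ →₀ ℕ),
      (∀ M ∈ T, monomialWeight D.c M = D.χ ^ (D.d * N)) ∧
      weightComponent D.c (D.χ ^ (D.d * N)) f =
        ∑ M ∈ T, MvPolynomial.monomial M (f.coeff M) := by
    classical exact ⟨_, fun M hM => (Finset.mem_filter.1 hM).2, rfl⟩
  rw [hT]
  clear hT
  induction T using Finset.induction_on with
  | empty => exact ⟨0, MvPolynomial.isHomogeneous_zero _ _ _, by simp⟩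
  | insert M T hM ih =>
    obtain ⟨G, hG, hGT⟩ := ih fun M' hM' => hT' M' (Finset.mem_insert_of_mem hM')
    obtain ⟨G', hG', hGM⟩ := D.exists_eq_bind₁_of_monomialWeight N M
      (hT' M (Finset.mem_insert_self _ _))
    have hadd : (MvPolynomial.C (f.coeff M) * G' + G).IsHomogeneous N :=
      MvPolynomial.IsHomogeneous.add (MvPolynomial.IsHomogeneous.C_mul hG' (f.coeff M)) hG
    refine ⟨MvPolynomial.C (f.coeff M) * G' + G, hadd, ?_⟩
    rw [Finset.sum_insert hM, hGT, map_add, map_mul, ← hGM, MvPolynomial.algHom_C,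
      MvPolynomial.algebraMap_eq, MvPolynomial.C_mul_monomial, mul_one]

theorem eval_weightComponent_eq (N : ℕ) (f : MvPolynomial κ ℂ) (y : κ → ℂ) (A : ℂ)
    (hf : ∀ h, eval (D.act h y) f = (D.χ h : ℂ) ^ (D.d * N) * A) :
    eval y (weightComponent D.c (D.χ ^ (D.d * N)) f) = A := by
  refine eval_weightComponent _ _ _ _ _ fun h => ?_
  rw [← D.act_eq, hf, MonoidHom.pow_apply, Units.val_pow_eq_pow_val]

/-- A semi-invariant that does not vanish at `y` has a monomial of weight `χ ^ m`, `m > 0`, not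
vanishing there. That monomial is a form of positive degree in the generators, so the generators
cannot all vanish at `y`. -/
theorem mem_semistable_iff (y : κ → ℂ) :
    y ∈ semistable D.act D.χ D.Y ↔ y ∈ D.Y ∧ D.val y ≠ 0 := by
  constructor
  · rintro ⟨hy, m, f, hm, hf, hfy⟩
    refine ⟨hy, fun h0 => ?_⟩
    have h1 : eval y (weightComponent D.c (D.χ ^ m) f) = eval y f := by
      refine eval_weightComponent _ _ _ _ _ fun h => ?_
      rw [← D.act_eq, hf h y hy, MonoidHom.pow_apply, Units.val_pow_eq_pow_val]
    rw [← h1, weightComponent, map_sum] at hfy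
    obtain ⟨M, hM, hMy⟩ := Finset.exists_ne_zero_of_sum_ne_zero hfy
    obtain ⟨N, G, hG, hN, h⟩ := D.generate M m (by classical exact (Finset.mem_filter.1 hM).2)
    have hN0 : N ≠ 0 := by
      rintro rfl
      omega
    have h2 : eval y (MvPolynomial.monomial M (1 : ℂ)) = 0 := by
      rw [h, eval_bind₁_eq]
      change eval (D.val y) G = 0
      rw [h0, ← zero_smul ℂ (0 : ι → ℂ), eval_smul_of_isHomogeneous hG, zero_pow hN0, zero_mul]
    rw [MvPolynomial.eval_monomial, one_mul] at h2
    rw [MvPolynomial.eval_monomial, h2, mul_zero] at hMy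
    exact hMy rfl
  · rintro ⟨hy, h0⟩
    obtain ⟨i, hi⟩ := Function.ne_iff.1 h0
    exact ⟨hy, D.d, D.P i, D.d_pos, fun h z _ => D.eval_act h z i, hi⟩

/-- The map from the semistable points to projective space. -/
noncomputable def toX (y : semistable D.act D.χ D.Y) : D.X :=
  ⟨Projectivization.mk ℂ (D.val y.1) ((D.mem_semistable_iff y.1).1 y.2).2,
    D.mk_mem y.1 y.2.1 _⟩

theorem act_mem_semistable (h : H) {y : κ → ℂ} (hy : y ∈ semistable D.act D.χ D.Y) :
    D.act h y ∈ semistable D.act D.χ D.Y := by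
  rw [mem_semistable_iff] at hy ⊢
  refine ⟨D.act_mem h y hy.1, ?_⟩
  rw [D.val_act]
  exact smul_ne_zero (pow_ne_zero _ (D.χ h).ne_zero) hy.2

theorem toX_act (h : H) (y : semistable D.act D.χ D.Y) :
    D.toX ⟨D.act h y.1, D.act_mem_semistable h y.2⟩ = D.toX y := by
  refine Subtype.ext ?_
  change Projectivization.mk ℂ _ _ = Projectivization.mk ℂ _ _
  rw [Projectivization.mk_eq_mk_iff']
  exact ⟨_, (D.val_act h y.1).symm⟩

/-- The minors comparing the generators at a variable point with those at `y` vanish on the orbit of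
`y`, hence on its closure. -/
theorem toX_eq_of_mem_orbitClosure {y w : semistable D.act D.χ D.Y}
    (hw : w ∈ orbitClosure D.act D.χ D.Y y) : D.toX w = D.toX y := by
  refine Subtype.ext (mk_eq_mk_of_cross _ _ fun i j => ?_)
  by_contra hne
  obtain ⟨z, ⟨h, hz⟩, hne'⟩ := affine_restrict_mem_closure_iff.1 hw
    (D.P i * .C (D.val y.1 j) - D.P j * .C (D.val y.1 i))
    (by simpa [sub_eq_zero, val] using hne)
  refine hne' ?_
  rw [← hz]
  simp only [map_sub, map_mul, MvPolynomial.eval_C, D.eval_act, val]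
  ring

/-- Invariants separate a stable set from an orbit if their closures are disjoint. -/
theorem exists_separating (Z : Set (semistable D.act D.χ D.Y))
    (hZ : ∀ h, ∀ w ∈ Z, (⟨D.act h w.1, D.act_mem_semistable h w.2⟩ : semistable _ _ _) ∈ Z)
    (z : semistable D.act D.χ D.Y)
    (hd : ∀ w ∈ @closure _ ((affine κ).restrict (semistable D.act D.χ D.Y)).top Z,
      w ∉ orbitClosure D.act D.χ D.Y z) :
    ∃ (N : ℕ) (G : MvPolynomial ι ℂ), G.IsHomogeneous N ∧ (∀ w ∈ Z, eval (D.val w.1) G = 0) ∧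
      eval (D.val z.1) G ≠ 0 := by
  obtain ⟨i, hi⟩ := Function.ne_iff.1 ((D.mem_semistable_iff z.1).1 z.2).2
  let I₁ : Ideal (MvPolynomial κ ℂ) :=
    MvPolynomial.vanishingIdeal ℂ {w | ∃ h : w ∈ semistable D.act D.χ D.Y, ⟨w, h⟩ ∈ Z}
  let I₂ : Ideal (MvPolynomial κ ℂ) := MvPolynomial.vanishingIdeal ℂ {w | ∃ h, D.act h z.1 = w}
  -- Nullstellensatz: a common zero of both ideals at which `P i` is not zero would be a semistable
  -- point in both closures.
  have hrad : D.P i ∈ (I₁ ⊔ I₂).radical := by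
    rw [← MvPolynomial.vanishingIdeal_zeroLocus_eq_radical (K := ℂ),
      MvPolynomial.mem_vanishingIdeal_iff]
    intro w hw
    rw [MvPolynomial.mem_zeroLocus_iff] at hw
    have hw1 : ∀ f : MvPolynomial κ ℂ, (∀ u ∈ Z, eval u.1 f = 0) → eval w f = 0 := by
      intro f hf
      rw [← aeval_apply_eq_eval]
      refine hw f (Ideal.mem_sup_left ?_)
      rw [MvPolynomial.mem_vanishingIdeal_iff]
      rintro u ⟨h, hu⟩
      rw [aeval_apply_eq_eval]
      exact hf ⟨u, h⟩ hu
    have hw2 : ∀ f : MvPolynomial κ ℂ, (∀ h, eval (D.act h z.1) f = 0) → eval w f = 0 := by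
      intro f hf
      rw [← aeval_apply_eq_eval]
      refine hw f (Ideal.mem_sup_right ?_)
      rw [MvPolynomial.mem_vanishingIdeal_iff]
      rintro u ⟨h, rfl⟩
      rw [aeval_apply_eq_eval]
      exact hf h
    rw [aeval_apply_eq_eval]
    by_contra hne
    have hwss : w ∈ semistable D.act D.χ D.Y := by
      rw [mem_semistable_iff]
      exact ⟨D.mem_of_forall w fun f hf => hw1 f fun u _ => hf _ u.2.1,
        fun h0 => hne (congrFun h0 i)⟩
    refine hd ⟨w, hwss⟩ (affine_restrict_mem_closure_iff.2 fun f hf => ?_)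
      (affine_restrict_mem_closure_iff.2 fun f hf => ?_)
    · by_contra! hcon
      exact hf (hw1 f hcon)
    · by_contra! hcon
      exact hf (hw2 f fun h => hcon ⟨_, D.act_mem_semistable h z.2⟩ ⟨h, rfl⟩)
  -- From `P i ^ N = f₁ + f₂`, the polynomial `f₁` vanishes on `Z` and equals `P i ^ N` on the orbit
  -- of `z`. Its component of weight `χ ^ (d * N)` inherits both properties and is a form in the
  -- generators.
  obtain ⟨N, hN⟩ := hrad
  obtain ⟨f₁, hf₁, f₂, hf₂, hsum⟩ := Submodule.mem_sup.1 hN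
  obtain ⟨G, hG, hGf⟩ := D.exists_weightComponent_eq N f₁
  refine ⟨N, G, hG, fun w hw => ?_, ?_⟩
  · change eval (fun i => eval w.1 (D.P i)) G = 0
    rw [← eval_bind₁_eq, ← hGf]
    refine D.eval_weightComponent_eq N f₁ w.1 0 fun h => ?_
    rw [mul_zero, ← aeval_apply_eq_eval]
    exact MvPolynomial.mem_vanishingIdeal_iff.1 hf₁ _ ⟨_, hZ h w hw⟩
  · change eval (fun i => eval z.1 (D.P i)) G ≠ 0
    rw [← eval_bind₁_eq, ← hGf, D.eval_weightComponent_eq N f₁ z.1 (eval z.1 (D.P i) ^ N)]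
    · exact pow_ne_zero _ hi
    · intro h
      have h2 : eval (D.act h z.1) f₂ = 0 := by
        rw [← aeval_apply_eq_eval]
        exact MvPolynomial.mem_vanishingIdeal_iff.1 hf₂ _ ⟨h, rfl⟩
      have h3 := congrArg (eval (D.act h z.1)) hsum
      rw [map_add, h2, add_zero, map_pow, D.eval_act] at h3
      rw [h3]
      ring

theorem eval_toX_rep_ne_zero_iff {m : ℕ} {G : MvPolynomial ι ℂ} (hG : G.IsHomogeneous m)
    (y : semistable D.act D.χ D.Y) :
    eval (D.toX y).1.rep G ≠ 0 ↔ eval (D.val y.1) G ≠ 0 :=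
  eval_rep_mk_ne_zero_iff hG _ _

theorem exists_toX_eq (x : D.X) : ∃ y, D.toX y = x := by
  obtain ⟨y, hy, h, hx⟩ := D.exists_mk_eq x.1 x.2
  exact ⟨⟨y, (D.mem_semistable_iff y).2 ⟨hy, h⟩⟩, Subtype.ext hx⟩

theorem orbitClosure_inter_nonempty {y z : semistable D.act D.χ D.Y} (h : D.toX y = D.toX z) :
    (orbitClosure D.act D.χ D.Y y ∩ orbitClosure D.act D.χ D.Y z).Nonempty := by
  by_contra hne
  obtain ⟨N, G, hG, h1, h2⟩ := D.exists_separating {w | ∃ h, D.act h y.1 = w.1}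
    (by
      rintro h w ⟨k, hk⟩
      exact ⟨h * k, by rw [← D.act_act, hk]⟩) z
    (fun w hw hw' => hne ⟨w, hw, hw'⟩)
  rw [← D.eval_toX_rep_ne_zero_iff hG, ← h, D.eval_toX_rep_ne_zero_iff hG] at h2
  exact h2 (h1 y ⟨1, D.act_one _⟩)

theorem isMorphism_toX :
    IsMorphism ((affine κ).restrict (semistable D.act D.χ D.Y)) ((projective ι).restrict D.X)
      D.toX :=
  isMorphism_affine_projective _ D.P (fun y => ((D.mem_semistable_iff y.1).1 y.2).2)
    fun _ => rfl

/-- The complement of the preimage is closed and invariant. It misses the orbit closure of every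
point above `U`, because the map is constant on orbit closures; an invariant separating the two
gives a basic neighbourhood below. -/
theorem isOpen_of_isOpen_preimage (U : Set D.X)
    (hU : ((affine κ).restrict (semistable D.act D.χ D.Y)).top.IsOpen (D.toX ⁻¹' U)) :
    ((projective ι).restrict D.X).top.IsOpen U := by
  refine projective_restrict_isOpen_iff.2 fun x hx => ?_
  obtain ⟨z, rfl⟩ := D.exists_toX_eq x
  obtain ⟨N, G, hG, h1, h2⟩ := D.exists_separating (D.toX ⁻¹' U)ᶜ
    (fun h w hw => by
      rw [Set.mem_compl_iff, Set.mem_preimage, D.toX_act]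
      exact hw) z
    (fun w hw hw' => by
      have hcl := (@isClosed_compl_iff _ ((affine κ).restrict (semistable D.act D.χ D.Y)).top
        (D.toX ⁻¹' U)).2 hU
      have hw := (@IsClosed.closure_eq _ ((affine κ).restrict (semistable D.act D.χ D.Y)).top
        _ hcl).subset hw
      exact hw ((D.toX_eq_of_mem_orbitClosure hw').symm ▸ hx : D.toX w ∈ U))
  refine ⟨N, G, hG, (D.eval_toX_rep_ne_zero_iff hG z).2 h2, fun y hy => ?_⟩
  obtain ⟨w, rfl⟩ := D.exists_toX_eq y
  by_contra hw
  exact (D.eval_toX_rep_ne_zero_iff hG w).1 hy (h1 w hw)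

theorem regular_of_regular_comp (U : Set D.X) (hU : ((projective ι).restrict D.X).top.IsOpen U)
    (F : D.X → ℂ)
    (hF : ((affine κ).restrict (semistable D.act D.χ D.Y)).regular (D.toX ⁻¹' U) (F ∘ D.toX)) :
    ((projective ι).restrict D.X).regular U F := by
  classical
  refine projective_restrict_regular_iff.2 fun x hx => ?_
  obtain ⟨m, G₀, hG₀, hG₀x, hG₀U⟩ := projective_restrict_isOpen_iff.1 hU x hx
  obtain ⟨i, hi⟩ := Function.ne_iff.1 x.1.rep_nonzero
  -- The factor `X i` ensures positive degree, so that `G ≠ 0` forces the generators not to vanish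
  -- together and the point to be semistable.
  let G : MvPolynomial ι ℂ := G₀ * .X i
  have hG : G.IsHomogeneous (m + 1) := hG₀.mul (MvPolynomial.isHomogeneous_X _ _)
  have hGx : eval x.1.rep G ≠ 0 := by
    simp only [G, map_mul, MvPolynomial.eval_X]
    exact mul_ne_zero hG₀x hi
  have hGU : ∀ y : D.X, eval y.1.rep G ≠ 0 → y ∈ U := fun y hy => hG₀U y fun h => hy (by
    simp only [G, map_mul, h, zero_mul])
  let g : MvPolynomial κ ℂ := MvPolynomial.bind₁ D.P G
  have hg : ∀ y, eval y g = eval (D.val y) G := fun y => eval_bind₁_eq _ _ _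
  have hss : ∀ y ∈ D.Y, eval y g ≠ 0 → y ∈ semistable D.act D.χ D.Y := fun y hy hgy => by
    refine (D.mem_semistable_iff y).2 ⟨hy, fun h0 => hgy ?_⟩
    rw [hg, h0, ← zero_smul ℂ (0 : ι → ℂ), eval_smul_of_isHomogeneous hG,
      zero_pow m.succ_ne_zero, zero_mul]
  let φ : (κ → ℂ) → ℂ := fun y =>
    if h : y ∈ semistable D.act D.χ D.Y then F (D.toX ⟨y, h⟩) else 0
  have hφ : ∀ y : semistable D.act D.χ D.Y, φ y.1 = F (D.toX y) := fun y => dif_pos y.2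
  -- The ideal of global denominators of the pulled-back function on the locus `g ≠ 0`.
  let J : Ideal (MvPolynomial κ ℂ) :=
    { carrier := {p | ∃ f : MvPolynomial κ ℂ, ∀ y ∈ D.Y, eval y g ≠ 0 →
        eval y p * φ y = eval y f}
      add_mem' := by
        rintro p q ⟨f, hf⟩ ⟨f', hf'⟩
        refine ⟨f + f', fun y hy hgy => ?_⟩
        rw [map_add, map_add, add_mul, hf y hy hgy, hf' y hy hgy]
      zero_mem' := ⟨0, by simp⟩
      smul_mem' := by
        rintro p q ⟨f, hf⟩
        refine ⟨p * f, fun y hy hgy => ?_⟩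
        rw [smul_eq_mul, map_mul, map_mul, mul_assoc, hf y hy hgy] }
  have hrad : g ∈ J.radical := by
    rw [← MvPolynomial.vanishingIdeal_zeroLocus_eq_radical (K := ℂ),
      MvPolynomial.mem_vanishingIdeal_iff]
    intro w hw
    rw [MvPolynomial.mem_zeroLocus_iff] at hw
    rw [aeval_apply_eq_eval]
    by_contra hgw
    have hwY : w ∈ D.Y := D.mem_of_forall w fun f hf => by
      rw [← aeval_apply_eq_eval]
      exact hw f ⟨0, fun y hy _ => by rw [hf y hy]; simp⟩
    have hgU : ∀ y (hy : y ∈ D.Y) (hgy : eval y g ≠ 0), D.toX ⟨y, hss y hy hgy⟩ ∈ U :=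
      fun y hy hgy => hGU _ ((D.eval_toX_rep_ne_zero_iff hG _).2 (by rwa [hg] at hgy))
    obtain ⟨p, q, hq, hpq⟩ := affine_restrict_regular_iff.1 hF ⟨w, hss w hwY hgw⟩
      (hgU w hwY hgw)
    -- The local formula `p / q` says nothing where `q = 0`. After multiplication by `q * q` both
    -- sides vanish there, so the identity with `q * p` holds on the whole locus `g ≠ 0`.
    have hqJ : q * q ∈ J := by
      refine ⟨q * p, fun y hy hgy => ?_⟩
      by_cases hqy : eval y q = 0
      · simp [hqy]
      · have h1 := hpq ⟨y, hss y hy hgy⟩ (hgU y hy hgy) hqy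
        have h2 : φ y = eval y p / eval y q := (hφ ⟨y, hss y hy hgy⟩).trans h1
        rw [h2, map_mul, map_mul]
        field_simp
    have := hw _ hqJ
    rw [aeval_apply_eq_eval, map_mul, mul_self_eq_zero] at this
    exact hq this
  obtain ⟨N, f, hf⟩ := hrad
  -- Since `g ^ N * φ = f`, the function is `g * f / g ^ (N + 1)`. The additional power of `g` keeps
  -- the exponent of `G` positive even if `N = 0`, so that the denominator controls `G ≠ 0`.
  obtain ⟨Q, hQ, hQf⟩ := D.exists_weightComponent_eq ((m + 1) * (N + 1)) (g * f)
  refine ⟨(m + 1) * (N + 1), Q, G ^ (N + 1), hQ, hG.pow (N + 1), ?_, fun x' _ hx' => ?_⟩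
  · rw [map_pow]
    exact pow_ne_zero _ hGx
  · obtain ⟨y, rfl⟩ := D.exists_toX_eq x'
    rw [map_pow] at hx'
    have hGy : eval (D.val y.1) G ≠ 0 :=
      (D.eval_toX_rep_ne_zero_iff hG y).1 (ne_zero_pow N.succ_ne_zero hx')
    have hact : ∀ h, eval (D.act h y.1) (g * f) =
        (D.χ h : ℂ) ^ (D.d * ((m + 1) * (N + 1))) * (eval y.1 g ^ (N + 1) * φ y.1) := by
      intro h
      have hgh : eval (D.act h y.1) g = (D.χ h : ℂ) ^ (D.d * (m + 1)) * eval y.1 g := by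
        rw [hg, hg, D.val_act, eval_smul_of_isHomogeneous hG, ← pow_mul]
      have hne : eval (D.act h y.1) g ≠ 0 := by
        rw [hgh, hg]
        exact mul_ne_zero (pow_ne_zero _ (D.χ h).ne_zero) hGy
      have h1 := hf _ (D.act_mem h _ y.2.1) hne
      have h2 : φ (D.act h y.1) = φ y.1 := by
        rw [hφ y, ← D.toX_act h y]
        exact hφ ⟨D.act h y.1, _⟩
      rw [map_mul, ← h1, h2, map_pow, hgh]
      ring
    have h3 := D.eval_weightComponent_eq _ _ _ _ hact
    rw [hQf, eval_bind₁_eq] at h3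
    have h4 : eval (D.toX y).1.rep Q / eval (D.toX y).1.rep (G ^ (N + 1)) =
        eval (D.val y.1) Q / eval (D.val y.1) (G ^ (N + 1)) :=
      eval_rep_mk_div hQ (hG.pow _) _ _
    rw [h4, ← hφ y, map_pow]
    change φ y.1 = eval (fun i => eval y.1 (D.P i)) Q / _
    rw [h3, hg, mul_div_cancel_left₀ _ (pow_ne_zero _ hGy)]

/-- The map from the GIT quotient to projective space. -/
noncomputable def quotMap : (gitQuotient D.act D.χ D.Y).carrier → D.X :=
  Quot.lift D.toX fun _ _ ⟨_, hy, hz⟩ =>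
    (D.toX_eq_of_mem_orbitClosure hy).symm.trans (D.toX_eq_of_mem_orbitClosure hz)

theorem quotMap_bijective : Function.Bijective D.quotMap := by
  constructor
  · intro y z
    induction y using Quot.ind
    induction z using Quot.ind
    exact fun h => Quot.sound (D.orbitClosure_inter_nonempty h)
  · intro x
    obtain ⟨y, hy⟩ := D.exists_toX_eq x
    exact ⟨Quot.mk _ y, hy⟩

/-- The GIT quotient is the image of the map defined by the generating semi-invariants. -/
noncomputable def iso : Iso (gitQuotient D.act D.χ D.Y) ((projective ι).restrict D.X) where
  toEquiv := Equiv.ofBijective D.quotMap D.quotMap_bijective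
  isOpen_iff U := ⟨D.isMorphism_toX.isOpen_preimage U, D.isOpen_of_isOpen_preimage U⟩
  regular_iff U hU f := ⟨D.isMorphism_toX.regular_comp U hU f, D.regular_of_regular_comp U hU f⟩

end QuotientData

end SpaceWithFunctions
end PolygonDegeneration

/-! ### Dissected polygons, the gluing map and the central fibre. -/

namespace PolygonDegeneration

open scoped LinearAlgebra.Projectivization

open SpaceWithFunctions

variable {n : ℕ} {S : Finset (Fin n × Fin n)}

/-! ## Dissections of the polygon -/

/-- A set of pairwise non-crossing diagonals. -/
structure IsDissection (S : Finset (Fin n × Fin n)) : Prop where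
  isDiagonal : ∀ e ∈ S, IsDiagonal e
  nonCrossing : ∀ e ∈ S, ∀ f ∈ S, NonCrossing e f

theorem nonCrossing_iff {e f : Fin n × Fin n} (he : e.1 < e.2) (hf : f.1 < f.2) :
    NonCrossing e f ↔
      (f.1 ≤ e.1 ∧ e.2 ≤ f.2) ∨ (e.1 ≤ f.1 ∧ f.2 ≤ e.2) ∨ e.2 ≤ f.1 ∨ f.2 ≤ e.1 := by
  rw [NonCrossing, Finset.Ico_subset_Ico_iff he, Finset.Ico_subset_Ico_iff hf]
  refine or_congr Iff.rfl (or_congr Iff.rfl ?_)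
  rw [Finset.disjoint_left]
  simp only [Finset.mem_Ico]
  constructor
  · intro h
    by_contra! hc
    rcases le_total e.1 f.1 with h1 | h1
    · exact h ⟨h1, hc.1⟩ ⟨le_rfl, hf⟩
    · exact h ⟨le_rfl, he⟩ ⟨h1, hc.2⟩
  · grind

/-- A chord that bounds a subpolygon from above: a diagonal of the dissection or the side joining
the first and the last vertex. -/
def IsLid (S : Finset (Fin n × Fin n)) (e : Fin n × Fin n) : Prop :=
  e ∈ S ∨ (e.1 < e.2 ∧ ∀ k, e.1 ≤ k ∧ k ≤ e.2)

theorem IsDissection.lt (hS : IsDissection S) {e : Fin n × Fin n} (he : e ∈ S) : e.1 < e.2 :=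
  (hS.isDiagonal e he).1

theorem IsDissection.exists_between (hS : IsDissection S) {e : Fin n × Fin n} (he : e ∈ S) :
    ∃ k, e.1 < k ∧ k < e.2 := by
  have := (hS.isDiagonal e he).2
  rw [CyclicallyAdjacent] at this
  push Not at this
  exact this.1

theorem IsDissection.exists_outside (hS : IsDissection S) {e : Fin n × Fin n} (he : e ∈ S) :
    ∃ k, k < e.1 ∨ e.2 < k := by
  have := (hS.isDiagonal e he).2
  rw [CyclicallyAdjacent] at this
  push Not at this
  obtain ⟨k, hk⟩ := this.2
  exact ⟨k, or_iff_not_imp_left.2 fun h => hk (not_lt.1 h)⟩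

theorem IsLid.lt (hS : IsDissection S) {e : Fin n × Fin n} (he : IsLid S e) : e.1 < e.2 :=
  he.elim hS.lt And.left

/-- The intervals of leaves under the lids form a laminar family: nested or disjoint. All tree
arguments about cells rest on this. -/
theorem IsLid.cases (hS : IsDissection S) {e f : Fin n × Fin n} (he : IsLid S e)
    (hf : IsLid S f) :
      (f.1 ≤ e.1 ∧ e.2 ≤ f.2) ∨ (e.1 ≤ f.1 ∧ f.2 ≤ e.2) ∨ e.2 ≤ f.1 ∨ f.2 ≤ e.1 := by
  rcases hf with hf | hf
  · rcases he with he | he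
    · exact (nonCrossing_iff (hS.lt he) (hS.lt hf)).1 (hS.nonCrossing e he f hf)
    · exact Or.inr (Or.inl ⟨(he.2 _).1, (he.2 _).2⟩)
  · exact Or.inl ⟨(hf.2 _).1, (hf.2 _).2⟩

/-! ## Cells -/

theorem cell_nonempty (α : Cell S) : α.1.Nonempty :=
  Finset.card_pos.1 (lt_of_lt_of_le (by norm_num) α.2.1)

/-- The first vertex of a cell. -/
def lo (α : Cell S) : Fin n := α.1.min' (cell_nonempty α)

/-- The last vertex of a cell. -/
def hi (α : Cell S) : Fin n := α.1.max' (cell_nonempty α)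

theorem lo_mem (α : Cell S) : lo α ∈ α.1 := Finset.min'_mem _ _

theorem hi_mem (α : Cell S) : hi α ∈ α.1 := Finset.max'_mem _ _

theorem lo_le {α : Cell S} {v : Fin n} (hv : v ∈ α.1) : lo α ≤ v := Finset.min'_le _ _ hv

theorem le_hi {α : Cell S} {v : Fin n} (hv : v ∈ α.1) : v ≤ hi α := Finset.le_max' _ _ hv

/-- The edge of a cell that joins its last and its first vertex. -/
def topEdge (α : Cell S) : α.1 := ⟨hi α, hi_mem α⟩

theorem exists_mid (α : Cell S) : ∃ v ∈ α.1, lo α < v ∧ v < hi α := by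
  by_contra! h
  have : α.1 ⊆ {lo α, hi α} := fun v hv => by
    have h1 := lo_le hv
    have h2 := le_hi hv
    have h3 := h v hv
    rw [Finset.mem_insert, Finset.mem_singleton]
    grind
  have h1 := Finset.card_le_card this
  have h2 := α.2.1
  have h3 := Finset.card_le_two (a := lo α) (b := hi α)
  omega

theorem lo_lt_hi (α : Cell S) : lo α < hi α := by
  obtain ⟨v, _, h1, h2⟩ := exists_mid α
  exact h1.trans h2

theorem nextVertex_mem (V : Finset (Fin n)) (v : V) : nextVertex V v ∈ V := by
  unfold nextVertex
  split_ifs with h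
  · exact (Finset.mem_filter.1 (Finset.min'_mem _ h)).1
  · exact Finset.min'_mem _ _

theorem lt_nextVertex_of_exists {V : Finset (Fin n)} {v : V} (hv : ∃ w ∈ V, v.1 < w) :
    v.1 < nextVertex V v := by
  have h : (V.filter (v.1 < ·)).Nonempty :=
    hv.imp fun w hw => Finset.mem_filter.2 hw
  rw [nextVertex, dif_pos h]
  exact (Finset.mem_filter.1 (Finset.min'_mem _ h)).2

theorem nextVertex_le {V : Finset (Fin n)} {v : V} {w : Fin n} (hw : w ∈ V) (hvw : v.1 < w) :
    nextVertex V v ≤ w := by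
  have h : w ∈ V.filter (v.1 < ·) := Finset.mem_filter.2 ⟨hw, hvw⟩
  rw [nextVertex, dif_pos ⟨w, h⟩]
  exact Finset.min'_le _ _ h

theorem nextVertex_eq_min {V : Finset (Fin n)} {v : V} (hv : ∀ w ∈ V, w ≤ v.1) {m : Fin n}
    (hm : m ∈ V) (hm' : ∀ w ∈ V, m ≤ w) : nextVertex V v = m := by
  rw [nextVertex, dif_neg]
  · exact le_antisymm (Finset.min'_le _ _ hm) (hm' _ (Finset.min'_mem _ _))
  · rintro ⟨w, hw⟩
    rw [Finset.mem_filter] at hw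
    exact absurd (hv w hw.1) (not_le.2 hw.2)

theorem lt_nextVertex {α : Cell S} {v : α.1} (hv : v.1 < hi α) : v.1 < nextVertex α.1 v :=
  lt_nextVertex_of_exists ⟨hi α, hi_mem α, hv⟩

theorem nextVertex_topEdge (α : Cell S) : nextVertex α.1 (topEdge α) = lo α :=
  nextVertex_eq_min (fun _ hw => le_hi hw) (lo_mem α) fun _ hw => lo_le hw

theorem lt_hi_of_ne {α : Cell S} {v : α.1} (hv : v ≠ topEdge α) : v.1 < hi α :=
  lt_of_le_of_ne (le_hi v.2) fun h => hv (Subtype.ext h)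

/-- An edge of a cell other than the top one is a side of the polygon or a diagonal of the
dissection. -/
theorem edge_cases {α : Cell S} {v : α.1} (hv : v.1 < hi α) :
    (v.1, nextVertex α.1 v) ∈ S ∨ ∀ k, k ≤ v.1 ∨ nextVertex α.1 v ≤ k := by
  have hlt := lt_nextVertex hv
  rcases α.2.2.1 v with h | h
  · right
    rw [IsSide, min_eq_left hlt.le, max_eq_right hlt.le] at h
    rcases h with h | h
    · intro k
      have := h k
      grind
    · exfalso
      obtain ⟨w, hw, h1, h2⟩ := exists_mid α
      have h3 := (h (lo α)).1
      have h4 := (h (hi α)).2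
      have h5 := nextVertex_le (v := v) hw (lt_of_le_of_lt h3 h1)
      exact absurd (h4.trans h5) (not_le.2 h2)
  · left
    rwa [min_eq_left hlt.le, max_eq_right hlt.le] at h

theorem isLid_cell (α : Cell S) : IsLid S (lo α, hi α) := by
  have h := α.2.2.1 (topEdge α)
  have hlt := lo_lt_hi α
  rw [nextVertex_topEdge, IsSide] at h
  simp only [topEdge, min_eq_right hlt.le, max_eq_left hlt.le] at h
  rcases h with h | h
  · rcases h with h | h
    · obtain ⟨w, hw, h1, h2⟩ := exists_mid α
      exact absurd ⟨h1, h2⟩ (h w)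
    · exact Or.inr ⟨hlt, h⟩
  · exact Or.inl h

/-- The vertices of a cell around a vertex `k` that is not in the cell. -/
theorem exists_gap {α : Cell S} {k : Fin n} (h1 : lo α ≤ k) (h2 : k < hi α) :
    ∃ v : α.1, v.1 ≤ k ∧ k < nextVertex α.1 v ∧ v.1 < hi α := by
  have h : (α.1.filter (· ≤ k)).Nonempty := ⟨lo α, Finset.mem_filter.2 ⟨lo_mem α, h1⟩⟩
  have hm := Finset.mem_filter.1 (Finset.max'_mem _ h)
  refine ⟨⟨_, hm.1⟩, hm.2, ?_, lt_of_le_of_lt hm.2 h2⟩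
  by_contra! hc
  have h3 := Finset.le_max' (α.1.filter (· ≤ k)) _
    (Finset.mem_filter.2 ⟨nextVertex_mem α.1 ⟨_, hm.1⟩, hc⟩)
  have h4 := lt_nextVertex (α := α) (v := ⟨_, hm.1⟩) (lt_of_le_of_lt hm.2 h2)
  exact absurd h3 (not_le.2 h4)

/-- If an end of `f` fell strictly inside a gap between consecutive vertices of `α`, the edge of `α`
over that gap would cross `f`, because `f` passes over the vertex `v`. -/
theorem mem_cell_of_inside (hS : IsDissection S) {α : Cell S} {f : Fin n × Fin n}
    (hf : f ∈ S) (h1 : lo α ≤ f.1) (h2 : f.2 ≤ hi α) {v : Fin n} (hv : v ∈ α.1)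
    (h3 : f.1 < v) (h4 : v < f.2) : f.1 ∈ α.1 ∧ f.2 ∈ α.1 := by
  constructor
  · obtain ⟨x, hx1, hx2, hx3⟩ := exists_gap h1 (lt_of_lt_of_le (h3.trans h4) h2)
    rcases hx1.eq_or_lt with hx | hx
    · exact hx ▸ x.2
    · exfalso
      have h5 := nextVertex_le (v := x) hv (lt_trans hx h3)
      rcases edge_cases hx3 with h | h
      · have := IsLid.cases hS (Or.inl h) (Or.inl hf)
        simp only at this
        grind
      · have := h f.1
        grind
  · rcases h2.eq_or_lt with h2 | h2
    · exact h2 ▸ hi_mem α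
    obtain ⟨x, hx1, hx2, hx3⟩ := exists_gap (h1.trans (hS.lt hf).le) h2
    rcases hx1.eq_or_lt with hx | hx
    · exact hx ▸ x.2
    · exfalso
      have h5 : v ≤ x.1 := by
        by_contra! hc
        have := nextVertex_le (v := x) hv hc
        exact absurd (hx2.trans_le this) (not_lt.2 h4.le)
      rcases edge_cases hx3 with h | h
      · have := IsLid.cases hS (Or.inl h) (Or.inl hf)
        simp only at this
        grind
      · have := h f.2
        grind

/-- A diagonal of the dissection that cuts off a vertex of a cell cuts off the whole cell. -/
theorem cut_off (hS : IsDissection S) {α : Cell S} {f : Fin n × Fin n} (hf : f ∈ S)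
    {v : Fin n} (hv : v ∈ α.1) (h3 : f.1 < v) (h4 : v < f.2) : f.1 ≤ lo α ∧ hi α ≤ f.2 := by
  have h5 := lo_le hv
  have h6 := le_hi hv
  rcases IsLid.cases hS (isLid_cell α) (Or.inl hf) with h | h | h | h
  · exact h
  · simp only at h
    obtain ⟨m1, m2⟩ := mem_cell_of_inside hS hf h.1 h.2 hv h3 h4
    -- Both ends of `f` are now vertices of `α`, so `f` is an edge of `α`. With a vertex strictly
    -- under it, it can only be the top edge.
    rcases α.2.2.2 ⟨_, m1⟩ ⟨_, m2⟩ hf with hn | hn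
    · have := nextVertex_le (v := ⟨_, m1⟩) hv h3
      rw [hn] at this
      exact absurd this (not_le.2 h4)
    · have hnot : ¬ f.2 < hi α := fun hlt => by
        have := lt_nextVertex (v := ⟨_, m2⟩) hlt
        rw [hn] at this
        exact absurd (hS.lt hf) (not_lt.2 this.le)
      have heq : (⟨_, m2⟩ : α.1) = topEdge α := Subtype.ext (le_antisymm h.2 (not_lt.1 hnot))
      rw [heq, nextVertex_topEdge] at hn
      exact ⟨hn.symm.le, not_lt.1 hnot⟩
  · simp only at h
    grind
  · simp only at h
    grind

/-- A vertex under the lid that is missing from `α` lies strictly under a lower edge of `α`, which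
is a diagonal too short to pass over the cell. Consequently a cell is determined by its lid. -/
theorem mem_cell_iff (hS : IsDissection S) (α : Cell S) (v : Fin n) :
    v ∈ α.1 ↔ lo α ≤ v ∧ v ≤ hi α ∧
      ∀ f ∈ S, f.1 < v → v < f.2 → f.1 ≤ lo α ∧ hi α ≤ f.2 := by
  constructor
  · exact fun hv => ⟨lo_le hv, le_hi hv, fun f hf => cut_off hS hf hv⟩
  · rintro ⟨h1, h2, h⟩
    rcases h2.eq_or_lt with h2 | h2
    · exact h2 ▸ hi_mem α
    obtain ⟨x, hx1, hx2, hx3⟩ := exists_gap h1 h2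
    rcases hx1.eq_or_lt with hx | hx
    · exact hx ▸ x.2
    · exfalso
      rcases edge_cases hx3 with h' | h'
      · obtain ⟨h5, h6⟩ := h _ h' hx hx2
        obtain ⟨w, hw, h7, h8⟩ := exists_mid α
        have := nextVertex_le (v := x) hw (lt_of_le_of_lt h5 h7)
        exact absurd (h6.trans this) (not_le.2 h8)
      · have := h' v
        grind

theorem cell_ext (hS : IsDissection S) {α β : Cell S} (h1 : lo α = lo β) (h2 : hi α = hi β) :
    α = β := by
  refine Subtype.ext (Finset.ext fun v => ?_)
  rw [mem_cell_iff hS α, mem_cell_iff hS β, h1, h2]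

/-- The cell `β` lies below the edge of `α` with ends `v < v'`. -/
def LiesBelow (α β : Cell S) (v v' : Fin n) : Prop :=
  v ∈ α.1 ∧ v' ∈ α.1 ∧ (∀ w ∈ α.1, w ≤ v ∨ v' ≤ w) ∧ v ≤ lo β ∧ hi β ≤ v'

theorem exists_liesBelow (hS : IsDissection S) {α β : Cell S} (hne : α ≠ β)
    (h1 : lo α ≤ lo β) (h2 : hi β ≤ hi α) : ∃ v v', LiesBelow α β v v' := by
  obtain ⟨x, hx1, hx2, hx3⟩ := exists_gap h1 ((lo_lt_hi β).trans_le h2)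
  refine ⟨x.1, nextVertex α.1 x, x.2, nextVertex_mem _ _, fun w hw => ?_, hx1, ?_⟩
  · rcases le_or_gt w x.1 with h | h
    · exact Or.inl h
    · exact Or.inr (nextVertex_le hw h)
  · by_contra! hc
    rcases isLid_cell β with h | h
    · obtain ⟨h3, h4⟩ := cut_off hS h (nextVertex_mem α.1 x) hx2 hc
      exact hne (cell_ext hS (le_antisymm h1 h3) (le_antisymm h4 h2))
    · exact hne (cell_ext hS (le_antisymm h1 (h.2 _).1) (le_antisymm (h.2 _).2 h2))

theorem cell_cases (hS : IsDissection S) {α β : Cell S} (hne : α ≠ β) :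
    (∃ v v', LiesBelow α β v v') ∨ (∃ v v', LiesBelow β α v v') ∨
      hi α ≤ lo β ∨ hi β ≤ lo α := by
  rcases IsLid.cases hS (isLid_cell α) (isLid_cell β) with h | h | h | h
  · exact Or.inr (Or.inl (exists_liesBelow hS hne.symm h.1 h.2))
  · exact Or.inl (exists_liesBelow hS hne h.1 h.2)
  · exact Or.inr (Or.inr (Or.inl h))
  · exact Or.inr (Or.inr (Or.inr h))

/-! ## The edge of a cell through which a leaf, or another cell, is reached -/

/-- The edge of `α` that separates the `i`-th side from `α` (or is equal to it). -/
def part (α : Cell S) (i : Fin n) : α.1 :=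
  if h : (α.1.filter (· ≤ i)).Nonempty then
    ⟨(α.1.filter (· ≤ i)).max' h, (Finset.mem_filter.1 (Finset.max'_mem _ h)).1⟩
  else topEdge α

theorem part_eq_of {α : Cell S} {i v : Fin n} (hv : v ∈ α.1) (h : v ≤ i)
    (h' : ∀ w ∈ α.1, w ≤ i → w ≤ v) : part α i = ⟨v, hv⟩ := by
  have hm : v ∈ α.1.filter (· ≤ i) := Finset.mem_filter.2 ⟨hv, h⟩
  rw [part, dif_pos ⟨v, hm⟩]
  refine Subtype.ext (le_antisymm ?_ (Finset.le_max' _ _ hm))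
  have := Finset.mem_filter.1 (Finset.max'_mem _ ⟨v, hm⟩)
  exact h' _ this.1 this.2

theorem part_self {α : Cell S} (v : α.1) : part α v.1 = v :=
  part_eq_of v.2 le_rfl fun _ _ h => h

theorem part_eq_topEdge {α : Cell S} {i : Fin n} (h : i < lo α ∨ hi α ≤ i) :
    part α i = topEdge α := by
  rcases h with h | h
  · rw [part, dif_neg]
    rintro ⟨w, hw⟩
    rw [Finset.mem_filter] at hw
    exact absurd (lo_le hw.1) (not_le.2 (lt_of_le_of_lt hw.2 h))
  · exact part_eq_of (hi_mem α) h fun w hw _ => le_hi hw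

theorem part_spec {α : Cell S} {i : Fin n} (h : lo α ≤ i) :
    (part α i).1 ≤ i ∧ ∀ w ∈ α.1, w ≤ i → w ≤ (part α i).1 := by
  have hm : (α.1.filter (· ≤ i)).Nonempty := ⟨lo α, Finset.mem_filter.2 ⟨lo_mem α, h⟩⟩
  rw [part, dif_pos hm]
  exact ⟨(Finset.mem_filter.1 (Finset.max'_mem _ hm)).2, fun w hw hwi =>
    Finset.le_max' _ _ (Finset.mem_filter.2 ⟨hw, hwi⟩)⟩

theorem part_eq_topEdge_iff {α : Cell S} {i : Fin n} :
    part α i = topEdge α ↔ i < lo α ∨ hi α ≤ i := by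
  refine ⟨fun h => ?_, part_eq_topEdge⟩
  by_contra! hc
  have := (part_spec hc.1).1
  rw [h] at this
  exact absurd this (not_le.2 hc.2)

theorem part_eq_iff {α : Cell S} {v : α.1} (hv : v.1 < hi α) {i : Fin n} :
    part α i = v ↔ v.1 ≤ i ∧ i < nextVertex α.1 v := by
  constructor
  · rintro rfl
    have h1 : lo α ≤ i := by
      by_contra! hc
      rw [part_eq_topEdge (Or.inl hc)] at hv
      exact lt_irrefl _ hv
    have h2 := part_spec h1
    refine ⟨h2.1, ?_⟩
    by_contra! hc
    exact absurd (h2.2 _ (nextVertex_mem _ _) hc) (not_le.2 (lt_nextVertex hv))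
  · rintro ⟨h1, h2⟩
    refine part_eq_of v.2 h1 fun w hw hwi => ?_
    by_contra! hc
    exact absurd ((nextVertex_le hw hc).trans hwi) (not_le.2 h2)

/-- The leaves cut off by an edge of `α` are a fibre of `part α`, or its complement for the top
edge. This turns the paths of the dual tree into the functions `part`. -/
theorem onPath_iff {α : Cell S} (v : α.1) (i j : Fin n) :
    OnPath v.1 (nextVertex α.1 v) i j ↔ ¬ (part α i = v ↔ part α j = v) := by
  rw [OnPath]
  by_cases hv : v = topEdge α
  · subst hv
    rw [nextVertex_topEdge, part_eq_topEdge_iff, part_eq_topEdge_iff]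
    have : lo α ≤ (topEdge α).1 := (lo_lt_hi α).le
    rw [min_eq_right this, max_eq_left this, Finset.mem_Ico, Finset.mem_Ico]
    have h : (topEdge α).1 = hi α := rfl
    rw [h]
    grind
  · have hv' := lt_hi_of_ne hv
    have := (lt_nextVertex hv').le
    rw [part_eq_iff hv', part_eq_iff hv', min_eq_left this, max_eq_right this, Finset.mem_Ico,
      Finset.mem_Ico]

/-- The edge of `α` that separates `β` from `α`. -/
def dir (α β : Cell S) : α.1 :=
  if lo α ≤ lo β ∧ hi β ≤ hi α then part α (lo β) else topEdge α

theorem LiesBelow.lt {α β : Cell S} {v v' : Fin n} (h : LiesBelow α β v v') : v < v' := by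
  obtain ⟨_, _, _, h4, h5⟩ := h
  have := lo_lt_hi β
  grind

theorem LiesBelow.nextVertex_eq {α β : Cell S} {v v' : Fin n} (h : LiesBelow α β v v') :
    nextVertex α.1 ⟨v, h.1⟩ = v' := by
  have h1 := nextVertex_le (v := ⟨v, h.1⟩) h.2.1 h.lt
  have h2 := lt_nextVertex (α := α) (v := ⟨v, h.1⟩) (h.lt.trans_le (le_hi h.2.1))
  rcases h.2.2.1 _ (nextVertex_mem α.1 ⟨v, h.1⟩) with h3 | h3
  · exact absurd h2 (not_lt.2 h3)
  · exact le_antisymm h1 h3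

theorem LiesBelow.dir_eq {α β : Cell S} {v v' : Fin n} (h : LiesBelow α β v v') :
    dir α β = ⟨v, h.1⟩ := by
  obtain ⟨h1, h2, h3, h4, h5⟩ := h
  rw [dir, if_pos ⟨(lo_le h1).trans h4, h5.trans (le_hi h2)⟩]
  refine part_eq_of h1 h4 fun w hw hwi => ?_
  have := h3 w hw
  have := lo_lt_hi β
  grind

theorem LiesBelow.dir_eq_topEdge {α β : Cell S} {v v' : Fin n} (h : LiesBelow α β v v') :
    dir β α = topEdge β := by
  obtain ⟨h1, h2, h3, h4, h5⟩ := h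
  rw [dir, if_neg]
  rintro ⟨h6, h7⟩
  obtain ⟨w, hw, h8, h9⟩ := exists_mid α
  have := h3 w hw
  grind

theorem dir_eq_topEdge_of_le {α β : Cell S} (h : hi α ≤ lo β ∨ hi β ≤ lo α) :
    dir α β = topEdge α := by
  rw [dir, if_neg]
  have := lo_lt_hi α
  have := lo_lt_hi β
  grind

theorem LiesBelow.part_eq_iff {α β : Cell S} {v v' : Fin n} (h : LiesBelow α β v v')
    {i : Fin n} : part α i = ⟨v, h.1⟩ ↔ v ≤ i ∧ i < v' := by
  have := PolygonDegeneration.part_eq_iff (α := α) (v := ⟨v, h.1⟩)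
    (h.lt.trans_le (le_hi h.2.1)) (i := i)
  rwa [h.nextVertex_eq] at this

/-- The tree property in the form used throughout: a leaf that is not on the side of `β` as seen
from `α` must be on the side of `α` as seen from `β`. -/
theorem part_eq_dir (hS : IsDissection S) {α β : Cell S} (hne : α ≠ β) {i : Fin n}
    (hi : part α i ≠ dir α β) : part β i = dir β α := by
  have hα := lo_lt_hi α
  have hβ := lo_lt_hi β
  rcases cell_cases hS hne with ⟨v, v', h⟩ | ⟨v, v', h⟩ | h
  · rw [h.dir_eq, ne_eq, h.part_eq_iff] at hi
    rw [h.dir_eq_topEdge, part_eq_topEdge_iff]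
    obtain ⟨_, _, _, h4, h5⟩ := h
    grind
  · rw [h.dir_eq_topEdge, ne_eq, part_eq_topEdge_iff] at hi
    rw [h.dir_eq, h.part_eq_iff]
    obtain ⟨_, _, _, h4, h5⟩ := h
    grind
  · rw [dir_eq_topEdge_of_le h, ne_eq, part_eq_topEdge_iff] at hi
    rw [dir_eq_topEdge_of_le h.symm, part_eq_topEdge_iff]
    grind

/-! ## Existence of cells -/

/-- Among the lids in a set that all lie over a common vertex there is a least one. -/
theorem exists_least_lid (hS : IsDissection S) (Q : Fin n × Fin n → Prop) (x : Fin n)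
    (hQ : ∃ e, IsLid S e ∧ Q e) (hx : ∀ e, Q e → e.1 ≤ x ∧ x < e.2) :
    ∃ e, IsLid S e ∧ Q e ∧ ∀ g, IsLid S g → Q g → g.1 ≤ e.1 ∧ e.2 ≤ g.2 := by
  classical
  obtain ⟨e₀, he₀⟩ := hQ
  -- Lids over a common leaf are nested by laminarity, so the one of least width is contained in all
  -- others.
  obtain ⟨e, he, hmin⟩ := Finset.exists_min_image
    (Finset.univ.filter fun e => IsLid S e ∧ Q e) (fun e => e.2.val - e.1.val)
    ⟨e₀, Finset.mem_filter.2 ⟨Finset.mem_univ _, he₀⟩⟩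
  rw [Finset.mem_filter] at he
  refine ⟨e, he.2.1, he.2.2, fun g hg hQg => ?_⟩
  have h1 := hmin g (Finset.mem_filter.2 ⟨Finset.mem_univ _, hg, hQg⟩)
  have h2 := hx e he.2.2
  have h3 := hx g hQg
  simp only [Fin.le_def, Fin.lt_def] at *
  rcases he.2.1.cases hS hg with h | h | h | h <;> simp only [Fin.le_def] at h <;> omega

theorem exists_root (hn : 0 < n) : ∃ r : Fin n × Fin n, ∀ k, r.1 ≤ k ∧ k ≤ r.2 := by
  refine ⟨(⟨0, hn⟩, ⟨n - 1, by omega⟩), fun k => ?_⟩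
  simp only [Fin.le_def]
  omega

/-- The cell consists of the vertices under `e` that no diagonal other than those passing over all
of `e` cuts off. The work lies in showing that consecutive ones are joined by a side or a diagonal.
-/
theorem exists_cell (hS : IsDissection S) {e : Fin n × Fin n} (he : IsLid S e)
    (hmid : ∃ k, e.1 < k ∧ k < e.2) : ∃ α : Cell S, lo α = e.1 ∧ hi α = e.2 := by
  classical
  have hlt := he.lt hS
  let V : Finset (Fin n) := Finset.univ.filter fun v =>
    e.1 ≤ v ∧ v ≤ e.2 ∧ ∀ f ∈ S, f.1 < v → v < f.2 → f.1 ≤ e.1 ∧ e.2 ≤ f.2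
  have hV : ∀ v, v ∈ V ↔
      e.1 ≤ v ∧ v ≤ e.2 ∧ ∀ f ∈ S, f.1 < v → v < f.2 → f.1 ≤ e.1 ∧ e.2 ≤ f.2 := fun v => by
    simp [V]
  have h1 : e.1 ∈ V := (hV _).2 ⟨le_rfl, hlt.le, fun f hf h h' => by
    have := IsLid.cases hS (Or.inl hf) he
    grind⟩
  have h2 : e.2 ∈ V := (hV _).2 ⟨hlt.le, le_rfl, fun f hf h h' => by
    have := IsLid.cases hS (Or.inl hf) he
    grind⟩
  -- The clause excluding a chord over all of `e` is what later provides a third vertex.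
  have hcons : ∀ v ∈ V, ∀ w ∈ V, v < w → (∀ x ∈ V, x ≤ v ∨ w ≤ x) →
      ((v, w) ∈ S ∧ ¬ (v ≤ e.1 ∧ e.2 ≤ w)) ∨ ∀ k, k ≤ v ∨ w ≤ k := by
    intro v hv w hw hvw hno
    by_contra! hcon
    obtain ⟨k, hk1, hk2⟩ := hcon.2
    have hkV : k ∉ V := fun h => by
      have := hno k h
      grind
    have hv' := (hV v).1 hv
    have hw' := (hV w).1 hw
    have hex : ∃ f ∈ S, f.1 < k ∧ k < f.2 ∧ ¬ (f.1 ≤ e.1 ∧ e.2 ≤ f.2) := by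
      rw [hV] at hkV
      push Not at hkV
      obtain ⟨f, hf, h3, h4, h5⟩ := hkV (hv'.1.trans hk1.le) (hk2.le.trans hw'.2.1)
      exact ⟨f, hf, h3, h4, fun h => absurd h.2 (not_le.2 (h5 h.1))⟩
    obtain ⟨f₀, hf₀, hf₀'⟩ := hex
    -- A widest diagonal hiding `k` has ends that no other such diagonal hides. They therefore
    -- belong to `V` and must be the neighbours `v` and `w`.
    obtain ⟨f, hf, hmax⟩ := Finset.exists_max_image
      (S.filter fun f => f.1 < k ∧ k < f.2 ∧ ¬ (f.1 ≤ e.1 ∧ e.2 ≤ f.2))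
      (fun e => e.2.val - e.1.val) ⟨f₀, Finset.mem_filter.2 ⟨hf₀, hf₀'⟩⟩
    rw [Finset.mem_filter] at hf
    obtain ⟨hf, hf1, hf2, hf3⟩ := hf
    have hfe := IsLid.cases hS (Or.inl hf) he
    have hbig : ∀ x, (x = f.1 ∨ x = f.2) → x ∈ V := by
      intro x hx
      rw [hV]
      refine ⟨by grind, by grind, fun g hg hg1 hg2 => ?_⟩
      by_contra hg3
      have h6 := IsLid.cases hS (Or.inl hf) (Or.inl hg)
      have h7 := hmax g
      rw [Finset.mem_filter] at h7
      simp only [Fin.le_def, Fin.lt_def, Fin.ext_iff] at *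
      have h8 := h7 ⟨hg, by omega, by omega, hg3⟩
      omega
    have h6 := hno _ (hbig f.1 (Or.inl rfl))
    have h7 := hno _ (hbig f.2 (Or.inr rfl))
    have h8 := hv'.2.2 f hf
    have h9 := hw'.2.2 f hf
    have hfe : f = (v, w) := Prod.ext (by grind) (by grind)
    subst hfe
    exact hf3 (hcon.1 hf)
  have hnext : ∀ v : V, v.1 < e.2 →
      ((v.1, nextVertex V v) ∈ S ∧ ¬ (v.1 ≤ e.1 ∧ e.2 ≤ nextVertex V v)) ∨
        ∀ k, k ≤ v.1 ∨ nextVertex V v ≤ k := fun v hv =>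
    hcons _ v.2 _ (nextVertex_mem V v) (lt_nextVertex_of_exists ⟨_, h2, hv⟩) fun x hx => by
      rcases le_or_gt x v.1 with h | h
      · exact Or.inl h
      · exact Or.inr (nextVertex_le hx h)
  have hmin : ∀ v ∈ V, e.1 ≤ v := fun v hv => ((hV v).1 hv).1
  have hmax : ∀ v ∈ V, v ≤ e.2 := fun v hv => ((hV v).1 hv).2.1
  have hcell : IsCell S V := by
    refine ⟨?_, fun v => ?_, fun v w hvw => ?_⟩
    · have hm1 := lt_nextVertex_of_exists (v := ⟨e.1, h1⟩) ⟨_, h2, hlt⟩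
      have hm2 : nextVertex V ⟨e.1, h1⟩ < e.2 := by
        by_contra! hc
        rcases hnext ⟨e.1, h1⟩ hlt with h | h
        · exact h.2 ⟨le_rfl, hc⟩
        · obtain ⟨k, hk1, hk2⟩ := hmid
          have := h k
          grind
      have : ({e.1, nextVertex V ⟨e.1, h1⟩, e.2} : Finset (Fin n)) ⊆ V := by
        intro x hx
        simp only [Finset.mem_insert, Finset.mem_singleton] at hx
        rcases hx with rfl | rfl | rfl
        · exact h1
        · exact nextVertex_mem _ _
        · exact h2
      refine le_trans ?_ (Finset.card_le_card this)
      rw [Finset.card_eq_three.2 ⟨_, _, _, hm1.ne, hlt.ne, hm2.ne, rfl⟩]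
    · rcases (hmax v.1 v.2).lt_or_eq with hv | hv
      · have hlt' := lt_nextVertex_of_exists (v := v) ⟨_, h2, hv⟩
        rw [IsSide, min_eq_left hlt'.le, max_eq_right hlt'.le]
        rcases hnext v hv with h | h
        · exact Or.inr h.1
        · exact Or.inl (Or.inl fun k hk => by
            have := h k
            grind)
      · rw [nextVertex_eq_min (fun w hw => hv ▸ hmax w hw) h1 hmin, hv, IsSide,
          min_eq_right hlt.le, max_eq_left hlt.le]
        rcases he with h | h
        · exact Or.inr h
        · exact Or.inl (Or.inr h.2)
    · have hlt' := hS.lt hvw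
      by_cases hb : ∃ x ∈ V, v.1 < x ∧ x < w.1
      · obtain ⟨x, hx, hx1, hx2⟩ := hb
        obtain ⟨h3, h4⟩ := ((hV x).1 hx).2.2 _ hvw hx1 hx2
        right
        rw [nextVertex_eq_min (fun u hu => (hmax u hu).trans h4) h1 hmin]
        exact le_antisymm (hmin _ v.2) h3
      · push Not at hb
        left
        refine le_antisymm (nextVertex_le w.2 hlt') ?_
        exact hb _ (nextVertex_mem V v) (lt_nextVertex_of_exists ⟨_, w.2, hlt'⟩)
  refine ⟨⟨V, hcell⟩, le_antisymm (lo_le h1) (hmin _ (lo_mem ⟨V, hcell⟩)),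
    le_antisymm (hmax _ (hi_mem ⟨V, hcell⟩)) (le_hi h2)⟩

/-! ## Neighbouring cells -/

/-- The cell `β` lies immediately below an edge of `α`. -/
def Attached (α β : Cell S) : Prop := LiesBelow α β (lo β) (hi β)

theorem Attached.ne {α β : Cell S} (h : Attached α β) : α ≠ β := by
  rintro rfl
  obtain ⟨w, hw, h1, h2⟩ := exists_mid α
  have := h.2.2.1 w hw
  grind

theorem Attached.part_iff {α β : Cell S} (h : Attached α β) (i : Fin n) :
    part β i = topEdge β ↔ part α i ≠ ⟨lo β, h.1⟩ := by
  rw [part_eq_topEdge_iff, ne_eq, LiesBelow.part_eq_iff h]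
  grind

/-- Nothing lies between two neighbouring cells, so a third cell sees both through the same edge. -/
theorem Attached.dir_eq_dir (hS : IsDissection S) {α β γ : Cell S} (h : Attached α β)
    (hα : γ ≠ α) (hβ : γ ≠ β) : dir γ α = dir γ β := by
  have hlα := lo_lt_hi α
  have hlβ := lo_lt_hi β
  have hlγ := lo_lt_hi γ
  have h1 := lo_le h.1
  have h2 := le_hi h.2.1
  rcases cell_cases hS hα with ⟨x, x', h'⟩ | ⟨x, x', h'⟩ | h'
  · have h'' : LiesBelow γ β x x' :=
      ⟨h'.1, h'.2.1, h'.2.2.1, h'.2.2.2.1.trans h1, h2.trans h'.2.2.2.2⟩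
    rw [h'.dir_eq, h''.dir_eq]
  · rw [h'.dir_eq_topEdge]
    rcases cell_cases hS hβ with ⟨y, y', h''⟩ | ⟨y, y', h''⟩ | h''
    · exfalso
      have h3 := h'.2.2.1 _ h.1
      have h4 := h'.2.2.1 _ h.2.1
      have h5 := lo_le h''.1
      have h6 := le_hi h''.2.1
      obtain ⟨_, _, _, h7, h8⟩ := h'
      obtain ⟨_, _, _, h9, h10⟩ := h''
      exact hβ (cell_ext hS (by grind) (by grind))
    · rw [h''.dir_eq_topEdge]
    · rw [dir_eq_topEdge_of_le h'']
  · rw [dir_eq_topEdge_of_le h', dir_eq_topEdge_of_le (by grind)]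

theorem Attached.unique (hS : IsDissection S) {α β γ : Cell S} (h : Attached α γ)
    (h' : Attached β γ) : α = β := by
  have key : ∀ {α β : Cell S}, Attached α γ → Attached β γ →
      ∀ v v', ¬ LiesBelow α β v v' := by
    intro α β h h' v v' hb
    have h1 := hb.2.2.1 _ h.1
    have h2 := hb.2.2.1 _ h.2.1
    have h3 := lo_le h'.1
    have h4 := le_hi h'.2.1
    obtain ⟨_, _, _, h7, h8⟩ := hb
    have hl := lo_lt_hi γ
    exact h'.ne (cell_ext hS (by grind) (by grind))
  by_contra hne
  rcases cell_cases hS hne with ⟨v, v', hb⟩ | ⟨v, v', hb⟩ | hb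
  · exact key h h' v v' hb
  · exact key h' h v v' hb
  · have h1 := lo_le h.1
    have h2 := le_hi h.2.1
    have h3 := lo_le h'.1
    have h4 := le_hi h'.2.1
    have hl := lo_lt_hi γ
    grind

/-- The parent of `β` is the cell under the least lid strictly containing the lid of `β`. Leastness
prevents any diagonal from hiding the ends of that lid from the parent. -/
theorem exists_attached (hS : IsDissection S) {β : Cell S} (hβ : (lo β, hi β) ∈ S) :
    ∃ α, Attached α β := by
  have hlt := lo_lt_hi β
  obtain ⟨r, hr⟩ := exists_root (lo β).pos
  obtain ⟨k, hk⟩ := hS.exists_outside hβ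
  obtain ⟨g, hg, hgQ, hmin⟩ := exists_least_lid hS
    (fun g => g ≠ (lo β, hi β) ∧ g.1 ≤ lo β ∧ hi β ≤ g.2) (lo β)
    ⟨r, Or.inr ⟨lt_of_le_of_lt (hr _).1 (hlt.trans_le (hr _).2), hr⟩,
      fun h => by
        have := hr k
        rw [h] at this
        simp only at this hk
        grind, (hr _).1, (hr _).2⟩
    fun e he => ⟨he.2.1, hlt.trans_le he.2.2⟩
  obtain ⟨w, _, hw1, hw2⟩ := exists_mid β
  obtain ⟨α, h1, h2⟩ := exists_cell hS hg ⟨w, by grind, by grind⟩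
  have hmem : ∀ x, x = lo β ∨ x = hi β → x ∈ α.1 := by
    intro x hx
    rw [mem_cell_iff hS]
    refine ⟨by grind, by grind, fun f hf hf1 hf2 => ?_⟩
    have h3 := IsLid.cases hS (Or.inl hf) (Or.inl hβ)
    have h4 := hmin f (Or.inl hf)
    have h5 := IsLid.cases hS (Or.inl hf) hg
    have h6 := hS.lt hf
    simp only at h3
    rw [h1, h2]
    by_cases hfe : f = (lo β, hi β)
    · subst hfe
      simp only at hf1 hf2
      grind
    · have h7 := h4 ⟨hfe, by grind, by grind⟩
      grind
  refine ⟨α, hmem _ (Or.inl rfl), hmem _ (Or.inr rfl), fun x hx => ?_, le_rfl, le_rfl⟩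
  by_contra! hc
  obtain ⟨h3, h4⟩ := cut_off hS hβ hx hc.1 hc.2
  simp only at h3 h4
  exact hgQ.1 (Prod.ext (by grind) (by grind))

/-- The edge of a cell labelled by `v` is a side of the polygon. -/
def IsOuter (α : Cell S) (v : α.1) : Prop :=
  (v.1, nextVertex α.1 v) ∉ S ∧ (nextVertex α.1 v, v.1) ∉ S

theorem edge_trichotomy (hS : IsDissection S) (α : Cell S) (v : α.1) :
    IsOuter α v ∨ (∃ β, Attached α β ∧ v.1 = lo β) ∨ (v = topEdge α ∧ ∃ β, Attached β α) := by
  by_cases h : IsOuter α v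
  · exact Or.inl h
  right
  rw [IsOuter, not_and_or, not_not, not_not] at h
  by_cases hv : v = topEdge α
  · subst hv
    rw [nextVertex_topEdge] at h
    rcases h with h | h
    · exact absurd (hS.lt h) (not_lt.2 (lo_lt_hi α).le)
    · exact Or.inr ⟨rfl, exists_attached hS h⟩
  · have hlt := lt_nextVertex (lt_hi_of_ne hv)
    rcases h with h | h
    · left
      obtain ⟨β, h1, h2⟩ := exists_cell hS (Or.inl h) (hS.exists_between h)
      simp only at h1 h2
      refine ⟨β, ?_, h1.symm⟩
      rw [Attached, h1, h2]
      refine ⟨v.2, nextVertex_mem _ _, fun w hw => ?_, h1.ge, h2.le⟩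
      rcases le_or_gt w v.1 with h | h
      · exact Or.inl h
      · exact Or.inr (nextVertex_le hw h)
    · exact absurd (hS.lt h) (not_lt.2 hlt.le)

theorem IsOuter.part_eq_iff {α : Cell S} {v : α.1} (h : IsOuter α v)
    {i : Fin n} : part α i = v ↔ i = v.1 := by
  refine ⟨fun hi => ?_, fun hi => hi ▸ part_self v⟩
  by_cases hv : v = topEdge α
  · subst hv
    rw [part_eq_topEdge_iff] at hi
    rcases isLid_cell α with h' | h'
    · have := h.2
      rw [nextVertex_topEdge] at this
      exact absurd h' this
    · have := h'.2 i
      have h3 : (topEdge α).1 = PolygonDegeneration.hi α := rfl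
      rw [h3]
      grind
  · have hv' := lt_hi_of_ne hv
    rw [PolygonDegeneration.part_eq_iff hv'] at hi
    rcases edge_cases hv' with h' | h'
    · exact absurd h' h.1
    · have := h' i
      grind

/-- Only one leaf lies beyond a side. But `β` has three vertices, which as leaves lie beyond three
different edges of `β`; at most one of these edges points to `α`, so two distinct leaves would be
seen from `α` in the direction of `β`. -/
theorem IsOuter.dir_ne (hS : IsDissection S) {α β : Cell S} {v : α.1} (h : IsOuter α v)
    (hne : α ≠ β) : dir α β ≠ v := by
  intro hd
  obtain ⟨w, hw, h1, h2⟩ := exists_mid β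
  have hp : ∀ i, part α i = v ↔ i = v.1 := fun i => h.part_eq_iff
  have hw' : ∀ i, part β i ≠ dir β α → i = v.1 := fun i hi =>
    (hp i).1 ((part_eq_dir hS hne.symm hi).trans hd)
  by_cases h3 : dir β α = part β w
  · have h4 := hw' (lo β) fun h => by
      rw [← h, part_self ⟨w, hw⟩, part_self ⟨lo β, lo_mem β⟩] at h3
      exact h1.ne (congrArg Subtype.val h3)
    have h5 := hw' (hi β) fun h => by
      rw [← h, part_self ⟨w, hw⟩, part_self ⟨hi β, hi_mem β⟩] at h3
      exact h2.ne' (congrArg Subtype.val h3)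
    exact (h1.trans h2).ne (h4.trans h5.symm)
  · have h4 := hw' w fun h => h3 h.symm
    by_cases h5 : dir β α = part β (lo β)
    · have h6 := hw' (hi β) fun h => by
        rw [← h, part_self ⟨lo β, lo_mem β⟩, part_self ⟨hi β, hi_mem β⟩] at h5
        exact (h1.trans h2).ne' (congrArg Subtype.val h5)
      exact h2.ne (h4.trans h6.symm)
    · exact h1.ne ((hw' (lo β) fun h => h5 h.symm).trans h4.symm)

/-- Neighbouring cells, seen from either side. -/
structure IsNeighbor (α β : Cell S) : Prop where
  ne : α ≠ β
  part_iff : ∀ i, part β i = dir β α ↔ part α i ≠ dir α β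
  dir_eq : ∀ γ, γ ≠ α → γ ≠ β → dir γ α = dir γ β

theorem Attached.isNeighbor (hS : IsDissection S) {α β : Cell S} (h : Attached α β) :
    IsNeighbor α β where
  ne := h.ne
  part_iff i := by
    rw [LiesBelow.dir_eq h, LiesBelow.dir_eq_topEdge h]
    exact h.part_iff i
  dir_eq γ h1 h2 := h.dir_eq_dir hS h1 h2

theorem IsNeighbor.symm {α β : Cell S} (h : IsNeighbor α β) : IsNeighbor β α where
  ne := h.ne.symm
  part_iff i := by
    have := h.part_iff i
    tauto
  dir_eq γ h1 h2 := (h.dir_eq γ h2 h1).symm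

/-! ## Cells that separate given leaves -/

/-- The cell carrying the leaf is the one under the least lid above it. The last leaf lies under no
lid; it is the top edge of the root cell. -/
theorem exists_isOuter (hS : IsDissection S) (hn : 3 ≤ n) (i : Fin n) :
    ∃ (α : Cell S) (v : α.1), v.1 = i ∧ IsOuter α v := by
  obtain ⟨r, hr⟩ := exists_root (n := n) (by omega)
  have hrmid : ∃ k, r.1 < k ∧ k < r.2 := by
    refine ⟨⟨1, by omega⟩, ?_, ?_⟩
    · have := (hr ⟨0, by omega⟩).1
      simp only [Fin.le_def, Fin.lt_def] at *
      omega
    · have := (hr ⟨n - 1, by omega⟩).2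
      simp only [Fin.le_def, Fin.lt_def] at *
      omega
  have hrlid : IsLid S r := Or.inr ⟨by grind, hr⟩
  rcases (hr i).2.lt_or_eq with hi' | hi'
  · obtain ⟨e, he, heQ, hmin⟩ := exists_least_lid hS (fun e => e.1 ≤ i ∧ i < e.2) i
      ⟨r, hrlid, (hr i).1, hi'⟩ fun _ h => h
    have hmid : ∃ k, e.1 < k ∧ k < e.2 := by
      rcases he with h | h
      · exact hS.exists_between h
      · obtain ⟨k, hk1, hk2⟩ := hrmid
        have h1 := h.2 r.1
        have h2 := h.2 r.2
        exact ⟨k, by grind, by grind⟩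
    obtain ⟨α, h1, h2⟩ := exists_cell hS he hmid
    obtain ⟨v, hv1, hv2, hv3⟩ := exists_gap (α := α) (k := i) (by grind) (by grind)
    have hnot : (v.1, nextVertex α.1 v) ∉ S := fun h => by
      obtain ⟨h3, h4⟩ := hmin _ (Or.inl h) ⟨hv1, hv2⟩
      simp only at h3 h4
      obtain ⟨w, hw, h5, h6⟩ := exists_mid α
      have := nextVertex_le (v := v) hw (by grind)
      grind
    refine ⟨α, v, ?_, hnot, fun h => absurd (hS.lt h) (not_lt.2 (lt_nextVertex hv3).le)⟩
    rcases edge_cases hv3 with h | h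
    · exact absurd h hnot
    · have := h i
      grind
  · obtain ⟨α, h1, h2⟩ := exists_cell hS hrlid hrmid
    refine ⟨α, topEdge α, h2.trans hi'.symm, ?_, ?_⟩
    · rw [nextVertex_topEdge]
      exact fun h => absurd (hS.lt h) (not_lt.2 (lo_lt_hi α).le)
    · rw [nextVertex_topEdge]
      intro h
      obtain ⟨k, hk⟩ := hS.exists_outside h
      have h3 := hr k
      have h4 : (topEdge α).1 = hi α := rfl
      simp only [h4, h1, h2] at hk
      grind

/-- Two leaves below the root are separated by the cell of the least lid above them. -/
theorem exists_cell_separating (hS : IsDissection S) {i j k : Fin n} (hij : i < j)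
    (hjk : j < k) : ∃ α : Cell S, lo α ≤ i ∧ j < hi α ∧ part α i ≠ part α j ∧
      ∀ g, IsLid S g → g.1 ≤ i → j < g.2 → g.1 ≤ lo α ∧ hi α ≤ g.2 := by
  obtain ⟨r, hr⟩ := exists_root i.pos
  obtain ⟨e, he, heQ, hmin⟩ := exists_least_lid hS (fun e => e.1 ≤ i ∧ j < e.2) i
    ⟨r, Or.inr ⟨((hr i).1.trans_lt hij).trans_le (hr j).2, hr⟩, (hr i).1,
      hjk.trans_le (hr k).2⟩ fun _ h => ⟨h.1, hij.trans h.2⟩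
  obtain ⟨α, h1, h2⟩ := exists_cell hS he ⟨j, by grind, by grind⟩
  refine ⟨α, by grind, by grind, fun hp => ?_, fun g hg h3 h4 => ?_⟩
  · obtain ⟨v, hv1, hv2, hv3⟩ := exists_gap (α := α) (k := i) (by grind) (by grind)
    have hv := (part_eq_iff hv3).2 ⟨hv1, hv2⟩
    have hv4 := (part_eq_iff hv3).1 (hp.symm.trans hv)
    rcases edge_cases hv3 with h | h
    · obtain ⟨h5, h6⟩ := hmin _ (Or.inl h) ⟨hv1, hv4.2⟩
      simp only at h5 h6
      obtain ⟨w, hw, h7, h8⟩ := exists_mid α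
      have := nextVertex_le (v := v) hw (by grind)
      grind
    · have := h j
      grind
  · rw [h1, h2]
    exact hmin g hg ⟨h3, h4⟩

/-- This is the median of three leaves in the dual tree. It is the least cell above `i` and `j`,
unless `j` and `k` enter that cell together; then it is the least cell above `j` and `k`, which has
`i` outside. -/
theorem exists_cell_separating_three (hS : IsDissection S) {i j k : Fin n} (hij : i < j)
    (hjk : j < k) :
    ∃ α : Cell S, part α i ≠ part α j ∧ part α j ≠ part α k ∧ part α i ≠ part α k := by
  obtain ⟨α, h1, h2, h3, h4⟩ := exists_cell_separating hS hij hjk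
  by_cases hjk' : part α j = part α k
  · obtain ⟨v, hv1, hv2, hv3⟩ := exists_gap (α := α) (k := j) (by grind) h2
    have hv := (part_eq_iff hv3).2 ⟨hv1, hv2⟩
    have hk := (part_eq_iff hv3).1 (hjk'.symm.trans hv)
    have hi' : ¬ (v.1 ≤ i ∧ i < nextVertex α.1 v) := fun h =>
      h3 (((part_eq_iff hv3).2 h).trans hv.symm)
    obtain ⟨β, h5, h6, h7, h8⟩ := exists_cell_separating hS hjk hk.2
    rcases edge_cases hv3 with h | h
    · obtain ⟨h9, h10⟩ := h8 _ (Or.inl h) hv1 hk.2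
      simp only at h9 h10
      have h11 : part β i = topEdge β := part_eq_topEdge (Or.inl (by grind))
      refine ⟨β, ?_, h7, ?_⟩ <;> rw [h11, ne_comm, ne_eq, part_eq_topEdge_iff] <;> grind
    · have := h k
      grind
  · refine ⟨α, h3, hjk', fun hik => ?_⟩
    obtain ⟨v, hv1, hv2, hv3⟩ := exists_gap (α := α) (k := i) h1 (by grind)
    have hv := (part_eq_iff hv3).2 ⟨hv1, hv2⟩
    have hk := (part_eq_iff hv3).1 (hik.symm.trans hv)
    exact h3 (hv.trans ((part_eq_iff hv3).2 ⟨by grind, by grind⟩).symm)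

/-- A diagonal of the dissection does not separate two pairs of leaves that reach a cell through
four different edges. -/
theorem not_separated (hS : IsDissection S) (α : Cell S) {e : Fin n × Fin n} (he : e ∈ S)
    {i j k l : Fin n} (hij : part α i ≠ part α j) (hkl : part α k ≠ part α l) :
    ¬ ((e.1 ≤ i ∧ i < e.2) ∧ (e.1 ≤ j ∧ j < e.2) ∧ ¬ (e.1 ≤ k ∧ k < e.2) ∧
      ¬ (e.1 ≤ l ∧ l < e.2)) := by
  obtain ⟨β, h1, h2⟩ := exists_cell hS (Or.inl he) (hS.exists_between he)
  have hin : ∀ x, part β x = topEdge β ↔ ¬ (e.1 ≤ x ∧ x < e.2) := fun x => by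
    rw [part_eq_topEdge_iff]
    grind
  rw [← not_iff_comm.1 (hin i).symm, ← not_iff_comm.1 (hin j).symm, ← hin, ← hin]
  rintro ⟨hi, hj, hk, hl⟩
  by_cases hne : α = β
  · subst hne
    exact hkl (hk.trans hl.symm)
  · by_cases hd : dir β α = topEdge β
    · have hx : ∀ x, part β x ≠ topEdge β → part α x = dir α β := fun x h => by
        by_contra hc
        exact h ((part_eq_dir hS hne hc).trans hd)
      exact hij ((hx i hi).trans (hx j hj).symm)
    · have hx : ∀ x, part β x = topEdge β → part α x = dir α β := fun x h => by
        by_contra hc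
        exact hd ((part_eq_dir hS hne hc).symm.trans h)
      exact hkl ((hx k hk).trans (hx l hl).symm)

/-- Two leaves that reach a cell through the same edge are separated from all leaves that do not
by a diagonal of the dissection. -/
theorem exists_separating_diagonal (α : Cell S) {i j : Fin n} (hij : i ≠ j)
    (hp : part α i = part α j) :
    ∃ e ∈ S, ((∀ x, part α x = part α i ↔ (e.1 ≤ x ∧ x < e.2)) ∨
      (∀ x, part α x = part α i ↔ ¬ (e.1 ≤ x ∧ x < e.2))) := by
  have hout : ¬ IsOuter α (part α i) := fun h =>
    hij ((h.part_eq_iff.1 rfl).trans (h.part_eq_iff.1 hp.symm).symm)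
  by_cases hv : part α i = topEdge α
  · rcases isLid_cell α with h | h
    · refine ⟨_, h, Or.inr fun x => ?_⟩
      rw [hv, part_eq_topEdge_iff]
      grind
    · have hx : ∀ x, part α x = topEdge α → x = hi α := fun x hx => by
        rw [part_eq_topEdge_iff] at hx
        have := h.2 x
        grind
      exact absurd ((hx i hv).trans (hx j (hp.symm.trans hv)).symm) hij
  · have hlt := lt_hi_of_ne hv
    rcases edge_cases hlt with h | h
    · exact ⟨_, h, Or.inl fun x => part_eq_iff hlt⟩
    · have h1 := (part_eq_iff hlt).1 rfl
      have h2 := (part_eq_iff hlt).1 hp.symm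
      have h3 := h i
      have h4 := h j
      grind

/-! ## Adjacent edges of a cell -/

/-- Two edges of a polygon are equal or adjacent. -/
def Near {I : Type} [LinearOrder I] (x y : I) : Prop :=
  x = y ∨ (x < y ∧ CyclicallyAdjacent x y) ∨ (y < x ∧ CyclicallyAdjacent y x)

theorem Near.refl {I : Type} [LinearOrder I] (x : I) : Near x x := Or.inl rfl

theorem Near.symm {I : Type} [LinearOrder I] {x y : I} (h : Near x y) : Near y x := by
  unfold Near at *
  tauto

theorem near_of_gap {α : Cell S} {v w : α.1} (h : v.1 < w.1)
    (h' : ∀ x ∈ α.1, x ≤ v.1 ∨ w.1 ≤ x) : Near v w :=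
  Or.inr (Or.inl ⟨h, Or.inl fun k hk => by
    have := h' k.1 k.2
    have h1 : v.1 < k.1 := hk.1
    have h2 : k.1 < w.1 := hk.2
    grind⟩)

theorem near_topEdge (α : Cell S) : Near ⟨lo α, lo_mem α⟩ (topEdge α) :=
  Or.inr (Or.inl ⟨lo_lt_hi α, Or.inr fun k => ⟨lo_le k.2, le_hi k.2⟩⟩)

/-- Seen from `β`, a vertex of another cell `α` lies beyond the edge towards `α` or beyond an
edge adjacent to it. -/
theorem near_part_dir (hS : IsDissection S) {α β : Cell S} (hne : β ≠ α) (v : α.1) :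
    Near (part β v.1) (dir β α) := by
  have h1 := lo_le v.2
  have h2 := le_hi v.2
  have hlo : v.1 = lo β → Near (part β v.1) (topEdge β) := fun h => by
    rw [h, part_self ⟨lo β, lo_mem β⟩]
    exact near_topEdge β
  have htop : (v.1 < lo β ∨ hi β ≤ v.1) → Near (part β v.1) (topEdge β) := fun h => by
    rw [part_eq_topEdge h]
    exact Near.refl _
  rcases cell_cases hS hne with ⟨x, x', h⟩ | ⟨x, x', h⟩ | h
  · rw [LiesBelow.dir_eq h]
    by_cases hv : v.1 < x'
    · rw [(LiesBelow.part_eq_iff h).2 ⟨h.2.2.2.1.trans h1, hv⟩]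
      exact Near.refl _
    · have hv' : v.1 = x' := le_antisymm (h2.trans h.2.2.2.2) (not_lt.1 hv)
      rw [hv', part_self ⟨x', h.2.1⟩]
      exact (near_of_gap h.lt h.2.2.1).symm
  · rw [LiesBelow.dir_eq_topEdge h]
    have h3 := h.2.2.1 v.1 v.2
    obtain ⟨_, _, _, h4, h5⟩ := h
    rcases h3 with h3 | h3
    · rcases (h3.trans h4).lt_or_eq with h6 | h6
      · exact htop (Or.inl h6)
      · exact hlo h6
    · exact htop (Or.inr (h5.trans h3))
  · rw [dir_eq_topEdge_of_le h]
    rcases h with h | h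
    · exact htop (Or.inr (h.trans h1))
    · rcases (h2.trans h).lt_or_eq with h6 | h6
      · exact htop (Or.inl h6)
      · exact hlo h6

/-- Consecutive leaves reach a cell through the same edge or through adjacent ones. -/
theorem near_part_part (α : Cell S) {i j : Fin n} (hij : i < j) (h : CyclicallyAdjacent i j) :
    Near (part α i) (part α j) := by
  rcases h with h | h
  · by_cases hj : j ∈ α.1
    · rw [part_self ⟨j, hj⟩]
      by_cases hi' : i < lo α
      · have : j = lo α := le_antisymm
          (by
            by_contra! hc
            exact h _ ⟨hi', hc⟩) (lo_le hj)
        subst this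
        rw [part_eq_topEdge (Or.inl hi')]
        exact (near_topEdge α).symm
      · have h1 := part_spec (not_lt.1 hi')
        refine near_of_gap (lt_of_le_of_lt h1.1 hij) fun x hx => ?_
        by_contra! hc
        have h2 := h1.2 x hx
        exact h x ⟨by grind, hc.2⟩
    · have : part α j = part α i := by
        by_cases hi' : i < lo α
        · rw [part_eq_topEdge (Or.inl hi'), part_eq_topEdge (Or.inl _)]
          by_contra! hc
          rcases hc.lt_or_eq with hc | hc
          · exact h _ ⟨hi', hc⟩
          · exact hj (hc ▸ lo_mem α)
        · have h1 := part_spec (not_lt.1 hi')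
          refine part_eq_of (part α i).2 (h1.1.trans hij.le) fun w hw hwj => ?_
          refine h1.2 w hw ?_
          by_contra! hc
          rcases hwj.lt_or_eq with hwj | hwj
          · exact h _ ⟨hc, hwj⟩
          · exact hj (hwj ▸ hw)
      rw [this]
      exact Near.refl _
  · rw [part_eq_topEdge (α := α) (i := j) (Or.inr (h _).2)]
    by_cases hi' : i < lo α
    · rw [part_eq_topEdge (Or.inl hi')]
      exact Near.refl _
    · have : i = lo α := le_antisymm (h _).1 (not_lt.1 hi')
      rw [this, part_self ⟨lo α, lo_mem α⟩]
      exact near_topEdge α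

/-- Adjacent edges of a cell are those through which two consecutive leaves reach it. -/
theorem exists_leaves_of_adjacent {α : Cell S} {v w : α.1} (hvw : v < w)
    (h : CyclicallyAdjacent v w) :
    ∃ i j : Fin n, i < j ∧ CyclicallyAdjacent i j ∧
      ((part α i = v ∧ part α j = w) ∨ (part α i = w ∧ part α j = v)) := by
  have hvw' : v.1 < w.1 := hvw
  have hpred : ∀ x y : Fin n, x < y → ∃ z : Fin n, x ≤ z ∧ z < y ∧ ∀ k, ¬ (z < k ∧ k < y) := by
    intro x y hxy
    refine ⟨⟨y.1 - 1, by omega⟩, ?_, ?_, fun k => ?_⟩ <;>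
      simp only [Fin.le_def, Fin.lt_def] at * <;> omega
  rcases h with h | h
  · obtain ⟨z, hz1, hz2, hz3⟩ := hpred _ _ hvw'
    refine ⟨z, w.1, hz2, Or.inl hz3, Or.inl ⟨part_eq_of v.2 hz1 fun x hx hxz => ?_, part_self w⟩⟩
    by_contra! hc
    exact h ⟨x, hx⟩ ⟨hc, show x < w.1 from lt_of_le_of_lt hxz hz2⟩
  · have hv : v.1 = lo α := le_antisymm (h ⟨lo α, lo_mem α⟩).1 (lo_le v.2)
    have hw : w = topEdge α := Subtype.ext (le_antisymm (le_hi w.2) (h (topEdge α)).2)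
    obtain ⟨r, hr⟩ := exists_root v.1.pos
    by_cases h0 : r.1 < lo α
    · obtain ⟨z, hz1, hz2, hz3⟩ := hpred _ _ h0
      refine ⟨z, v.1, by rwa [hv], by rw [hv]; exact Or.inl hz3, Or.inr ⟨?_, part_self v⟩⟩
      rw [hw]
      exact part_eq_topEdge (Or.inl hz2)
    · have h1 : r.1 = v.1 := le_antisymm (hr _).1 (by rw [hv]; exact not_lt.1 h0)
      refine ⟨r.1, r.2, ((hr v).1.trans_lt hvw').trans_le (hr w).2, Or.inr hr, Or.inl ⟨by rw [h1]; exact part_self v, ?_⟩⟩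
      rw [hw]
      exact part_eq_topEdge (Or.inr (hr _).2)

/-! ## Plücker coordinates without order on the indices -/

/-- The coordinate `p_{xy} = p_{yx}`, with the convention `p_{xx} = 1`. -/
def symCoord {I : Type} [LinearOrder I] (p : Pairs I → ℂ) (x y : I) : ℂ :=
  if h : x < y then p ⟨(x, y), h⟩ else if h : y < x then p ⟨(y, x), h⟩ else 1

section SymCoord

variable {I : Type} [LinearOrder I] (p : Pairs I → ℂ)

theorem symCoord_of_lt {x y : I} (h : x < y) : symCoord p x y = p ⟨(x, y), h⟩ := dif_pos h

theorem symCoord_comm (x y : I) : symCoord p x y = symCoord p y x := by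
  unfold symCoord
  rcases lt_trichotomy x y with h | rfl | h
  · simp [h, h.not_gt]
  · rfl
  · simp [h, h.not_gt]

theorem symCoord_self (x : I) : symCoord p x x = 1 := by simp [symCoord]

theorem symCoord_pair (q : Pairs I) : symCoord p q.1.1 q.1.2 = p q := symCoord_of_lt p q.2

/-- The condition selects the single pair `{x, y}`, and no pair at all if `x = y`. This is the
reason for the convention `p_{xx} = 1`: cells off the path contribute trivial factors. -/
theorem prod_pairs_ite [Fintype I] (x y : I) :
    (∏ q : Pairs I, if ¬ (x = q.1.1 ↔ y = q.1.1) ∧ ¬ (x = q.1.2 ↔ y = q.1.2) then p q else 1) =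
      symCoord p x y := by
  have key : ∀ x y : I, ∀ h : x < y,
      (∏ q : Pairs I, if ¬ (x = q.1.1 ↔ y = q.1.1) ∧ ¬ (x = q.1.2 ↔ y = q.1.2) then p q else 1) =
        p ⟨(x, y), h⟩ := by
    intro x y h
    rw [Finset.prod_eq_single ⟨(x, y), h⟩]
    · rw [if_pos]
      simp [h.ne, h.ne']
    · rintro ⟨⟨u, v⟩, huv⟩ _ hne
      have huv' : u < v := huv
      rw [if_neg]
      rintro ⟨h1, h2⟩
      simp only at h1 h2
      refine hne (Subtype.ext (Prod.ext ?_ ?_)) <;> simp only <;> grind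
    · intro h
      exact absurd (Finset.mem_univ _) h
  rcases lt_trichotomy x y with h | rfl | h
  · rw [key x y h, symCoord_of_lt p h]
  · rw [symCoord_self]
    exact Finset.prod_eq_one fun q _ => by simp
  · rw [symCoord_comm, symCoord_of_lt p h, ← key y x h]
    refine Finset.prod_congr rfl fun q _ => ?_
    congr 1
    simp only [eq_iff_iff]
    tauto

/-- The Plücker relation in symmetric form. -/
def PluckerRel (P : I → I → ℂ) (i j k l : I) : Prop :=
  P i j * P k l - P i k * P j l + P i l * P j k = 0

theorem mem_grassCone_iff :
    p ∈ grassCone I ↔ ∀ i j k l, i < j → j < k → k < l → PluckerRel (symCoord p) i j k l := by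
  unfold PluckerRel
  constructor
  · intro h i j k l hij hjk hkl
    rw [symCoord_of_lt p hij, symCoord_of_lt p hkl, symCoord_of_lt p (hij.trans hjk),
      symCoord_of_lt p (hjk.trans hkl), symCoord_of_lt p ((hij.trans hjk).trans hkl),
      symCoord_of_lt p hjk]
    exact h i j k l hij hjk hkl
  · intro h i j k l hij hjk hkl
    have := h i j k l hij hjk hkl
    rwa [symCoord_of_lt p hij, symCoord_of_lt p hkl, symCoord_of_lt p (hij.trans hjk),
      symCoord_of_lt p (hjk.trans hkl), symCoord_of_lt p ((hij.trans hjk).trans hkl),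
      symCoord_of_lt p hjk] at this

end SymCoord

/-- Leaves in increasing order may enter a cell in an order that is only cyclically increasing;
invariance under rotation absorbs the difference. -/
theorem PluckerRel.rotate {I : Type} {P : I → I → ℂ} (hP : ∀ x y, P x y = P y x) {i j k l : I}
    (h : PluckerRel P i j k l) : PluckerRel P j k l i := by
  unfold PluckerRel at *
  rw [hP l i, hP k i, hP j i]
  linear_combination h

/-! ## The glued coordinates -/

/-- The coordinates of one cell. -/
def cellCoord (y : ForestPair S → ℂ) (α : Cell S) : Pairs (α.1 : Finset (Fin n)) → ℂ :=
  fun q => y ⟨α, q⟩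

theorem symCoord_gluedPlucker (y : ForestPair S → ℂ) (i j : Fin n) :
    symCoord (gluedPlucker S y) i j =
      ∏ α : Cell S, symCoord (cellCoord y α) (part α i) (part α j) := by
  have key : ∀ i j (h : i < j), gluedPlucker S y ⟨(i, j), h⟩ =
      ∏ α : Cell S, symCoord (cellCoord y α) (part α i) (part α j) := by
    intro i j h
    refine Finset.prod_congr rfl fun α _ => ?_
    rw [← prod_pairs_ite]
    refine Finset.prod_congr rfl fun q _ => ?_
    simp only [onPath_iff]
    rfl
  rcases lt_trichotomy i j with h | rfl | h
  · rw [symCoord_of_lt _ h, key i j h]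
  · rw [symCoord_self]
    exact (Finset.prod_eq_one fun α _ => symCoord_self _ _).symm
  · rw [symCoord_comm, symCoord_of_lt _ h, key j i h]
    exact Finset.prod_congr rfl fun α _ => symCoord_comm _ _ _

/-- The product of the coordinates along the path from the cell `α` to the `i`-th leaf. -/
noncomputable def reach (y : ForestPair S → ℂ) (α : Cell S) (i : Fin n) : ℂ :=
  ∏ β ∈ Finset.univ.erase α, symCoord (cellCoord y β) (part β i) (dir β α)

/-- In any cell other than `α`, at least one of the two leaves enters through the edge towards `α`,
so the factor of that cell belongs to the other leaf alone. Thus the dependence on `i` and `j`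
separates, apart from the coordinate of `α`. -/
theorem gluedPlucker_eq_reach (hS : IsDissection S) (y : ForestPair S → ℂ) {α : Cell S}
    {i j : Fin n} (h : part α i ≠ part α j) :
    symCoord (gluedPlucker S y) i j =
      symCoord (cellCoord y α) (part α i) (part α j) * reach y α i * reach y α j := by
  rw [symCoord_gluedPlucker, ← Finset.mul_prod_erase _ _ (Finset.mem_univ α), mul_assoc, reach,
    reach, ← Finset.prod_mul_distrib]
  congr 1
  refine Finset.prod_congr rfl fun β hβ => ?_
  have hne : α ≠ β := (Finset.ne_of_mem_erase hβ).symm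
  by_cases hi : part α i = dir α β
  · rw [part_eq_dir hS hne (i := j) (fun hj => h (hi.trans hj.symm)), symCoord_self, mul_one]
  · rw [part_eq_dir hS hne hi, symCoord_self, one_mul, symCoord_comm]

/-- One step along the path: the factor of `β` is split off, and the remaining cells see `α` and `β`
in the same direction. -/
theorem reach_eq_of_isNeighbor (y : ForestPair S → ℂ) {α β : Cell S}
    (h : IsNeighbor α β) {i : Fin n} (hi : part α i = dir α β) :
    reach y α i = symCoord (cellCoord y β) (part β i) (dir β α) * reach y β i := by
  rw [reach, reach, ← Finset.mul_prod_erase _ _ (Finset.mem_erase.2 ⟨h.ne.symm,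
    Finset.mem_univ β⟩), ← Finset.mul_prod_erase (Finset.univ.erase β) _
    (Finset.mem_erase.2 ⟨h.ne, Finset.mem_univ α⟩), hi, symCoord_self, one_mul,
    Finset.erase_right_comm]
  congr 1
  refine Finset.prod_congr rfl fun γ hγ => ?_
  rw [Finset.mem_erase, Finset.mem_erase] at hγ
  rw [h.dir_eq γ hγ.1 hγ.2.1]

theorem reach_eq_one (hS : IsDissection S) (y : ForestPair S → ℂ) {α : Cell S} {v : α.1}
    (hv : IsOuter α v) {i : Fin n} (hi : part α i = v) : reach y α i = 1 := by
  refine Finset.prod_eq_one fun β hβ => ?_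
  have hne : α ≠ β := (Finset.ne_of_mem_erase hβ).symm
  rw [part_eq_dir hS hne (i := i), symCoord_self]
  rw [hi]
  exact (hv.dir_ne hS hne).symm

/-- Induction along the paths from the leaves inwards. -/
theorem edge_induction (hS : IsDissection S) {motive : ∀ α : Cell S, α.1 → Prop}
    (outer : ∀ α v, IsOuter α v → motive α v)
    (step : ∀ α β, IsNeighbor α β → (Attached α β ∨ Attached β α) →
      (∀ f : β.1, f ≠ dir β α → motive β f) → motive α (dir α β)) (α : Cell S) (v : α.1) :
    motive α v := by
  induction hm : (Finset.univ.filter fun i => part α i = v).card using Nat.strong_induction_on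
    generalizing α v with
  | _ m ih =>
    by_cases hv : IsOuter α v
    · exact outer α v hv
    obtain ⟨β, hβ, hatt, rfl⟩ : ∃ β, IsNeighbor α β ∧ (Attached α β ∨ Attached β α) ∧
        dir α β = v := by
      rcases edge_trichotomy hS α v with h | ⟨β, h, hv⟩ | ⟨rfl, β, h⟩
      · exact absurd h hv
      · exact ⟨β, h.isNeighbor hS, Or.inl h, (LiesBelow.dir_eq h).trans (Subtype.ext hv.symm)⟩
      · exact ⟨β, (h.isNeighbor hS).symm, Or.inr h, LiesBelow.dir_eq_topEdge h⟩
    refine step α β hβ hatt fun f hf => ih _ ?_ β f rfl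
    rw [← hm]
    refine Finset.card_lt_card ?_
    rw [Finset.ssubset_iff_of_subset]
    -- The measure is the number of leaves beyond an edge. It drops strictly because `β` has a third
    -- edge, whose leaves lie beyond the given edge but not beyond `f`.
    · have hcard : ∃ g : β.1, g ≠ dir β α ∧ g ≠ f := by
        by_contra! hc
        have : (Finset.univ : Finset β.1) ⊆ {dir β α, f} := fun g _ => by
          rw [Finset.mem_insert, Finset.mem_singleton]
          exact or_iff_not_imp_left.2 (hc g)
        have h1 := Finset.card_le_card this
        have h2 := Finset.card_le_two (a := dir β α) (b := f)
        have h3 := β.2.1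
        rw [Finset.card_univ, Fintype.card_coe] at h1
        omega
      obtain ⟨g, hg1, hg2⟩ := hcard
      refine ⟨g.1, ?_, ?_⟩
      · rw [Finset.mem_filter]
        refine ⟨Finset.mem_univ _, not_not.1 fun h => hg1 ?_⟩
        rw [← (hβ.part_iff g.1).2 h, part_self]
      · rw [Finset.mem_filter, part_self]
        exact fun h => hg2 h.2
    · intro i hi
      rw [Finset.mem_filter] at hi ⊢
      refine ⟨Finset.mem_univ _, not_not.1 fun h => hf ?_⟩
      rw [← (hβ.part_iff i).2 h, hi.2]

/-! ## The equations of the central fibre -/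

/-- The diagonal `e` separates the leaves `i`, `j` from `k`, `l`. -/
def Separates (e : Fin n × Fin n) (i j k l : Fin n) : Prop :=
  ((e.1 ≤ i ∧ i < e.2) ↔ (e.1 ≤ j ∧ j < e.2)) ∧ ((e.1 ≤ k ∧ k < e.2) ↔ (e.1 ≤ l ∧ l < e.2)) ∧
    ¬ ((e.1 ≤ i ∧ i < e.2) ↔ (e.1 ≤ k ∧ k < e.2))

/-- The equations of the central fibre of the family attached to `S`. -/
structure IsInitial (S : Finset (Fin n × Fin n)) (P : Fin n → Fin n → ℂ) : Prop where
  rank_one : ∀ e ∈ S, ∀ i j k l, (e.1 ≤ i ∧ i < e.2) → (e.1 ≤ j ∧ j < e.2) →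
    ¬ (e.1 ≤ k ∧ k < e.2) → ¬ (e.1 ≤ l ∧ l < e.2) → P i k * P j l = P i l * P j k
  plucker : ∀ i j k l, i < j → j < k → k < l → (∀ e ∈ S, ¬ Separates e i j k l) →
    (∀ e ∈ S, ¬ Separates e i l j k) → PluckerRel P i j k l

theorem part_le_part {α : Cell S} {i j : Fin n} (h : lo α ≤ i) (hij : i ≤ j) :
    part α i ≤ part α j :=
  (part_spec (h.trans hij)).2 _ (part α i).2 ((part_spec h).1.trans hij)

theorem pluckerRel_parts {y : ForestPair S → ℂ} (hy : y ∈ coneProduct S) (α : Cell S)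
    {i j k l : Fin n} (hij : i < j) (hjk : j < k) (hkl : k < l) (h1 : part α i ≠ part α j)
    (h3 : part α i ≠ part α l) (h4 : part α j ≠ part α k) (h6 : part α k ≠ part α l) :
    PluckerRel (symCoord (cellCoord y α)) (part α i) (part α j) (part α k) (part α l) := by
  have hc := (mem_grassCone_iff _).1 (hy α)
  have hj : lo α ≤ j := by
    by_contra! hc
    exact h1 (by rw [part_eq_topEdge (Or.inl hc), part_eq_topEdge (Or.inl (hij.trans hc))])
  have hjk' := lt_of_le_of_ne (part_le_part hj hjk.le) h4
  have hkl' := lt_of_le_of_ne (part_le_part (hj.trans hjk.le) hkl.le) h6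
  by_cases hi : lo α ≤ i
  · exact hc _ _ _ _ (lt_of_le_of_ne (part_le_part hi hij.le) h1) hjk' hkl'
  · have hi' := part_eq_topEdge (α := α) (Or.inl (not_le.1 hi))
    have hli : part α l < part α i := by
      refine lt_of_le_of_ne ?_ h3.symm
      rw [hi']
      exact le_hi (part α l).2
    exact ((hc _ _ _ _ hjk' hkl' hli).rotate (symCoord_comm _)).rotate (symCoord_comm _)
      |>.rotate (symCoord_comm _)

/-- From the cell just below a diagonal, all outside leaves are seen through the top edge, so the
block is a product of row and column factors. For an unseparated quadruple, the median cell of three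
of the leaves sees all four through different edges; its own Plücker relation is multiplied by the
four `reach` factors. -/
theorem isInitial_gluedPlucker (hS : IsDissection S) {y : ForestPair S → ℂ}
    (hy : y ∈ coneProduct S) : IsInitial S (symCoord (gluedPlucker S y)) where
  rank_one e he i j k l hi hj hk hl := by
    obtain ⟨α, h1, h2⟩ := exists_cell hS (Or.inl he) (hS.exists_between he)
    have hin : ∀ x, part α x = topEdge α ↔ ¬ (e.1 ≤ x ∧ x < e.2) := fun x => by
      rw [part_eq_topEdge_iff]
      grind
    have hi' : part α i ≠ topEdge α := fun h => (hin i).1 h hi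
    have hj' : part α j ≠ topEdge α := fun h => (hin j).1 h hj
    have hk' := (hin k).2 hk
    have hl' := (hin l).2 hl
    rw [gluedPlucker_eq_reach hS y (α := α) (i := i) (j := k) (by rwa [hk']),
      gluedPlucker_eq_reach hS y (α := α) (i := i) (j := l) (by rwa [hl']),
      gluedPlucker_eq_reach hS y (α := α) (i := j) (j := k) (by rwa [hk']),
      gluedPlucker_eq_reach hS y (α := α) (i := j) (j := l) (by rwa [hl']), hk', hl']
    ring
  plucker i j k l hij hjk hkl h h' := by
    obtain ⟨α, h1, h2, h3⟩ := exists_cell_separating_three hS hij hjk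
    have h4 : part α i ≠ part α l := fun hp => by
      obtain ⟨e, he, h5⟩ := exists_separating_diagonal α ((hij.trans hjk).trans hkl).ne hp
      refine h' e he ?_
      unfold Separates
      rcases h5 with h5 | h5 <;>
      · have := h5 i
        have := h5 j
        have := h5 k
        have := h5 l
        grind
    -- No hypothesis on separation enters here: `j, l` and `i, k` interlace, and a diagonal cannot
    -- separate interlaced pairs.
    have h5 : part α j ≠ part α l := fun hp => by
      obtain ⟨e, he, h5⟩ := exists_separating_diagonal α (hjk.trans hkl).ne hp
      rcases h5 with h5 | h5 <;>
      · have := h5 i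
        have := h5 j
        have := h5 k
        have := h5 l
        grind
    have h6 : part α k ≠ part α l := fun hp => by
      obtain ⟨e, he, h5⟩ := exists_separating_diagonal α hkl.ne hp
      refine h e he ?_
      unfold Separates
      rcases h5 with h5 | h5 <;>
      · have := h5 i
        have := h5 j
        have := h5 k
        have := h5 l
        grind
    have hp := pluckerRel_parts hy α hij hjk hkl h1 h4 h2 h6
    unfold PluckerRel at *
    rw [gluedPlucker_eq_reach hS y h1, gluedPlucker_eq_reach hS y h2,
      gluedPlucker_eq_reach hS y h3, gluedPlucker_eq_reach hS y h4,
      gluedPlucker_eq_reach hS y h5, gluedPlucker_eq_reach hS y h6]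
    linear_combination (reach y α i * reach y α j * reach y α k * reach y α l) * hp

/-! ## Factorization of the solutions of the central equations -/

theorem Attached.mem {α β : Cell S} (h : Attached α β) : (lo β, hi β) ∈ S := by
  rcases isLid_cell β with h' | ⟨_, h'⟩
  · exact h'
  · obtain ⟨w, hw, h1, h2⟩ := exists_mid α
    have h3 := h.2.2.1 w hw
    have h4 := h' w
    have h5 := h' (lo α)
    have h6 := h' (hi α)
    grind

theorem Attached.nextVertex_dir {α β : Cell S} (h : Attached α β) :
    ((dir α β).1, nextVertex α.1 (dir α β)) = (lo β, hi β) := by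
  rw [LiesBelow.dir_eq h, LiesBelow.nextVertex_eq h]

theorem Attached.nextVertex_dir' {α β : Cell S} (h : Attached α β) :
    (nextVertex β.1 (dir β α), (dir β α).1) = (lo β, hi β) := by
  rw [LiesBelow.dir_eq_topEdge h, nextVertex_topEdge]
  rfl

theorem Attached.part_eq_dir_iff {α β : Cell S} (h : Attached α β) (i : Fin n) :
    part α i = dir α β ↔ lo β ≤ i ∧ i < hi β := by
  rw [LiesBelow.dir_eq h, LiesBelow.part_eq_iff h]

/-- Row and column through a non-zero entry give the factors. A zero block gets both factors zero,
so that one factor vanishes exactly when the other does; the reconstruction needs this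
normalization. -/
theorem exists_rank_one {A : Type} {P : A → A → ℂ} {s : A → Prop}
    (h : ∀ i j k l, s i → s j → ¬ s k → ¬ s l → P i k * P j l = P i l * P j k) :
    ∃ u v : A → ℂ, (∀ i j, s i → ¬ s j → P i j = u i * v j) ∧
      ((∃ i, s i ∧ u i ≠ 0) ↔ ∃ j, ¬ s j ∧ v j ≠ 0) := by
  by_cases hP : ∃ i j, s i ∧ ¬ s j ∧ P i j ≠ 0
  · obtain ⟨i₀, j₀, hi, hj, h0⟩ := hP
    refine ⟨fun i => P i j₀, fun j => P i₀ j / P i₀ j₀, fun i j hi' hj' => ?_,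
      ⟨fun _ => ⟨j₀, hj, div_ne_zero h0 h0⟩, fun _ => ⟨i₀, hi, h0⟩⟩⟩
    rw [mul_div_assoc', eq_div_iff h0]
    exact h i i₀ j j₀ hi' hi hj' hj
  · push Not at hP
    exact ⟨0, 0, fun i j hi hj => by simp [hP i j hi hj], by simp⟩

/-- Rank-one factorizations of `P` along all edges of the forest. -/
structure IsEdgeFactor (S : Finset (Fin n × Fin n)) (P : Fin n → Fin n → ℂ)
    (w : ∀ α : Cell S, α.1 → Fin n → ℂ) : Prop where
  outer : ∀ α v, IsOuter α v → w α v v.1 = 1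
  neighbor : ∀ α β, IsNeighbor α β → (Attached α β ∨ Attached β α) → ∀ i j,
    part α i = dir α β → part β j = dir β α → P i j = w α (dir α β) i * w β (dir β α) j
  support : ∀ α β, IsNeighbor α β → (Attached α β ∨ Attached β α) →
    (∃ i, part α i = dir α β ∧ w α (dir α β) i ≠ 0) →
    ∃ j, part β j = dir β α ∧ w β (dir β α) j ≠ 0

/-- One factorization is chosen for each diagonal. The factor of the leaves under it goes to the
cell above, that of the leaves outside to the cell below; sides get the constant `1`. -/
theorem IsInitial.exists_isEdgeFactor (hS : IsDissection S) {P : Fin n → Fin n → ℂ}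
    (hP : IsInitial S P) (hsymm : ∀ i j, P i j = P j i) : ∃ w, IsEdgeFactor S P w := by
  have key : ∀ e : Fin n × Fin n, ∃ u v : Fin n → ℂ, e ∈ S →
      (∀ i j, (e.1 ≤ i ∧ i < e.2) → ¬ (e.1 ≤ j ∧ j < e.2) → P i j = u i * v j) ∧
      ((∃ i, (e.1 ≤ i ∧ i < e.2) ∧ u i ≠ 0) ↔ ∃ j, ¬ (e.1 ≤ j ∧ j < e.2) ∧ v j ≠ 0) := by
    intro e
    by_cases he : e ∈ S
    · obtain ⟨u, v, h⟩ := exists_rank_one (s := fun i => e.1 ≤ i ∧ i < e.2) (P := P)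
        fun i j k l hi hj hk hl => hP.rank_one e he i j k l hi hj hk hl
      exact ⟨u, v, fun _ => h⟩
    · exact ⟨0, 0, fun h => absurd h he⟩
  choose u v huv using key
  let w : ∀ α : Cell S, α.1 → Fin n → ℂ := fun α x =>
    if (x.1, nextVertex α.1 x) ∈ S then u (x.1, nextVertex α.1 x)
    else if (nextVertex α.1 x, x.1) ∈ S then v (nextVertex α.1 x, x.1) else 1
  have hu : ∀ α β, Attached α β → w α (dir α β) = u (lo β, hi β) := fun α β h => by
    simp only [w]
    rw [h.nextVertex_dir, if_pos h.mem]
  have hv : ∀ α β, Attached α β → w β (dir β α) = v (lo β, hi β) := fun α β h => by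
    simp only [w]
    have h1 : ((dir β α).1, nextVertex β.1 (dir β α)) ∉ S := fun h' => by
      have h2 := hS.lt h'
      have h3 := h.nextVertex_dir'
      rw [Prod.mk.injEq] at h3
      simp only [h3.1, h3.2] at h2
      exact absurd h2 (lo_lt_hi β).not_gt
    rw [if_neg h1, h.nextVertex_dir', if_pos h.mem]
  have hin : ∀ α β : Cell S, Attached α β → IsNeighbor α β → ∀ j, part β j = dir β α ↔
      ¬ (lo β ≤ j ∧ j < hi β) := fun α β h hn j => by
    rw [hn.part_iff, ne_eq, h.part_eq_dir_iff]
  refine ⟨w, ⟨fun α x hx => ?_, fun α β hn h i j hi hj => ?_, fun α β hn h => ?_⟩⟩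
  · simp only [w]
    rw [if_neg hx.1, if_neg hx.2]
    rfl
  · rcases h with h | h
    · rw [hu α β h, hv α β h]
      exact (huv _ h.mem).1 i j ((h.part_eq_dir_iff i).1 hi) ((hin α β h hn j).1 hj)
    · rw [hu β α h, hv β α h, mul_comm, hsymm]
      exact (huv _ h.mem).1 j i ((h.part_eq_dir_iff j).1 hj) ((hin β α h hn.symm i).1 hi)
  · rcases h with h | h
    · rw [hu α β h, hv α β h]
      simp only [hin α β h hn, h.part_eq_dir_iff]
      exact (huv _ h.mem).2.1
    · rw [hu β α h, hv β α h]
      simp only [hin β α h hn.symm, h.part_eq_dir_iff]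
      exact (huv _ h.mem).2.2

namespace IsEdgeFactor

variable {P : Fin n → Fin n → ℂ} {w : ∀ α : Cell S, α.1 → Fin n → ℂ}

theorem exists_factor (hS : IsDissection S) (hw : IsEdgeFactor S P w) (α : Cell S) (v : α.1) :
    ∃ g : Fin n → ℂ, ∀ i j, part α i = v → part α j ≠ v → P i j = w α v i * g j := by
  rcases edge_trichotomy hS α v with h | ⟨β, h, hv⟩ | ⟨rfl, β, h⟩
  · refine ⟨P v.1, fun i j hi _ => ?_⟩
    rw [h.part_eq_iff.1 hi, hw.outer α v h, one_mul]
  · obtain rfl : v = dir α β := by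
      rw [LiesBelow.dir_eq h]
      exact Subtype.ext hv
    have hn := h.isNeighbor hS
    exact ⟨_, fun i j hi hj => hw.neighbor α β hn (Or.inl h) i j hi ((hn.part_iff j).2 hj)⟩
  · rw [← LiesBelow.dir_eq_topEdge h]
    have hn := (h.isNeighbor hS).symm
    exact ⟨_, fun i j hi hj => hw.neighbor α β hn (Or.inr h) i j hi ((hn.part_iff j).2 hj)⟩

/-- The block between two edges of a cell has rows proportional to one edge factor and columns
proportional to the other, so it is a scalar times their product. That scalar is the coordinate of
the cell; it is set to zero where a factor vanishes and the block leaves it undetermined. -/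
theorem exists_coord (hS : IsDissection S) (hw : IsEdgeFactor S P w)
    (hsymm : ∀ i j, P i j = P j i) {α : Cell S} {v v' : α.1} (hv : v ≠ v') :
    ∃ c : ℂ, (∀ i j, part α i = v → part α j = v' → P i j = c * w α v i * w α v' j) ∧
      ((∀ i, part α i = v → w α v i = 0) ∨ (∀ j, part α j = v' → w α v' j = 0) → c = 0) := by
  obtain ⟨g, hg⟩ := hw.exists_factor hS α v
  obtain ⟨g', hg'⟩ := hw.exists_factor hS α v'
  have h1 : ∀ i j, part α i = v → part α j = v' → P i j = w α v i * g j := fun i j hi hj =>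
    hg i j hi (by rw [hj]; exact hv.symm)
  have h2 : ∀ i j, part α i = v → part α j = v' → P i j = w α v' j * g' i := fun i j hi hj => by
    rw [hsymm]
    exact hg' j i hj (by rwa [hi])
  by_cases hN : (∀ i, part α i = v → w α v i = 0) ∨ ∀ j, part α j = v' → w α v' j = 0
  · refine ⟨0, fun i j hi hj => ?_, fun _ => rfl⟩
    rcases hN with hN | hN
    · rw [h1 i j hi hj, hN i hi]
      ring
    · rw [h2 i j hi hj, hN j hj]
      ring
  · refine ⟨?_, ?_, fun h => absurd h hN⟩
    · push Not at hN
      exact P hN.1.choose hN.2.choose / (w α v hN.1.choose * w α v' hN.2.choose)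
    · push Not at hN
      obtain ⟨hi₀, hwi⟩ := hN.1.choose_spec
      obtain ⟨hj₀, hwj⟩ := hN.2.choose_spec
      intro i j hi hj
      set i₀ := hN.1.choose
      set j₀ := hN.2.choose
      rw [div_mul_eq_mul_div, div_mul_eq_mul_div, eq_div_iff (mul_ne_zero hwi hwj)]
      have e1 := h1 i j hi hj
      have e2 := (h1 i₀ j hi₀ hj).symm.trans (h2 i₀ j hi₀ hj)
      have e3 := (h1 i₀ j₀ hi₀ hj₀).symm.trans (h2 i₀ j₀ hi₀ hj₀)
      have e4 := h1 i₀ j₀ hi₀ hj₀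
      rw [e1, e4]
      linear_combination (w α v i * w α v' j₀) * e2 - w α v i * w α v' j * e3

end IsEdgeFactor

/-- Every solution of the equations of the central fibre is glued from the cells. -/
theorem exists_gluedPlucker_eq (hS : IsDissection S) (hn : 3 ≤ n) {p : Pairs (Fin n) → ℂ}
    (hP : IsInitial S (symCoord p)) : ∃ y ∈ coneProduct S, gluedPlucker S y = p := by
  obtain ⟨w, hw⟩ := hP.exists_isEdgeFactor hS (symCoord_comm p)
  choose c hc hc0 using fun (α : Cell S) (q : Pairs α.1) =>
    hw.exists_coord hS (symCoord_comm p) (ne_of_lt q.2)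
  let y : ForestPair S → ℂ := fun q => c q.1 q.2
  have hY : ∀ (α : Cell S) (v v' : α.1), v ≠ v' →
      (∀ i j, part α i = v → part α j = v' →
        symCoord p i j = symCoord (cellCoord y α) v v' * w α v i * w α v' j) ∧
      ((∀ i, part α i = v → w α v i = 0) ∨ (∀ j, part α j = v' → w α v' j = 0) →
        symCoord (cellCoord y α) v v' = 0) := by
    intro α v v' hne
    rcases lt_or_gt_of_ne hne with h | h
    · rw [symCoord_of_lt _ h]
      exact ⟨hc α ⟨(v, v'), h⟩, hc0 α ⟨(v, v'), h⟩⟩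
    · rw [symCoord_comm, symCoord_of_lt _ h]
      refine ⟨fun i j hi hj => ?_, fun hN => hc0 α ⟨(v', v), h⟩ hN.symm⟩
      rw [symCoord_comm, mul_right_comm]
      exact hc α ⟨(v', v), h⟩ j i hj hi
  have hmem : y ∈ coneProduct S := by
    intro α
    change cellCoord y α ∈ _
    rw [mem_grassCone_iff]
    intro v₁ v₂ v₃ v₄ h12 h23 h34
    have h13 := h12.trans h23
    have h24 := h23.trans h34
    have h14 := h13.trans h34
    -- Each term of the relation contains every edge once. If the factor of one edge vanishes, so do
    -- all coordinates involving it; otherwise leaves with non-zero factors are chosen and their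
    -- relation is divided by the four factors.
    by_cases hz : ∃ v, (v = v₁ ∨ v = v₂ ∨ v = v₃ ∨ v = v₄) ∧ ∀ i, part α i = v → w α v i = 0
    · obtain ⟨v, hv, hz⟩ := hz
      have h0 : ∀ v', v ≠ v' → symCoord (cellCoord y α) v v' = 0 := fun v' h =>
        (hY α v v' h).2 (Or.inl hz)
      have h0' : ∀ v', v ≠ v' → symCoord (cellCoord y α) v' v = 0 := fun v' h => by
        rw [symCoord_comm, h0 v' h]
      unfold PluckerRel
      rcases hv with rfl | rfl | rfl | rfl
      · rw [h0 _ h12.ne, h0 _ h13.ne, h0 _ h14.ne]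
        ring
      · rw [h0' _ h12.ne', h0 _ h23.ne, h0 _ h24.ne]
        ring
      · rw [h0' _ h13.ne', h0' _ h23.ne', h0 _ h34.ne]
        ring
      · rw [h0' _ h14.ne', h0' _ h24.ne', h0' _ h34.ne']
        ring
    · push Not at hz
      obtain ⟨i₁, hi₁, hw₁⟩ := hz v₁ (by simp)
      obtain ⟨i₂, hi₂, hw₂⟩ := hz v₂ (by simp)
      obtain ⟨i₃, hi₃, hw₃⟩ := hz v₃ (by simp)
      obtain ⟨i₄, hi₄, hw₄⟩ := hz v₄ (by simp)
      have hrel : PluckerRel (symCoord p) i₁ i₂ i₃ i₄ := by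
        have hlt : ∀ {v v' v'' : α.1} {i i' : Fin n}, v < v' → v' < v'' → part α i = v →
            part α i' = v' → i < i' := by
          intro v v' v'' i i' h h' hi hi'
          have hv'' := le_hi v''.2
          have h1 := (part_eq_iff (α := α) (v := v)
            (lt_of_lt_of_le (show v.1 < v''.1 from h.trans h') hv'')).1 hi
          have h2 := (part_eq_iff (α := α) (v := v')
            (lt_of_lt_of_le (show v'.1 < v''.1 from h') hv'')).1 hi'
          exact h1.2.trans_le ((nextVertex_le v'.2 h).trans h2.1)
        have hi12 := hlt h12 h23 hi₁ hi₂
        have hi23 := hlt h23 h34 hi₂ hi₃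
        have hsep : ∀ i j k l, part α i ≠ part α j → part α k ≠ part α l →
            ∀ e ∈ S, ¬ Separates e i j k l := by
          intro i j k l hij hkl e he hs
          have h1 := not_separated hS α he hij hkl
          have h2 := not_separated hS α he hkl hij
          unfold Separates at hs
          grind
        -- Only the last edge can be the top one, and a leaf beyond the top edge may come before all
        -- the others.
        have h4 : i₃ < i₄ ∨ i₄ < i₁ := by
          have hv4 := le_hi v₄.2
          have h3 := (part_eq_iff (α := α) (v := v₃)
            (lt_of_lt_of_le (show v₃.1 < v₄.1 from h34) hv4)).1 hi₃
          by_cases htop : v₄ = topEdge α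
          · rw [htop, part_eq_topEdge_iff] at hi₄
            have h5 := (part_eq_iff (α := α) (v := v₁)
              (lt_of_lt_of_le (show v₁.1 < v₄.1 from h14) hv4)).1 hi₁
            have h6 := lo_le v₁.2
            have h7 := le_hi (nextVertex_mem α.1 v₃)
            grind
          · have h5 := (part_eq_iff (lt_hi_of_ne htop)).1 hi₄
            exact Or.inl (h3.2.trans_le ((nextVertex_le v₄.2 h34).trans h5.1))
        rcases h4 with h4 | h4
        · refine hP.plucker _ _ _ _ hi12 hi23 h4 (hsep _ _ _ _ ?_ ?_) (hsep _ _ _ _ ?_ ?_)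
          · rw [hi₁, hi₂]; exact h12.ne
          · rw [hi₃, hi₄]; exact h34.ne
          · rw [hi₁, hi₄]; exact h14.ne
          · rw [hi₂, hi₃]; exact h23.ne
        · refine (hP.plucker i₄ i₁ i₂ i₃ h4 hi12 hi23 (hsep _ _ _ _ ?_ ?_)
            (hsep _ _ _ _ ?_ ?_)).rotate (symCoord_comm p)
          · rw [hi₁, hi₄]; exact h14.ne'
          · rw [hi₂, hi₃]; exact h23.ne
          · rw [hi₄, hi₃]; exact h34.ne'
          · rw [hi₁, hi₂]; exact h12.ne
      unfold PluckerRel at hrel ⊢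
      rw [(hY α _ _ h12.ne).1 _ _ hi₁ hi₂, (hY α _ _ h13.ne).1 _ _ hi₁ hi₃,
        (hY α _ _ h14.ne).1 _ _ hi₁ hi₄, (hY α _ _ h23.ne).1 _ _ hi₂ hi₃,
        (hY α _ _ h24.ne).1 _ _ hi₂ hi₄, (hY α _ _ h34.ne).1 _ _ hi₃ hi₄] at hrel
      have hne := mul_ne_zero (mul_ne_zero (mul_ne_zero hw₁ hw₂) hw₃) hw₄
      refine (mul_eq_zero.1 ?_).resolve_left hne
      linear_combination hrel
  -- The chosen coordinates reproduce the edge factors, by induction inwards from the leaves. A leaf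
  -- with non-zero factor on the far side allows cancellation; edges with zero factor are excluded,
  -- since all coordinates at them vanish anyway.
  have hreach : ∀ (α : Cell S) (v : α.1), (∃ i, part α i = v ∧ w α v i ≠ 0) →
      ∀ i, part α i = v → reach y α i = w α v i := by
    intro α v
    induction α, v using edge_induction hS with
    | outer α v hv =>
      intro _ i hi
      rw [reach_eq_one hS y hv hi, hv.part_eq_iff.1 hi, hw.outer α v hv]
    | step α β hnb hat ih =>
      intro hN i hi
      obtain ⟨j, hj, hwj⟩ := hw.support α β hnb hat hN
      have hf : part β i ≠ dir β α := fun h => (hnb.part_iff i).1 h hi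
      have h1 := (hY β _ _ hf).1 i j rfl hj
      rw [hw.neighbor α β hnb hat i j hi hj] at h1
      rw [reach_eq_of_isNeighbor y hnb hi, mul_right_cancel₀ hwj h1]
      by_cases hNf : ∃ i', part β i' = part β i ∧ w β (part β i) i' ≠ 0
      · rw [ih _ hf hNf i rfl]
      · push Not at hNf
        rw [(hY β _ _ hf).2 (Or.inl hNf), zero_mul, zero_mul]
  refine ⟨y, hmem, funext fun q => ?_⟩
  rw [← symCoord_pair (gluedPlucker S y), ← symCoord_pair p]
  -- The comparison is made at the cell carrying the first leaf, where both the path factor and the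
  -- edge factor of that leaf are `1`.
  obtain ⟨α, v, hv, hout⟩ := exists_isOuter hS hn q.1.1
  have hi : part α q.1.1 = v := hout.part_eq_iff.2 hv.symm
  have hne : part α q.1.1 ≠ part α q.1.2 := by
    rw [hi]
    exact fun h => q.2.ne (hv.symm.trans (hout.part_eq_iff.1 h.symm).symm)
  have h1 : w α v q.1.1 = 1 := hv ▸ hout.part_eq_iff.2 rfl ▸ hw.outer α v hout
  rw [gluedPlucker_eq_reach hS y hne, (hY α _ _ hne).1 _ _ rfl rfl, reach_eq_one hS y hout hi]
  rw [hi, h1]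
  by_cases hN : ∃ j, part α j = part α q.1.2 ∧ w α (part α q.1.2) j ≠ 0
  · rw [hreach α _ hN _ rfl]
  · push Not at hN
    rw [← hi, (hY α _ _ hne).2 (Or.inr hN)]
    ring

/-! ## The central fibre -/

theorem tCoeff_extend {Γ : Finset (Fin n × Fin n)} (hS : S ⊆ Γ) (t : S → ℂ)
    (i j k l x y z w : Fin n) :
    tCoeff Γ (fun e => if h : e.1 ∈ S then t ⟨e.1, h⟩ else 1) i j k l x y z w =
      tCoeff S t i j k l x y z w := by
  unfold tCoeff
  let F : Fin n × Fin n → ℂ := fun e => (if h : e ∈ S then t ⟨e, h⟩ else 1) ^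
    ((maxWeight e i j k l - (weight e x y + weight e z w)) / 2)
  have h1 := Finset.prod_coe_sort Γ F
  have h2 := Finset.prod_coe_sort S F
  refine h1.trans ((Finset.prod_subset hS fun e _ he => ?_).symm.trans (h2.symm.trans ?_))
  · simp only [F, dif_neg he, one_pow]
  · exact Finset.prod_congr rfl fun e _ => by simp only [F, dif_pos e.2]

/-- Setting `t_e = 1` just deletes the factors of `e` from the coefficients. The result no longer
depends on `Γ`, so both triangulations give the same subfamily. -/
theorem subfamily_eq_family {Γ : Finset (Fin n × Fin n)} (hS : S ⊆ Γ) :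
    subfamily Γ S = family S := by
  ext x
  simp only [subfamily, family, Set.mem_ofPred_eq, tCoeff_extend hS]

open Classical in
/-- The number `1` or `0`, according to whether a proposition holds. -/
noncomputable def truthValue (p : Prop) : ℂ := if p then 1 else 0

theorem truthValue_pos {p : Prop} (h : p) : truthValue p = 1 := if_pos h

theorem truthValue_neg {p : Prop} (h : ¬ p) : truthValue p = 0 := if_neg h

theorem tCoeff_zero (i j k l x y z w : Fin n) :
    tCoeff S 0 i j k l x y z w =
      truthValue
        (∀ e ∈ S, (maxWeight e i j k l - (weight e x y + weight e z w)) / 2 = 0) := by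
  unfold tCoeff truthValue
  split_ifs with h
  · exact Finset.prod_eq_one fun e _ => by rw [h e.1 e.2, pow_zero]
  · push Not at h
    obtain ⟨e, he, h⟩ := h
    exact Finset.prod_eq_zero (Finset.mem_univ ⟨e, he⟩) (by simp [h])

theorem weight_eq {e : Fin n × Fin n} (he : e.1 < e.2) (i j : Fin n) :
    weight e i j =
      if ¬ ((e.1 ≤ i ∧ i < e.2) ↔ (e.1 ≤ j ∧ j < e.2)) then 1 else 0 := by
  simp only [weight, OnPath, min_eq_left he.le, max_eq_right he.le, Finset.mem_Ico]

/-- The propositions say which of four leaves lie under a diagonal. For an interval the alternating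
patterns are impossible, so the middle monomial always has maximal weight, and an outer one loses
weight only when its two pairs are separated. -/
theorem defect_of_props (a b c d : Prop) [Decidable a] [Decidable b] [Decidable c] [Decidable d]
    (h1 : ¬ (a ∧ ¬ b ∧ c)) (h2 : ¬ (b ∧ ¬ c ∧ d)) :
    let w : (p q : Prop) → [Decidable p] → [Decidable q] → ℕ := fun p q => if ¬ (p ↔ q) then 1 else 0
    let m := max (w a b + w c d) (max (w a c + w b d) (w a d + w b c))
    ((m - (w a b + w c d)) / 2 = 0 ↔ ¬ ((a ↔ b) ∧ (c ↔ d) ∧ ¬ (a ↔ c))) ∧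
      (m - (w a c + w b d)) / 2 = 0 ∧
      ((m - (w a d + w b c)) / 2 = 0 ↔ ¬ ((a ↔ d) ∧ (b ↔ c) ∧ ¬ (a ↔ b))) := by
  by_cases a <;> by_cases b <;> by_cases c <;> by_cases d <;> simp_all

theorem weight_defect {e : Fin n × Fin n} (he : e.1 < e.2) {i j k l : Fin n} (hij : i < j)
    (hjk : j < k) (hkl : k < l) :
    ((maxWeight e i j k l - (weight e i j + weight e k l)) / 2 = 0 ↔ ¬ Separates e i j k l) ∧
    (maxWeight e i j k l - (weight e i k + weight e j l)) / 2 = 0 ∧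
    ((maxWeight e i j k l - (weight e i l + weight e j k)) / 2 = 0 ↔
      ¬ Separates e i l j k) := by
  have h1 : ¬ ((e.1 ≤ i ∧ i < e.2) ∧ ¬ (e.1 ≤ j ∧ j < e.2) ∧ (e.1 ≤ k ∧ k < e.2)) := by grind
  have h2 : ¬ ((e.1 ≤ j ∧ j < e.2) ∧ ¬ (e.1 ≤ k ∧ k < e.2) ∧ (e.1 ≤ l ∧ l < e.2)) := by grind
  simp only [maxWeight, weight_eq he, Separates]
  exact defect_of_props _ _ _ _ h1 h2

theorem Separates.cases {e : Fin n × Fin n} {i j k l : Fin n} (h : Separates e i j k l) :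
    ((e.1 ≤ i ∧ i < e.2) ∧ (e.1 ≤ j ∧ j < e.2) ∧ ¬ (e.1 ≤ k ∧ k < e.2) ∧
      ¬ (e.1 ≤ l ∧ l < e.2)) ∨
    ((e.1 ≤ k ∧ k < e.2) ∧ (e.1 ≤ l ∧ l < e.2) ∧ ¬ (e.1 ≤ i ∧ i < e.2) ∧
      ¬ (e.1 ≤ j ∧ j < e.2)) := by
  obtain ⟨h1, h2, h3⟩ := h
  by_cases hi : e.1 ≤ i ∧ i < e.2
  · have hk := fun hk => h3 (iff_of_true hi hk)
    exact Or.inl ⟨hi, h1.1 hi, hk, fun hl => hk (h2.2 hl)⟩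
  · have hk := not_not.1 fun hk => h3 (iff_of_false hi hk)
    exact Or.inr ⟨hk, h2.1 hk, hi, fun hj => hi (h1.2 hj)⟩

/-- Each equation at `t = 0` is either the full relation or a binomial, never a monomial: for both
outer terms to die, two diagonals would have to cross. The binomials are exactly the minors of the
blocks across diagonals. -/
theorem mem_centralFiber_iff {Γ : Finset (Fin n × Fin n)} (hΓ : S ⊆ Γ) (hS : IsDissection S)
    (x : ℙ ℂ (Pairs (Fin n) → ℂ)) :
    x ∈ centralFiber Γ S ↔ IsInitial S (symCoord x.rep) := by
  set P := symCoord x.rep with hPdef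
  have hsymm : ∀ i j, P i j = P j i := symCoord_comm x.rep
  have hP : ∀ i j (h : i < j), x.rep ⟨(i, j), h⟩ = P i j := fun i j h =>
    (symCoord_of_lt x.rep h).symm
  have hiff : x ∈ centralFiber Γ S ↔ ∀ i j k l : Fin n, i < j → j < k → k < l →
      truthValue (∀ e ∈ S, ¬ Separates e i j k l) *
        (P i j * P k l) - P i k * P j l +
      truthValue (∀ e ∈ S, ¬ Separates e i l j k) *
        (P i l * P j k) = 0 := by
    have h0 : x ∈ centralFiber Γ S ↔ (x, (0 : S → ℂ)) ∈ family S := by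
      rw [← subfamily_eq_family hΓ]
      rfl
    rw [h0]
    refine forall_congr' fun i => forall_congr' fun j => forall_congr' fun k =>
      forall_congr' fun l => forall_congr' fun hij => forall_congr' fun hjk =>
      forall_congr' fun hkl => ?_
    simp only [hP, tCoeff_zero]
    have h1 : (∀ e ∈ S, (maxWeight e i j k l - (weight e i j + weight e k l)) / 2 = 0) ↔
        ∀ e ∈ S, ¬ Separates e i j k l :=
      forall₂_congr fun e he => (weight_defect (hS.lt he) hij hjk hkl).1
    have h3 : (∀ e ∈ S, (maxWeight e i j k l - (weight e i l + weight e j k)) / 2 = 0) ↔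
        ∀ e ∈ S, ¬ Separates e i l j k :=
      forall₂_congr fun e he => (weight_defect (hS.lt he) hij hjk hkl).2.2
    have h2 : ∀ e ∈ S, (maxWeight e i j k l - (weight e i k + weight e j l)) / 2 = 0 :=
      fun e he => (weight_defect (hS.lt he) hij hjk hkl).2.1
    rw [h1, h3, truthValue_pos h2, one_mul]
  have hcross : ∀ {i j k l : Fin n}, i < j → j < k → k < l → ∀ {e f}, e ∈ S → f ∈ S →
      Separates e i j k l → Separates f i l j k → False := by
    intro i j k l hij hjk hkl e f he hf h1 h2
    have h3 := (nonCrossing_iff (hS.lt he) (hS.lt hf)).1 (hS.nonCrossing e he f hf)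
    unfold Separates at h1 h2
    grind
  rw [hiff]
  constructor
  · intro h
    have main : ∀ e ∈ S, ∀ i j k l, i < j → k < l → (e.1 ≤ i ∧ i < e.2) →
        (e.1 ≤ j ∧ j < e.2) → ¬ (e.1 ≤ k ∧ k < e.2) → ¬ (e.1 ≤ l ∧ l < e.2) →
        P i k * P j l = P i l * P j k := by
      intro e he i j k l hij hkl hi hj hk hl
      -- The two outside leaves lie both after the interval, on either side of it, or both before
      -- it. Accordingly a different outer monomial disappears.
      have hcase : (j < k) ∨ (k < i ∧ j < l) ∨ l < i := by grind
      rcases hcase with h1 | ⟨h1, h2⟩ | h1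
      · have hs : Separates e i j k l := by unfold Separates; grind
        have h4 := h i j k l hij h1 hkl
        rw [truthValue_neg (by push Not; exact ⟨e, he, hs⟩),
          truthValue_pos fun f hf hs' => hcross hij h1 hkl he hf hs hs'] at h4
        linear_combination -h4
      · have hs : Separates e k l i j := by unfold Separates; grind
        have h4 := h k i j l h1 hij h2
        rw [truthValue_neg (p := ∀ f ∈ S, ¬ Separates f k l i j) (by push Not; exact ⟨e, he, hs⟩),
          truthValue_pos fun f hf hs' => hcross h1 hij h2 hf he hs' hs] at h4
        rw [hsymm i k, hsymm j k]
        linear_combination h4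
      · have hs : Separates e k l i j := by unfold Separates; grind
        have h4 := h k l i j hkl h1 hij
        rw [truthValue_neg (by push Not; exact ⟨e, he, hs⟩),
          truthValue_pos fun f hf hs' => hcross hkl h1 hij he hf hs hs'] at h4
        rw [hsymm i k, hsymm j k, hsymm i l, hsymm j l]
        linear_combination -h4
    refine ⟨fun e he i j k l hi hj hk hl => ?_, fun i j k l hij hjk hkl h1 h2 => ?_⟩
    · rcases lt_trichotomy i j with hij | rfl | hij
      · rcases lt_trichotomy k l with hkl | rfl | hkl
        · exact main e he i j k l hij hkl hi hj hk hl
        · rfl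
        · exact (main e he i j l k hij hkl hi hj hl hk).symm
      · ring
      · rcases lt_trichotomy k l with hkl | rfl | hkl
        · linear_combination -main e he j i k l hij hkl hj hi hk hl
        · rfl
        · linear_combination main e he j i l k hij hkl hj hi hl hk
    · have h4 := h i j k l hij hjk hkl
      rwa [truthValue_pos h1, truthValue_pos h2, one_mul, one_mul] at h4
  · intro h i j k l hij hjk hkl
    by_cases h1 : ∀ e ∈ S, ¬ Separates e i j k l
    · by_cases h2 : ∀ e ∈ S, ¬ Separates e i l j k
      · rw [truthValue_pos h1, truthValue_pos h2, one_mul, one_mul]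
        exact h.plucker i j k l hij hjk hkl h1 h2
      · rw [truthValue_pos h1, truthValue_neg h2]
        push Not at h2
        obtain ⟨e, he, hs⟩ := h2
        rcases hs.cases with ⟨hi, hl, hj, hk⟩ | ⟨hj, hk, hi, hl⟩
        · have h4 := h.rank_one e he i l j k hi hl hj hk
          rw [hsymm l k, hsymm l j] at h4
          linear_combination h4
        · have h4 := h.rank_one e he j k i l hj hk hi hl
          rw [hsymm j i, hsymm k i] at h4
          linear_combination h4
    · rw [truthValue_neg h1]
      push Not at h1
      obtain ⟨e, he, hs⟩ := h1
      rw [truthValue_pos fun f hf hs' => hcross hij hjk hkl he hf hs hs']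
      rcases hs.cases with ⟨hi, hj, hk, hl⟩ | ⟨hk, hl, hi, hj⟩
      · have h4 := h.rank_one e he i j k l hi hj hk hl
        linear_combination -h4
      · have h4 := h.rank_one e he k l i j hk hl hi hj
        rw [hsymm k i, hsymm k j, hsymm l i, hsymm l j] at h4
        linear_combination -h4

/-! ## The action of the gluing torus -/

theorem gluingEmbed_outer (h : GluingTorus S) {α : Cell S} {v : α.1} (hv : IsOuter α v) :
    gluingEmbed S h ⟨α, v⟩ = h.1 :=
  (dif_neg hv.1).trans (dif_neg hv.2)

theorem Attached.gluingEmbed_upper (h : GluingTorus S) {α β : Cell S} (hat : Attached α β) :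
    gluingEmbed S h ⟨α, dir α β⟩ = h.2 ⟨(lo β, hi β), hat.mem⟩ := by
  have h1 := hat.nextVertex_dir
  have h2 : ((dir α β).1, nextVertex α.1 (dir α β)) ∈ S := h1 ▸ hat.mem
  exact (dif_pos h2).trans (congrArg h.2 (Subtype.ext h1))

theorem Attached.gluingEmbed_lower (hS : IsDissection S) (h : GluingTorus S) {α β : Cell S}
    (hat : Attached α β) :
    gluingEmbed S h ⟨β, dir β α⟩ = (h.2 ⟨(lo β, hi β), hat.mem⟩)⁻¹ := by
  have h1 := hat.nextVertex_dir'
  have h2 : (nextVertex β.1 (dir β α), (dir β α).1) ∈ S := h1 ▸ hat.mem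
  have h3 : ((dir β α).1, nextVertex β.1 (dir β α)) ∉ S := fun h' =>
    (hS.lt h2).not_gt (hS.lt h')
  exact ((dif_neg h3).trans (dif_pos h2)).trans
    (congrArg (fun e => (h.2 e)⁻¹) (Subtype.ext h1))

theorem gluingEmbed_mul_eq_one (hS : IsDissection S) (h : GluingTorus S) {α β : Cell S}
    (hat : Attached α β ∨ Attached β α) :
    gluingEmbed S h ⟨α, dir α β⟩ * gluingEmbed S h ⟨β, dir β α⟩ = 1 := by
  rcases hat with hat | hat
  · rw [hat.gluingEmbed_upper, hat.gluingEmbed_lower hS, mul_inv_cancel]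
  · rw [hat.gluingEmbed_upper, hat.gluingEmbed_lower hS, inv_mul_cancel]

theorem symCoord_forestAct (τ : ForestEdge S → ℂˣ) (y : ForestPair S → ℂ) {α : Cell S}
    {v w : α.1} (hvw : v ≠ w) :
    symCoord (cellCoord (forestAct S τ y) α) v w =
      (τ ⟨α, v⟩ : ℂ) * (τ ⟨α, w⟩ : ℂ) * symCoord (cellCoord y α) v w := by
  rcases lt_or_gt_of_ne hvw with h | h
  · rw [symCoord_of_lt _ h, symCoord_of_lt _ h]
    rfl
  · rw [symCoord_comm, symCoord_of_lt _ h, symCoord_comm, symCoord_of_lt _ h,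
      mul_comm (τ ⟨α, v⟩ : ℂ)]
    rfl

/-- Along a path, the scalars at the two copies of each diagonal are inverse to each other. Only the
scalar of the leaf at one end and that of the edge of `α` at the other remain. -/
theorem reach_gluingAct (hS : IsDissection S) (h : GluingTorus S) (y : ForestPair S → ℂ)
    (α : Cell S) (v : α.1) : ∀ i, part α i = v →
      reach (gluingAct S h y) α i * (gluingEmbed S h ⟨α, v⟩ : ℂ) = (h.1 : ℂ) * reach y α i := by
  induction α, v using edge_induction hS with
  | outer α v hv =>
    intro i hi
    rw [reach_eq_one hS _ hv hi, reach_eq_one hS _ hv hi, gluingEmbed_outer h hv, mul_comm]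
  | step α β hnb hat ih =>
    intro i hi
    have hf : part β i ≠ dir β α := fun h => (hnb.part_iff i).1 h hi
    have h1 := ih _ hf i rfl
    have h2 : (gluingEmbed S h ⟨α, dir α β⟩ : ℂ) * (gluingEmbed S h ⟨β, dir β α⟩ : ℂ) = 1 := by
      rw [← Units.val_mul, gluingEmbed_mul_eq_one hS h hat, Units.val_one]
    rw [reach_eq_of_isNeighbor _ hnb hi, reach_eq_of_isNeighbor _ hnb hi, gluingAct,
      symCoord_forestAct _ _ hf, ← gluingAct]
    set A := symCoord (cellCoord y β) (part β i) (dir β α)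
    linear_combination (gluingEmbed S h ⟨β, dir β α⟩ * A * gluingEmbed S h ⟨α, dir α β⟩ : ℂ) * h1 +
      (h.1 * reach y β i * A : ℂ) * h2

theorem symCoord_gluedPlucker_gluingAct (hS : IsDissection S) (h : GluingTorus S)
    (y : ForestPair S → ℂ) {i j : Fin n} {α : Cell S} (hα : part α i ≠ part α j) :
    symCoord (gluedPlucker S (gluingAct S h y)) i j =
      (h.1 : ℂ) ^ 2 * symCoord (gluedPlucker S y) i j := by
  rw [gluedPlucker_eq_reach hS _ hα, gluedPlucker_eq_reach hS _ hα]
  have h1 := reach_gluingAct hS h y α _ i rfl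
  have h2 := reach_gluingAct hS h y α _ j rfl
  have h3 := symCoord_forestAct (gluingEmbed S h) y hα
  rw [gluingAct] at h1 h2 ⊢
  rw [h3]
  linear_combination (gluingEmbed S h ⟨α, part α j⟩ *
    symCoord (cellCoord y α) (part α i) (part α j) *
    reach (forestAct S (gluingEmbed S h) y) α j : ℂ) * h1 +
    ((h.1 : ℂ) * reach y α i * symCoord (cellCoord y α) (part α i) (part α j)) * h2

theorem gluedPlucker_gluingAct (hS : IsDissection S) (hn : 3 ≤ n) (h : GluingTorus S)
    (y : ForestPair S → ℂ) (q : Pairs (Fin n)) :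
    gluedPlucker S (gluingAct S h y) q = (h.1 : ℂ) ^ 2 * gluedPlucker S y q := by
  obtain ⟨α, v, hv, hout⟩ := exists_isOuter hS hn q.1.1
  have hne : part α q.1.1 ≠ part α q.1.2 := by
    rw [hout.part_eq_iff.2 hv.symm]
    exact fun h => q.2.ne (hv.symm.trans (hout.part_eq_iff.1 h.symm).symm)
  rw [← symCoord_pair (gluedPlucker S _), ← symCoord_pair (gluedPlucker S y),
    symCoord_gluedPlucker_gluingAct hS h y hne]

theorem forestAct_mem_coneProduct (τ : ForestEdge S → ℂˣ) {y : ForestPair S → ℂ}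
    (hy : y ∈ coneProduct S) : forestAct S τ y ∈ coneProduct S := by
  intro α i j k l hij hjk hkl
  have h := hy α i j k l hij hjk hkl
  simp only [forestAct]
  linear_combination (τ ⟨α, i⟩ * τ ⟨α, j⟩ * τ ⟨α, k⟩ * τ ⟨α, l⟩ : ℂ) * h

/-! ## Monomials in the coordinates of the forest -/

/-- The weights of the coordinates of the forest. -/
def pairWeight (S : Finset (Fin n × Fin n)) : GluingTorus S →* (ForestPair S → ℂˣ) where
  toFun h q := gluingEmbed S h ⟨q.1, q.2.1.1⟩ * gluingEmbed S h ⟨q.1, q.2.1.2⟩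
  map_one' := by
    funext q
    simp
  map_mul' h k := by
    funext q
    simp only [map_mul, Pi.mul_apply]
    exact mul_mul_mul_comm _ _ _ _

/-- The exponent of the monomial `∏ p_{ε,ε'}`. -/
noncomputable def gluedExp (S : Finset (Fin n × Fin n)) (ij : Pairs (Fin n)) : ForestPair S →₀ ℕ :=
  Finsupp.equivFunOnFinite.symm fun q =>
    if OnPath q.2.1.1.1 (nextVertex q.1.1 q.2.1.1) ij.1.1 ij.1.2 ∧
        OnPath q.2.1.2.1 (nextVertex q.1.1 q.2.1.2) ij.1.1 ij.1.2 then 1 else 0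

theorem eval_gluedExp (y : ForestPair S → ℂ) (ij : Pairs (Fin n)) :
    MvPolynomial.eval y (MvPolynomial.monomial (gluedExp S ij) 1) = gluedPlucker S y ij := by
  rw [MvPolynomial.eval_monomial, one_mul, Finsupp.prod_fintype _ _ fun _ => pow_zero _,
    Fintype.prod_sigma]
  refine Finset.prod_congr rfl fun α _ => Finset.prod_congr rfl fun q _ => ?_
  simp only [gluedExp, Finsupp.equivFunOnFinite_symm_apply_apply]
  split_ifs <;> simp

theorem monomialWeight_gluedExp (hS : IsDissection S) (hn : 3 ≤ n) (ij : Pairs (Fin n)) :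
    monomialWeight (pairWeight S) (gluedExp S ij) =
      MonoidHom.fst ℂˣ (S → ℂˣ) ^ 2 := by
  ext h
  -- At the point with all coordinates `1` the transformation rule reads off the weight of the
  -- monomial.
  have h1 := gluedPlucker_gluingAct hS hn h 1 ij
  rw [← eval_gluedExp, ← eval_gluedExp, MvPolynomial.eval_monomial, MvPolynomial.eval_monomial,
    Finsupp.prod_fintype _ _ fun _ => pow_zero _, Finsupp.prod_fintype _ _ fun _ => pow_zero _]
    at h1
  simp only [Pi.one_apply, one_pow, Finset.prod_const_one, mul_one, one_mul] at h1
  rw [MonoidHom.pow_apply, Units.val_pow_eq_pow_val]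
  refine Eq.trans ?_ h1
  simp only [monomialWeight, MonoidHom.coe_mk, OneHom.coe_mk, Units.coe_prod,
    Units.val_pow_eq_pow_val]
  refine Finset.prod_congr rfl fun q _ => ?_
  simp [pairWeight, gluingAct, forestAct]

/-- The monomial `M` contains a coordinate of the edge `ε`. -/
def UsesEdge (M : ForestPair S →₀ ℕ) (ε : ForestEdge S) : Prop :=
  ∃ q : ForestPair S, M q ≠ 0 ∧
    ((⟨q.1, q.2.1.1⟩ : ForestEdge S) = ε ∨ (⟨q.1, q.2.1.2⟩ : ForestEdge S) = ε)

/-- The monomial `M` contains the coordinate of the edges `v`, `w` of `α`. -/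
def UsesPair (M : ForestPair S →₀ ℕ) (α : Cell S) (v w : α.1) : Prop :=
  ∃ q : Pairs α.1, M ⟨α, q⟩ ≠ 0 ∧ (q.1.1 = v ∧ q.1.2 = w ∨ q.1.1 = w ∧ q.1.2 = v)

theorem UsesPair.symm {M : ForestPair S →₀ ℕ} {α : Cell S} {v w : α.1} (h : UsesPair M α v w) :
    UsesPair M α w v := by
  obtain ⟨q, h1, h2⟩ := h
  exact ⟨q, h1, h2.symm⟩

theorem UsesEdge.exists_usesPair {M : ForestPair S →₀ ℕ} {α : Cell S} {v : α.1}
    (h : UsesEdge M ⟨α, v⟩) : ∃ w, w ≠ v ∧ UsesPair M α w v := by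
  obtain ⟨⟨γ, q⟩, h1, h2 | h2⟩ := h
  · obtain ⟨rfl, h3⟩ := Sigma.mk.inj_iff.1 h2
    have h4 := eq_of_heq h3
    exact ⟨q.1.2, h4 ▸ q.2.ne', q, h1, Or.inr ⟨h4, rfl⟩⟩
  · obtain ⟨rfl, h3⟩ := Sigma.mk.inj_iff.1 h2
    have h4 := eq_of_heq h3
    exact ⟨q.1.1, h4 ▸ q.2.ne, q, h1, Or.inl ⟨rfl, h4⟩⟩

theorem UsesPair.usesEdge {M : ForestPair S →₀ ℕ} {α : Cell S} {v w : α.1}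
    (h : UsesPair M α v w) : UsesEdge M ⟨α, v⟩ := by
  obtain ⟨q, h1, h2 | h2⟩ := h
  · exact ⟨⟨α, q⟩, h1, Or.inl (by rw [h2.1])⟩
  · exact ⟨⟨α, q⟩, h1, Or.inr (by rw [h2.2])⟩

/-- The gluing torus acts on the monomial only through its first factor. -/
def IsBalanced (M : ForestPair S →₀ ℕ) : Prop :=
  ∀ h : GluingTorus S, h.1 = 1 → monomialWeight (pairWeight S) M h = 1

/-- The one-parameter subgroup of a single diagonal, written as an exponent `1` on one copy, `-1` on
the other and `0` on every other edge. -/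
theorem Attached.exists_gluingEmbed_eq (hS : IsDissection S) {α β : Cell S} (hat : Attached α β)
    (u : ℂˣ) : ∃ h : GluingTorus S, h.1 = 1 ∧ ∀ ε : ForestEdge S, gluingEmbed S h ε =
      u ^ ((if ε = ⟨α, dir α β⟩ then 1 else 0) - (if ε = ⟨β, dir β α⟩ then 1 else 0) : ℤ) := by
  classical
  refine ⟨(1, Pi.mulSingle ⟨(lo β, hi β), hat.mem⟩ u), rfl, ?_⟩
  have hne : (⟨α, dir α β⟩ : ForestEdge S) ≠ ⟨β, dir β α⟩ := fun h => hat.ne (congrArg Sigma.fst h)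
  rintro ⟨γ, v⟩
  rcases edge_trichotomy hS γ v with hv | ⟨δ, hδ, hv⟩ | ⟨rfl, δ, hδ⟩
  · rw [gluingEmbed_outer _ hv, if_neg, if_neg]
    · simp
    · rintro ⟨⟩
      exact hv.dir_ne hS hat.ne.symm rfl
    · rintro ⟨⟩
      exact hv.dir_ne hS hat.ne rfl
  · obtain rfl : v = dir γ δ := by
      rw [LiesBelow.dir_eq hδ]
      exact Subtype.ext hv
    rw [hδ.gluingEmbed_upper]
    have h2 : (⟨γ, dir γ δ⟩ : ForestEdge S) ≠ ⟨β, dir β α⟩ := by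
      intro h
      rw [Sigma.mk.injEq] at h
      obtain ⟨rfl, h⟩ := h
      have h3 := eq_of_heq h
      rw [LiesBelow.dir_eq_topEdge hat, LiesBelow.dir_eq hδ] at h3
      have h4 := congrArg Subtype.val h3
      have h5 := lo_lt_hi δ
      have h6 := le_hi hδ.2.1
      have h7 : lo δ = hi γ := h4
      exact absurd (h7 ▸ h5) (not_lt.2 h6)
    rw [if_neg h2]
    by_cases hδβ : δ = β
    · subst hδβ
      obtain rfl := hδ.unique hS hat
      rw [if_pos rfl]
      simp
    · rw [if_neg]
      · have : (⟨(lo δ, hi δ), hδ.mem⟩ : S) ≠ ⟨(lo β, hi β), hat.mem⟩ := by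
          intro h
          have h := congrArg Subtype.val h
          rw [Prod.mk.injEq] at h
          exact hδβ (cell_ext hS h.1 h.2)
        simp [Pi.mulSingle_eq_of_ne this]
      · intro h
        rw [Sigma.mk.injEq] at h
        obtain ⟨rfl, h⟩ := h
        have h3 := congrArg Subtype.val (eq_of_heq h)
        have h4 := hδ.nextVertex_dir
        have h5 := hat.nextVertex_dir
        rw [eq_of_heq h, h5, Prod.mk.injEq] at h4
        exact hδβ (cell_ext hS h4.1.symm h4.2.symm)
  · rw [← LiesBelow.dir_eq_topEdge hδ, hδ.gluingEmbed_lower hS]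
    have h2 : (⟨γ, dir γ δ⟩ : ForestEdge S) ≠ ⟨α, dir α β⟩ := by
      intro h
      rw [Sigma.mk.injEq] at h
      obtain ⟨rfl, h⟩ := h
      have h3 := eq_of_heq h
      rw [LiesBelow.dir_eq_topEdge hδ, LiesBelow.dir_eq hat] at h3
      have h4 := congrArg Subtype.val h3
      have h5 := lo_lt_hi β
      have h6 := le_hi hat.2.1
      have h7 : hi γ = lo β := h4
      exact absurd (h7 ▸ h5) (not_lt.2 h6)
    rw [if_neg h2]
    by_cases hγβ : γ = β
    · subst hγβ
      obtain rfl := hδ.unique hS hat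
      rw [if_pos rfl]
      simp
    · rw [if_neg fun h => hγβ (congrArg Sigma.fst h)]
      have : (⟨(lo γ, hi γ), hδ.mem⟩ : S) ≠ ⟨(lo β, hi β), hat.mem⟩ := by
        intro h
        have h := congrArg Subtype.val h
        rw [Prod.mk.injEq] at h
        exact hγβ (cell_ext hS h.1 h.2)
      simp [Pi.mulSingle_eq_of_ne this]

theorem prod_zpow_eq_zpow_sum {ι G : Type*} [CommGroup G] (s : Finset ι) (f : ι → ℤ) (u : G) :
    ∏ i ∈ s, u ^ f i = u ^ ∑ i ∈ s, f i := by
  classical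
  induction s using Finset.induction_on with
  | empty => simp
  | insert a s ha ih => rw [Finset.prod_insert ha, Finset.sum_insert ha, zpow_add, ih]

theorem eq_zero_of_two_zpow_eq_one {k : ℤ} (h : (Units.mk0 (2 : ℂ) two_ne_zero) ^ k = 1) :
    k = 0 := by
  have h1 := congrArg (fun u : ℂˣ => ‖(u : ℂ)‖) h
  simp only [Units.val_zpow_eq_zpow_val, Units.val_mk0, norm_zpow, Complex.norm_ofNat,
    Units.val_one, norm_one] at h1
  exact zpow_right_injective₀ (a := (2 : ℝ)) (by norm_num) (by norm_num)
    (h1.trans (zpow_zero _).symm)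

/-- Testing invariance at the element `2`, which has infinite order, shows that the monomial has
equal degrees in the two copies of the diagonal. -/
theorem IsBalanced.sum_eq_zero (hS : IsDissection S) {M : ForestPair S →₀ ℕ} (hM : IsBalanced M)
    {α β : Cell S} (hat : Attached α β) :
    ∑ q : ForestPair S,
      (((if (⟨q.1, q.2.1.1⟩ : ForestEdge S) = ⟨α, dir α β⟩ then 1 else 0) -
        (if (⟨q.1, q.2.1.1⟩ : ForestEdge S) = ⟨β, dir β α⟩ then 1 else 0)) +
      ((if (⟨q.1, q.2.1.2⟩ : ForestEdge S) = ⟨α, dir α β⟩ then 1 else 0) -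
        (if (⟨q.1, q.2.1.2⟩ : ForestEdge S) = ⟨β, dir β α⟩ then 1 else 0))) * (M q : ℤ) = 0 := by
  obtain ⟨h, h1, h2⟩ := hat.exists_gluingEmbed_eq hS (Units.mk0 2 two_ne_zero)
  have h3 := hM h h1
  simp only [monomialWeight, MonoidHom.coe_mk, OneHom.coe_mk, pairWeight, h2, ← zpow_add] at h3
  simp only [← zpow_natCast, ← zpow_mul] at h3
  rw [prod_zpow_eq_zpow_sum] at h3
  exact eq_zero_of_two_zpow_eq_one h3

theorem UsesEdge.of_sum {M : ForestPair S →₀ ℕ} {ε ε' : ForestEdge S}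
    (hM : ∑ q : ForestPair S,
      (((if (⟨q.1, q.2.1.1⟩ : ForestEdge S) = ε then 1 else 0) -
        (if (⟨q.1, q.2.1.1⟩ : ForestEdge S) = ε' then 1 else 0)) +
      ((if (⟨q.1, q.2.1.2⟩ : ForestEdge S) = ε then 1 else 0) -
        (if (⟨q.1, q.2.1.2⟩ : ForestEdge S) = ε' then 1 else 0))) * (M q : ℤ) = 0)
    (h : UsesEdge M ε) : UsesEdge M ε' := by
  by_contra hc
  have hz : ∀ q : ForestPair S, M q ≠ 0 → (⟨q.1, q.2.1.1⟩ : ForestEdge S) ≠ ε' ∧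
      (⟨q.1, q.2.1.2⟩ : ForestEdge S) ≠ ε' := fun q hq =>
    ⟨fun h => hc ⟨q, hq, Or.inl h⟩, fun h => hc ⟨q, hq, Or.inr h⟩⟩
  obtain ⟨q, hq, hε⟩ := h
  refine (Finset.sum_pos' (fun r _ => ?_) ⟨q, Finset.mem_univ _, ?_⟩).ne' hM
  · by_cases hr : M r = 0
    · simp [hr]
    · rw [if_neg (hz r hr).1, if_neg (hz r hr).2]
      refine mul_nonneg ?_ (Int.natCast_nonneg _)
      split_ifs <;> norm_num
  · rw [if_neg (hz q hq).1, if_neg (hz q hq).2]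
    refine mul_pos ?_ (Int.natCast_pos.2 (Nat.pos_of_ne_zero hq))
    rcases hε with h | h <;> rw [if_pos h] <;> split_ifs <;> norm_num

theorem IsBalanced.usesEdge (hS : IsDissection S) {M : ForestPair S →₀ ℕ} (hM : IsBalanced M)
    {α β : Cell S} (hat : Attached α β ∨ Attached β α) (h : UsesEdge M ⟨α, dir α β⟩) :
    UsesEdge M ⟨β, dir β α⟩ := by
  rcases hat with hat | hat
  · exact h.of_sum (hM.sum_eq_zero hS hat)
  · refine h.of_sum ?_
    rw [← neg_eq_zero, ← Finset.sum_neg_distrib]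
    refine (Finset.sum_congr rfl fun q _ => ?_).trans (hM.sum_eq_zero hS hat)
    ring

/-- If one copy of a diagonal occurs in the monomial, so does the other; the coordinate containing
it uses a further edge of the next cell. Continuing in this way ends at a leaf, with a coordinate of
the monomial in every cell passed. -/
theorem IsBalanced.exists_leaf (hS : IsDissection S) {M : ForestPair S →₀ ℕ} (hM : IsBalanced M)
    (α : Cell S) (v : α.1) : UsesEdge M ⟨α, v⟩ → ∃ i, part α i = v ∧
      ∀ β, β ≠ α → part β i ≠ dir β α → UsesPair M β (part β i) (dir β α) := by
  induction α, v using edge_induction hS with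
  | outer α v hv =>
    intro _
    refine ⟨v.1, part_self v, fun β hβ hne => absurd (part_eq_dir hS hβ.symm ?_) hne⟩
    rw [part_self]
    exact (hv.dir_ne hS hβ.symm).symm
  | step α β hnb hat ih =>
    intro h
    obtain ⟨f, hf, hp⟩ := (hM.usesEdge hS hat h).exists_usesPair
    obtain ⟨i, rfl, hi⟩ := ih f hf hp.usesEdge
    refine ⟨i, not_not.1 fun h => hf ((hnb.part_iff i).2 h), fun γ hγ hne => ?_⟩
    by_cases hγβ : γ = β
    · subst hγβ
      exact hp
    · rw [hnb.dir_eq γ hγ hγβ] at hne ⊢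
      exact hi γ hγβ hne

theorem gluedExp_le {M : ForestPair S →₀ ℕ} (q : Pairs (Fin n))
    (h : ∀ β : Cell S, part β q.1.1 ≠ part β q.1.2 →
      UsesPair M β (part β q.1.1) (part β q.1.2)) : gluedExp S q ≤ M := by
  rintro ⟨β, r⟩
  simp only [gluedExp, Finsupp.equivFunOnFinite_symm_apply_apply]
  split_ifs with hr
  · rw [onPath_iff, onPath_iff] at hr
    have hne : part β q.1.1 ≠ part β q.1.2 := fun h => by simp [h] at hr
    obtain ⟨r', h1, h2⟩ := h β hne
    have h3 := r.2
    have h4 := r'.2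
    have : r = r' := by
      refine Subtype.ext (Prod.ext ?_ ?_) <;> grind
    rw [this]
    exact Nat.one_le_iff_ne_zero.2 h1
  · exact Nat.zero_le _

/-- Any coordinate of the monomial extends at both of its edges to a leaf. The resulting path uses
each cell at most once, so its monomial is squarefree and divides `M`. -/
theorem IsBalanced.exists_gluedExp_le (hS : IsDissection S) {M : ForestPair S →₀ ℕ}
    (hM : IsBalanced M) (h0 : M ≠ 0) : ∃ q, gluedExp S q ≤ M := by
  obtain ⟨⟨α, q⟩, hq⟩ := Finsupp.ne_iff.1 h0
  obtain ⟨i, hi, hi'⟩ := hM.exists_leaf hS α q.1.1 ⟨⟨α, q⟩, hq, Or.inl rfl⟩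
  obtain ⟨j, hj, hj'⟩ := hM.exists_leaf hS α q.1.2 ⟨⟨α, q⟩, hq, Or.inr rfl⟩
  have hij : part α i ≠ part α j := by
    rw [hi, hj]
    exact q.2.ne
  have key : ∀ β : Cell S, part β i ≠ part β j → UsesPair M β (part β i) (part β j) := by
    intro β hβ
    by_cases hβα : β = α
    · subst hβα
      rw [hi, hj]
      exact ⟨q, hq, Or.inl ⟨rfl, rfl⟩⟩
    · by_cases hid : part α i = dir α β
      · have h1 := part_eq_dir hS (Ne.symm hβα) (i := j) fun h => hij (hid.trans h.symm)
        rw [h1] at hβ ⊢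
        exact hi' β hβα hβ
      · have h1 := part_eq_dir hS (Ne.symm hβα) hid
        rw [h1] at hβ ⊢
        exact (hj' β hβα hβ.symm).symm
  rcases lt_trichotomy i j with h | rfl | h
  · exact ⟨⟨(i, j), h⟩, gluedExp_le _ key⟩
  · exact absurd rfl hij
  · exact ⟨⟨(j, i), h⟩, gluedExp_le _ fun β hβ => (key β hβ.symm).symm⟩

theorem monomialWeight_add {κ H : Type} [Fintype κ] [Group H] (c : H →* (κ → ℂˣ))
    (M N : κ →₀ ℕ) : monomialWeight c (M + N) = monomialWeight c M * monomialWeight c N := by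
  ext h
  simp [monomialWeight, pow_add, Finset.prod_mul_distrib]

/-- The invariants are generated by the glued coordinates. -/
theorem IsBalanced.exists_eq_bind₁ (hS : IsDissection S) (hn : 3 ≤ n) {M : ForestPair S →₀ ℕ}
    (hM : IsBalanced M) : ∃ (N : ℕ) (G : MvPolynomial (Pairs (Fin n)) ℂ), G.IsHomogeneous N ∧
      monomialWeight (pairWeight S) M = MonoidHom.fst ℂˣ (S → ℂˣ) ^ (2 * N) ∧
      MvPolynomial.monomial M 1 =
        MvPolynomial.bind₁ (fun q => MvPolynomial.monomial (gluedExp S q) (1 : ℂ)) G := by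
  induction hd : M.degree using Nat.strong_induction_on generalizing M with
  | _ d ih =>
    by_cases h0 : M = 0
    · subst h0
      refine ⟨0, 1, MvPolynomial.isHomogeneous_one _ _, ?_, by simp⟩
      ext h
      simp [monomialWeight]
    · obtain ⟨q, hq⟩ := hM.exists_gluedExp_le hS h0
      obtain ⟨M', rfl⟩ := exists_add_of_le hq
      have hw := monomialWeight_add (pairWeight S) (gluedExp S q) M'
      rw [monomialWeight_gluedExp hS hn] at hw
      have hM' : IsBalanced M' := fun h h1 => by
        have h2 := hM h h1
        rw [hw] at h2
        simpa [h1] using h2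
      -- The path monomial is not constant, because the first torus factor acts on it with the
      -- non-trivial weight `2`.
      have hlt : M'.degree < d := by
        rw [← hd, map_add]
        refine Nat.lt_add_of_pos_left (Nat.pos_of_ne_zero fun h => ?_)
        rw [Finsupp.degree_eq_zero_iff] at h
        have h2 := DFunLike.congr_fun (monomialWeight_gluedExp hS hn q)
          (Units.mk0 2 two_ne_zero, 1)
        rw [h] at h2
        have h3 := congrArg Units.val h2
        simp [monomialWeight] at h3
        norm_num at h3
      obtain ⟨N, G, hG, h1, h2⟩ := ih _ hlt hM' rfl
      refine ⟨1 + N, MvPolynomial.X q * G, (MvPolynomial.isHomogeneous_X _ _).mul hG, ?_, ?_⟩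
      · rw [hw, h1, ← pow_add]
        congr 1
        ring
      · rw [map_mul, MvPolynomial.bind₁_X_right, ← h2, MvPolynomial.monomial_mul, one_mul]

/-! ## The central fibre as a quotient -/

/-- The value `p_{xx} = 1` does not scale, so the equations are homogeneous only because all the
indices paired in them are distinct. -/
theorem IsInitial.of_smul {p : Pairs (Fin n) → ℂ} (h : IsInitial S (symCoord p)) (c : ℂ) :
    IsInitial S (symCoord (c • p)) := by
  have hs : ∀ i j, i ≠ j → symCoord (c • p) i j = c * symCoord p i j := by
    intro i j hij
    rcases lt_or_gt_of_ne hij with h | h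
    · rw [symCoord_of_lt _ h, symCoord_of_lt _ h]
      rfl
    · rw [symCoord_comm, symCoord_of_lt _ h, symCoord_comm, symCoord_of_lt _ h]
      rfl
  have hne : ∀ {e : Fin n × Fin n} {i k : Fin n}, (e.1 ≤ i ∧ i < e.2) → ¬ (e.1 ≤ k ∧ k < e.2) →
      i ≠ k := by
    rintro e i k hi hk rfl
    exact hk hi
  refine ⟨fun e he i j k l hi hj hk hl => ?_, fun i j k l hij hjk hkl h1 h2 => ?_⟩
  · rw [hs _ _ (hne hi hk), hs _ _ (hne hj hl), hs _ _ (hne hi hl), hs _ _ (hne hj hk)]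
    linear_combination c ^ 2 * h.rank_one e he i j k l hi hj hk hl
  · have h3 := h.plucker i j k l hij hjk hkl h1 h2
    unfold PluckerRel at h3 ⊢
    rw [hs _ _ hij.ne, hs _ _ hkl.ne, hs _ _ (hij.trans hjk).ne, hs _ _ (hjk.trans hkl).ne,
      hs _ _ ((hij.trans hjk).trans hkl).ne, hs _ _ hjk.ne]
    linear_combination c ^ 2 * h3

theorem mk_gluedPlucker_mem {Γ : Finset (Fin n × Fin n)} (hΓ : S ⊆ Γ) (hS : IsDissection S)
    {y : ForestPair S → ℂ} (hy : y ∈ coneProduct S) (h0 : gluedPlucker S y ≠ 0) :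
    Projectivization.mk ℂ (gluedPlucker S y) h0 ∈ centralFiber Γ S := by
  rw [mem_centralFiber_iff hΓ hS]
  obtain ⟨c, -, hc⟩ := exists_rep_mk_eq_smul _ h0
  rw [hc]
  exact (isInitial_gluedPlucker hS hy).of_smul c

theorem exists_mk_gluedPlucker_eq {Γ : Finset (Fin n × Fin n)} (hΓ : S ⊆ Γ) (hS : IsDissection S)
    (hn : 3 ≤ n) {x : ℙ ℂ (Pairs (Fin n) → ℂ)} (hx : x ∈ centralFiber Γ S) :
    ∃ y ∈ coneProduct S, gluedPlucker S y = x.rep :=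
  exists_gluedPlucker_eq hS hn ((mem_centralFiber_iff hΓ hS x).1 hx)

/-- The Plücker relation as a polynomial in the coordinates of the forest. -/
noncomputable def pluckerPoly (α : Cell S) {i j k l : α.1} (hij : i < j) (hjk : j < k)
    (hkl : k < l) : MvPolynomial (ForestPair S) ℂ :=
  .X ⟨α, ⟨(i, j), hij⟩⟩ * .X ⟨α, ⟨(k, l), hkl⟩⟩
    - .X ⟨α, ⟨(i, k), hij.trans hjk⟩⟩ * .X ⟨α, ⟨(j, l), hjk.trans hkl⟩⟩
    + .X ⟨α, ⟨(i, l), (hij.trans hjk).trans hkl⟩⟩ * .X ⟨α, ⟨(j, k), hjk⟩⟩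

/-- The glued coordinates as quotient data. -/
noncomputable def gluingData {Γ : Finset (Fin n × Fin n)} (hΓ : S ⊆ Γ) (hS : IsDissection S)
    (hn : 3 ≤ n) : QuotientData (ForestPair S) (Pairs (Fin n)) (GluingTorus S) where
  c := pairWeight S
  act := gluingAct S
  act_eq h y := by
    funext q
    simp [gluingAct, forestAct, pairWeight]
  χ := MonoidHom.fst ℂˣ (S → ℂˣ)
  Y := coneProduct S
  mem_of_forall y h α i j k l hij hjk hkl := by
    have h1 := h (pluckerPoly α hij hjk hkl) fun z hz => by
      simpa [pluckerPoly] using hz α i j k l hij hjk hkl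
    simpa [pluckerPoly] using h1
  act_mem h y hy := forestAct_mem_coneProduct _ hy
  P q := MvPolynomial.monomial (gluedExp S q) 1
  d := 2
  d_pos := two_pos
  eval_act h y q := by
    rw [eval_gluedExp, eval_gluedExp]
    exact gluedPlucker_gluingAct hS hn h y q
  generate M m hM := by
    have hb : IsBalanced M := fun h h1 => by
      rw [hM]
      simp [h1]
    obtain ⟨N, G, hG, h1, h2⟩ := hb.exists_eq_bind₁ hS hn
    refine ⟨N, G, hG, ?_, h2⟩
    -- Two equal powers of the linearizing character have equal exponents, as seen at the element
    -- `2`.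
    have h3 := DFunLike.congr_fun (hM.symm.trans h1) (Units.mk0 2 two_ne_zero, 1)
    simp only [MonoidHom.pow_apply, MonoidHom.coe_fst] at h3
    have h4 := congrArg Units.val h3
    simp only [Units.val_pow_eq_pow_val, Units.val_mk0] at h4
    exact Nat.pow_right_injective le_rfl (by exact_mod_cast h4)
  X := centralFiber Γ S
  mk_mem y hy h0 := by
    have h1 : (fun q => MvPolynomial.eval y (MvPolynomial.monomial (gluedExp S q) 1)) =
      gluedPlucker S y := funext fun q => eval_gluedExp y q
    simp only [h1]
    exact mk_gluedPlucker_mem hΓ hS hy _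
  exists_mk_eq x hx := by
    have h1 : ∀ y, (fun q => MvPolynomial.eval y (MvPolynomial.monomial (gluedExp S q) 1)) =
      gluedPlucker S y := fun y => funext fun q => eval_gluedExp y q
    obtain ⟨y, hy, h⟩ := exists_mk_gluedPlucker_eq hΓ hS hn hx
    simp only [h1]
    refine ⟨y, hy, h ▸ x.rep_nonzero, ?_⟩
    simp only [h, Projectivization.mk_rep]

theorem exists_gitQuotient_iso {Γ : Finset (Fin n × Fin n)} (hΓ : S ⊆ Γ) (hS : IsDissection S)
    (hn : 3 ≤ n) :
    ∃ Φ : Iso (gitQuotient (gluingAct S) (MonoidHom.fst ℂˣ (S → ℂˣ)) (coneProduct S))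
        ((projective (Pairs (Fin n))).restrict (centralFiber Γ S)),
      ∀ y : semistable (gluingAct S) (MonoidHom.fst ℂˣ (S → ℂˣ)) (coneProduct S),
        ∃ hy : gluedPlucker S y.1 ≠ 0,
          (Φ.toEquiv (Quot.mk _ y)).1 = Projectivization.mk ℂ (gluedPlucker S y.1) hy := by
  have h1 : ∀ y, (gluingData hΓ hS hn).val y = gluedPlucker S y :=
    fun y => funext fun q => eval_gluedExp y q
  refine ⟨(gluingData hΓ hS hn).iso, fun y => ?_⟩
  have h2 := (((gluingData hΓ hS hn).mem_semistable_iff y.1).1 y.2).2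
  have h4 : gluedPlucker S y.1 ≠ 0 := by rwa [h1] at h2
  have h5 : Projectivization.mk ℂ ((gluingData hΓ hS hn).val y.1) h2 =
      Projectivization.mk ℂ (gluedPlucker S y.1) h4 := by simp only [h1]
  refine ⟨h4, ?_⟩
  have h3 : ((gluingData hΓ hS hn).iso.toEquiv (Quot.mk _ y)).1 =
    Projectivization.mk ℂ ((gluingData hΓ hS hn).val y.1) h2 := rfl
  exact h3.trans h5

/-! ## The open part of the central fibre -/

theorem symCoord_ne_zero_of_near {y : ForestPair S → ℂ} (hy : y ∈ openConeProduct S)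
    {α : Cell S} {v w : α.1} (h : Near v w) : symCoord (cellCoord y α) v w ≠ 0 := by
  rcases h with rfl | ⟨h, hc⟩ | ⟨h, hc⟩
  · rw [symCoord_self]
    exact one_ne_zero
  · rw [symCoord_of_lt _ h]
    exact hy.2 α ⟨(v, w), h⟩ hc
  · rw [symCoord_comm, symCoord_of_lt _ h]
    exact hy.2 α ⟨(w, v), h⟩ hc

theorem reach_ne_zero (hS : IsDissection S) {y : ForestPair S → ℂ} (hy : y ∈ openConeProduct S)
    {α : Cell S} (v : α.1) : reach y α v.1 ≠ 0 :=
  Finset.prod_ne_zero_iff.2 fun _ hβ =>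
    symCoord_ne_zero_of_near hy (near_part_dir hS (Finset.ne_of_mem_erase hβ) v)

/-- Consecutive leaves enter each cell through equal or adjacent edges, so their coordinate is a
product of adjacent ones. Conversely, every adjacent coordinate of a cell is a factor for some pair
of consecutive leaves. -/
theorem mem_openConeProduct_iff {y : ForestPair S → ℂ} :
    y ∈ openConeProduct S ↔ y ∈ coneProduct S ∧
      ∀ q : Pairs (Fin n), CyclicallyAdjacent q.1.1 q.1.2 → gluedPlucker S y q ≠ 0 := by
  refine ⟨fun hy => ⟨hy.1, fun q hq => ?_⟩, fun hy => ⟨hy.1, fun α q hq => ?_⟩⟩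
  · rw [← symCoord_pair (gluedPlucker S y), symCoord_gluedPlucker]
    exact Finset.prod_ne_zero_iff.2 fun α _ =>
      symCoord_ne_zero_of_near hy (near_part_part α q.2 hq)
  · obtain ⟨i, j, hij, hadj, h⟩ := exists_leaves_of_adjacent q.2 hq
    have h1 := hy.2 ⟨(i, j), hij⟩ hadj
    rw [← symCoord_pair (gluedPlucker S y), symCoord_gluedPlucker] at h1
    have h2 := Finset.prod_ne_zero_iff.1 h1 α (Finset.mem_univ α)
    rcases h with ⟨h3, h4⟩ | ⟨h3, h4⟩
    · rwa [h3, h4, symCoord_pair] at h2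
    · rwa [h3, h4, symCoord_comm, symCoord_pair] at h2

/-- The first vertex of a cell, as a label. -/
def lowVertex (α : Cell S) : α.1 := ⟨lo α, lo_mem α⟩

/-- The first and the last vertex of a cell. -/
def topPair (α : Cell S) : Pairs (α.1 : Finset (Fin n)) := ⟨(lowVertex α, topEdge α), lo_lt_hi α⟩

theorem part_lo (α : Cell S) : part α (lo α) = lowVertex α := part_self (lowVertex α)

theorem symCoord_topPair (y : ForestPair S → ℂ) (α : Cell S) :
    symCoord (cellCoord y α) (lowVertex α) (topEdge α) = y ⟨α, topPair α⟩ :=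
  symCoord_of_lt _ (topPair α).2

theorem cyclicallyAdjacent_topPair (α : Cell S) :
    CyclicallyAdjacent (topPair α).1.1 (topPair α).1.2 :=
  Or.inr fun k => ⟨lo_le k.2, le_hi k.2⟩

theorem ne_topEdge (α : Cell S) (q : Pairs (α.1 : Finset (Fin n))) : q.1.1 ≠ topEdge α := by
  intro h
  have h1 := le_hi q.1.2.2
  have h2 : q.1.1.1 < q.1.2.1 := q.2
  rw [h] at h2
  exact absurd h2 (not_lt.2 h1)

/-- The vertices of a cell, read as leaves, represent its edges. So each coordinate of a cell can be
recovered from one glued coordinate up to `reach` factors, which is what makes the section explicit.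
-/
theorem gluedPlucker_pair (hS : IsDissection S) (y : ForestPair S → ℂ) (α : Cell S)
    (q : Pairs (α.1 : Finset (Fin n))) :
    gluedPlucker S y ⟨(q.1.1.1, q.1.2.1), q.2⟩ =
      y ⟨α, q⟩ * reach y α q.1.1.1 * reach y α q.1.2.1 := by
  rw [← symCoord_pair (gluedPlucker S y), gluedPlucker_eq_reach hS y (α := α), part_self,
    part_self, symCoord_pair]
  · rfl
  · rw [part_self, part_self]
    exact q.2.ne

theorem isOuter_topEdge_of_root (hS : IsDissection S) {α : Cell S}
    (h : ∀ k, lo α ≤ k ∧ k ≤ hi α) : IsOuter α (topEdge α) := by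
  rw [IsOuter, nextVertex_topEdge]
  exact ⟨fun h' => (hS.lt h').not_gt (lo_lt_hi α),
    fun h' => (hS.isDiagonal _ h').2 (Or.inr h)⟩

theorem gluedPlucker_root (hS : IsDissection S) (y : ForestPair S → ℂ) {α : Cell S}
    {r : Pairs (Fin n)} (h1 : lo α = r.1.1) (h2 : hi α = r.1.2)
    (hr : ∀ k, r.1.1 ≤ k ∧ k ≤ r.1.2) :
    gluedPlucker S y r = y ⟨α, topPair α⟩ * reach y α (lo α) := by
  have h3 := gluedPlucker_pair hS y α (topPair α)
  have h4 : (⟨((topPair α).1.1.1, (topPair α).1.2.1), (topPair α).2⟩ : Pairs (Fin n)) = r :=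
    Subtype.ext (Prod.ext h1 h2)
  have h5 : reach y α (topPair α).1.2.1 = 1 :=
    reach_eq_one hS y (isOuter_topEdge_of_root hS (by rwa [h1, h2])) (part_self _)
  rw [h4, h5, mul_one] at h3
  exact h3

/-- The index of the denominator in a coordinate of the section. -/
def sectionDenom (r : Pairs (Fin n)) (q : ForestPair S) : Pairs (Fin n) :=
  if q.2.1.2 = topEdge q.1 then ⟨(lo q.1, hi q.1), lo_lt_hi q.1⟩ else r

/-- A section of the gluing map over the open part. -/
noncomputable def sectionCoord (r : Pairs (Fin n)) (p : Pairs (Fin n) → ℂ) : ForestPair S → ℂ :=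
  fun q => p ⟨(q.2.1.1.1, q.2.1.2.1), q.2.2⟩ / p (sectionDenom r q)

theorem sectionCoord_smul (r : Pairs (Fin n)) {c : ℂ} (hc : c ≠ 0) (p : Pairs (Fin n) → ℂ) :
    sectionCoord (S := S) r (c • p) = sectionCoord r p :=
  funext fun _ => mul_div_mul_left _ _ hc

theorem gluedPlucker_sectionDenom_ne_zero (hS : IsDissection S) {y : ForestPair S → ℂ}
    (hy : y ∈ openConeProduct S) {r : Pairs (Fin n)} (hr : ∀ k, r.1.1 ≤ k ∧ k ≤ r.1.2)
    (q : ForestPair S) : gluedPlucker S y (sectionDenom r q) ≠ 0 := by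
  unfold sectionDenom
  split_ifs with h
  · have h1 := gluedPlucker_pair hS y q.1 (topPair q.1)
    refine ne_of_eq_of_ne h1 (mul_ne_zero (mul_ne_zero ?_ ?_) ?_)
    · exact hy.2 _ _ (cyclicallyAdjacent_topPair _)
    · exact reach_ne_zero hS hy _
    · exact reach_ne_zero hS hy _
  · exact (mem_openConeProduct_iff.1 hy).2 r (Or.inr hr)

/-- Over the open part the orbits of the gluing torus are the fibres of the gluing map. -/
theorem exists_gluingAct_eq_sectionCoord (hS : IsDissection S) {y : ForestPair S → ℂ}
    (hy : y ∈ openConeProduct S) {r : Pairs (Fin n)} (hr : ∀ k, r.1.1 ≤ k ∧ k ≤ r.1.2) :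
    ∃ h, gluingAct S h y = sectionCoord r (gluedPlucker S y) := by
  have hp0 : gluedPlucker S y r ≠ 0 := (mem_openConeProduct_iff.1 hy).2 r (Or.inr hr)
  -- The torus scales `p` by the square of its first component, so normalizing `p_r` to `1` needs a
  -- square root. Only `σ ^ 2` appears in the end, hence the section is rational.
  obtain ⟨σ, hσ⟩ := IsAlgClosed.exists_pow_nat_eq (gluedPlucker S y r)⁻¹ two_pos
  have hσ0 : σ ≠ 0 := by
    rintro rfl
    rw [zero_pow two_ne_zero] at hσ
    exact inv_ne_zero hp0 hσ.symm
  have htop : ∀ α : Cell S, y ⟨α, topPair α⟩ ≠ 0 := fun α =>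
    hy.2 _ _ (cyclicallyAdjacent_topPair _)
  have hlow : ∀ α : Cell S, reach y α (lo α) ≠ 0 := fun α => reach_ne_zero hS hy (lowVertex α)
  choose β hβ using fun e : S => exists_cell hS (Or.inl e.2) (hS.exists_between e.2)
  -- With this choice every lower edge is scaled by `σ` times its `reach`, and the top edge of `α`
  -- by the inverse of `u α`. These agree with the gluing since the path from a parent to the first
  -- leaf below `α` starts with the top pair of `α`.
  let u : Cell S → ℂˣ := fun α => Units.mk0 (σ * (y ⟨α, topPair α⟩ * reach y α (lo α)))
    (mul_ne_zero hσ0 (mul_ne_zero (htop α) (hlow α)))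
  have hu : ∀ α : Cell S, (u α : ℂ) = σ * (y ⟨α, topPair α⟩ * reach y α (lo α)) := fun _ => rfl
  let h : GluingTorus S := (Units.mk0 σ hσ0, fun e => u (β e))
  have hβ' : ∀ (α : Cell S) (hα : (lo α, hi α) ∈ S), h.2 ⟨_, hα⟩ = u α := fun α hα =>
    congrArg u (cell_ext hS (hβ ⟨_, hα⟩).1 (hβ ⟨_, hα⟩).2)
  have hlower : ∀ (α : Cell S) (v : α.1), v ≠ topEdge α →
      (gluingEmbed S h ⟨α, v⟩ : ℂ) = σ * reach y α v.1 := by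
    intro α v hv
    rcases edge_trichotomy hS α v with ho | ⟨δ, hδ, hvδ⟩ | ⟨hv', _⟩
    · rw [gluingEmbed_outer h ho, reach_eq_one hS y ho (part_self v), mul_one]
      rfl
    · obtain rfl : v = dir α δ := by
        rw [LiesBelow.dir_eq hδ]
        exact Subtype.ext hvδ
      rw [hδ.gluingEmbed_upper, hβ', hu, reach_eq_of_isNeighbor y (hδ.isNeighbor hS) (part_self _),
        hvδ, LiesBelow.dir_eq_topEdge hδ, part_lo, symCoord_topPair]
    · exact absurd hv' hv
  have hupper : ∀ α : Cell S, (gluingEmbed S h ⟨α, topEdge α⟩ : ℂ) *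
      (σ * (y ⟨α, topPair α⟩ * reach y α (lo α))) = 1 := by
    intro α
    rcases edge_trichotomy hS α (topEdge α) with ho | ⟨δ, hδ, hvδ⟩ | ⟨_, δ, hδ⟩
    · rcases isLid_cell α with hl | hl
      · exact absurd (by rw [nextVertex_topEdge]; exact hl) ho.2
      · have h1 : lo α = r.1.1 := le_antisymm (hl.2 _).1 (hr _).1
        have h2 : hi α = r.1.2 := le_antisymm (hr _).2 (hl.2 _).2
        rw [gluingEmbed_outer h ho, ← gluedPlucker_root hS y h1 h2 hr]
        change σ * (σ * _) = 1
        rw [← mul_assoc, ← sq, hσ, inv_mul_cancel₀ hp0]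
    · have h1 := lo_lt_hi δ
      have h2 := le_hi hδ.2.1
      have h3 : hi α = lo δ := hvδ
      exact absurd (h3 ▸ h1) (not_lt.2 h2)
    · rw [← LiesBelow.dir_eq_topEdge hδ, hδ.gluingEmbed_lower hS, hβ', ← hu, ← Units.val_mul,
        inv_mul_cancel, Units.val_one]
  refine ⟨h, funext fun ⟨α, q⟩ => ?_⟩
  rw [sectionCoord, eq_div_iff (gluedPlucker_sectionDenom_ne_zero hS hy hr _),
    gluedPlucker_pair hS y α q]
  change (gluingEmbed S h ⟨α, q.1.1⟩ : ℂ) * (gluingEmbed S h ⟨α, q.1.2⟩ : ℂ) * y ⟨α, q⟩ * _ = _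
  rw [hlower α _ (ne_topEdge α q)]
  unfold sectionDenom
  split_ifs with hq
  · have h1 := gluedPlucker_pair hS y α (topPair α)
    have h2 := hupper α
    have hq' : q.1.2 = topEdge α := hq
    rw [hq']
    refine (congrArg _ h1).trans ?_
    change _ = y ⟨α, q⟩ * reach y α q.1.1.1 * reach y α (hi α)
    change σ * _ * _ * _ * (_ * reach y α (lo α) * reach y α (hi α)) = _
    linear_combination (reach y α q.1.1.1 * y ⟨α, q⟩ * reach y α (hi α)) * h2
  · rw [hlower α _ hq]
    have h1 : σ ^ 2 * gluedPlucker S y r = 1 := by rw [hσ, inv_mul_cancel₀ hp0]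
    linear_combination (reach y α q.1.1.1 * reach y α q.1.2.1 * y ⟨α, q⟩) * h1

theorem sectionCoord_mem (hS : IsDissection S) {y : ForestPair S → ℂ}
    (hy : y ∈ openConeProduct S) {r : Pairs (Fin n)} (hr : ∀ k, r.1.1 ≤ k ∧ k ≤ r.1.2) :
    sectionCoord r (gluedPlucker S y) ∈ openConeProduct S := by
  obtain ⟨h, hh⟩ := exists_gluingAct_eq_sectionCoord hS hy hr
  rw [← hh]
  refine ⟨forestAct_mem_coneProduct _ hy.1, fun α q hq => ?_⟩
  exact mul_ne_zero (mul_ne_zero (Units.ne_zero _) (Units.ne_zero _)) (hy.2 α q hq)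

/-- The points of the open part with first-and-last coordinates normalized to `1`. -/
def normalizedCone (S : Finset (Fin n × Fin n)) : Set (ForestPair S → ℂ) :=
  {y | y ∈ openConeProduct S ∧ ∀ α, y ⟨α, topPair α⟩ = 1}

theorem sectionCoord_mem_normalizedCone (hS : IsDissection S) {y : ForestPair S → ℂ}
    (hy : y ∈ openConeProduct S) {r : Pairs (Fin n)} (hr : ∀ k, r.1.1 ≤ k ∧ k ≤ r.1.2) :
    sectionCoord r (gluedPlucker S y) ∈ normalizedCone S := by
  refine ⟨sectionCoord_mem hS hy hr, fun α => ?_⟩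
  have h1 := gluedPlucker_sectionDenom_ne_zero hS hy hr ⟨α, topPair α⟩
  rw [sectionCoord, div_eq_one_iff_eq h1]
  have h2 : sectionDenom r ⟨α, topPair α⟩ = ⟨(lo α, hi α), lo_lt_hi α⟩ := if_pos rfl
  rw [h2]
  rfl

/-- The path down from a lower edge to the leaf of its first vertex enters each cell by the top edge
and leaves it by the first one. It meets only coordinates normalized to `1`. -/
theorem reach_eq_one_of_normalized (hS : IsDissection S) {y : ForestPair S → ℂ}
    (hy : y ∈ normalizedCone S) (α : Cell S) (v : α.1) :
    v ≠ topEdge α → reach y α v.1 = 1 := by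
  induction α, v using edge_induction hS with
  | outer α v hv => exact fun _ => reach_eq_one hS y hv (part_self v)
  | step α β hnb hat ih =>
    intro hne
    rcases hat with hat | hat
    · have h1 : (dir α β).1 = lo β := by rw [LiesBelow.dir_eq hat]
      have h2 : lowVertex β ≠ topEdge β := ne_topEdge β (topPair β)
      have h3 : dir β α = topEdge β := LiesBelow.dir_eq_topEdge hat
      have h4 : reach y β (lo β) = 1 := ih (lowVertex β) (by rwa [h3]) h2
      rw [reach_eq_of_isNeighbor y hnb (part_self _), h1, h3, part_lo, symCoord_topPair, hy.2 β,
        h4, one_mul]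
    · exact absurd (LiesBelow.dir_eq_topEdge hat) hne

theorem sectionCoord_gluedPlucker_of_normalized (hS : IsDissection S) {y : ForestPair S → ℂ}
    (hy : y ∈ normalizedCone S) {r : Pairs (Fin n)} (hr : ∀ k, r.1.1 ≤ k ∧ k ≤ r.1.2) :
    sectionCoord r (gluedPlucker S y) = y := by
  funext ⟨α, q⟩
  have hlow : ∀ α : Cell S, reach y α (lo α) = 1 := fun α =>
    reach_eq_one_of_normalized hS hy α (lowVertex α) (ne_topEdge α (topPair α))
  rw [sectionCoord, div_eq_iff (gluedPlucker_sectionDenom_ne_zero hS hy.1 hr _),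
    gluedPlucker_pair hS y α q, reach_eq_one_of_normalized hS hy α _ (ne_topEdge α q), mul_one]
  unfold sectionDenom
  split_ifs with hq
  · have h1 := gluedPlucker_pair hS y α (topPair α)
    have hq' : q.1.2 = topEdge α := hq
    rw [hq']
    refine congrArg (y ⟨α, q⟩ * ·) (Eq.trans ?_ h1.symm)
    change _ = _ * reach y α (lo α) * reach y α (hi α)
    rw [hy.2 α, hlow, one_mul, one_mul]
    rfl
  · obtain ⟨m, _, hm1, hm2⟩ := exists_mid α
    obtain ⟨ρ, h1, h2⟩ := exists_cell hS (e := r.1) (Or.inr ⟨r.2, hr⟩)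
      ⟨m, (hr _).1.trans_lt hm1, hm2.trans_le (hr _).2⟩
    have hq' : q.1.2 ≠ topEdge α := hq
    rw [gluedPlucker_root hS y h1 h2 hr, hy.2 ρ, hlow,
      reach_eq_one_of_normalized hS hy α _ hq', mul_one, mul_one, mul_one]

/-! ## The open part as a geometric quotient -/

theorem mk_gluedPlucker_mem_open {Γ : Finset (Fin n × Fin n)} (hΓ : S ⊆ Γ) (hS : IsDissection S)
    {y : ForestPair S → ℂ} (hy : y ∈ openConeProduct S) (h0 : gluedPlucker S y ≠ 0) :
    Projectivization.mk ℂ (gluedPlucker S y) h0 ∈ centralFiber Γ S \ boundaryDivisor n := by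
  refine ⟨mk_gluedPlucker_mem hΓ hS hy.1 h0, ?_⟩
  rintro ⟨q, hq, hq0⟩
  obtain ⟨c, hc, h⟩ := exists_rep_mk_eq_smul _ h0
  rw [h] at hq0
  exact mul_ne_zero hc ((mem_openConeProduct_iff.1 hy).2 q hq) hq0

theorem exists_open_gluedPlucker_eq {Γ : Finset (Fin n × Fin n)} (hΓ : S ⊆ Γ)
    (hS : IsDissection S) (hn : 3 ≤ n) {x : ℙ ℂ (Pairs (Fin n) → ℂ)}
    (hx : x ∈ centralFiber Γ S \ boundaryDivisor n) :
    ∃ y ∈ openConeProduct S, gluedPlucker S y = x.rep := by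
  obtain ⟨y, hy, h⟩ := exists_mk_gluedPlucker_eq hΓ hS hn hx.1
  refine ⟨y, mem_openConeProduct_iff.2 ⟨hy, fun q hq h0 => hx.2 ⟨q, hq, ?_⟩⟩, h⟩
  rw [← h, h0]

theorem gluedPlucker_ne_zero {y : ForestPair S → ℂ} (hy : y ∈ openConeProduct S)
    {r : Pairs (Fin n)} (hr : ∀ k, r.1.1 ≤ k ∧ k ≤ r.1.2) : gluedPlucker S y ≠ 0 :=
  fun h => (mem_openConeProduct_iff.1 hy).2 r (Or.inr hr) (congrFun h r)

theorem mk_gluedPlucker_gluingAct (hS : IsDissection S) (hn : 3 ≤ n) {h : GluingTorus S}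
    {y z : ForestPair S → ℂ} (hz : gluingAct S h y = z) (hy0 : gluedPlucker S y ≠ 0)
    (hz0 : gluedPlucker S z ≠ 0) :
    Projectivization.mk ℂ (gluedPlucker S y) hy0 = Projectivization.mk ℂ (gluedPlucker S z) hz0 := by
  subst hz
  symm
  rw [Projectivization.mk_eq_mk_iff']
  exact ⟨(h.1 : ℂ) ^ 2, funext fun q => (gluedPlucker_gluingAct hS hn h y q).symm⟩

/-- The gluing map on the open part. -/
noncomputable def glueOpen {Γ : Finset (Fin n × Fin n)} (hΓ : S ⊆ Γ) (hS : IsDissection S)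
    {r : Pairs (Fin n)} (hr : ∀ k, r.1.1 ≤ k ∧ k ≤ r.1.2) (y : openConeProduct S) :
    (centralFiber Γ S \ boundaryDivisor n : Set (ℙ ℂ (Pairs (Fin n) → ℂ))) :=
  ⟨Projectivization.mk ℂ (gluedPlucker S y.1) (gluedPlucker_ne_zero y.2 hr),
    mk_gluedPlucker_mem_open hΓ hS y.2 _⟩

/-- The section of the gluing map on the open part. -/
noncomputable def sectionOpen {Γ : Finset (Fin n × Fin n)} (hΓ : S ⊆ Γ) (hS : IsDissection S)
    (hn : 3 ≤ n) {r : Pairs (Fin n)} (hr : ∀ k, r.1.1 ≤ k ∧ k ≤ r.1.2)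
    (x : (centralFiber Γ S \ boundaryDivisor n : Set (ℙ ℂ (Pairs (Fin n) → ℂ)))) :
    normalizedCone S :=
  ⟨sectionCoord r x.1.rep, by
    obtain ⟨y, hy, h⟩ := exists_open_gluedPlucker_eq hΓ hS hn x.2
    rw [← h]
    exact sectionCoord_mem_normalizedCone hS hy hr⟩

/-- The inclusion of the normalized points. -/
def normalizedIncl (y : normalizedCone S) : openConeProduct S := ⟨y.1, y.2.1⟩

section OpenPart

variable {Γ : Finset (Fin n × Fin n)} (hΓ : S ⊆ Γ) (hS : IsDissection S) (hn : 3 ≤ n)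
  {r : Pairs (Fin n)} (hr : ∀ k, r.1.1 ≤ k ∧ k ≤ r.1.2)

theorem glueOpen_sectionOpen
    (x : (centralFiber Γ S \ boundaryDivisor n : Set (ℙ ℂ (Pairs (Fin n) → ℂ)))) :
    glueOpen hΓ hS hr (normalizedIncl (sectionOpen hΓ hS hn hr x)) = x := by
  obtain ⟨y, hy, h⟩ := exists_open_gluedPlucker_eq hΓ hS hn x.2
  obtain ⟨k, hk⟩ := exists_gluingAct_eq_sectionCoord hS hy hr
  have h0 := gluedPlucker_ne_zero hy hr
  refine Subtype.ext ?_
  have h1 : Projectivization.mk ℂ (gluedPlucker S y) h0 = x.1 := by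
    simp only [h, Projectivization.mk_rep]
  rw [h] at hk
  refine Eq.trans ?_ h1
  exact (mk_gluedPlucker_gluingAct hS hn hk _ _).symm

theorem sectionCoord_rep_glueOpen (y : openConeProduct S) :
    sectionCoord r (glueOpen hΓ hS hr y).1.rep = sectionCoord (S := S) r (gluedPlucker S y.1) := by
  obtain ⟨c, hc, h⟩ := exists_rep_mk_eq_smul _ (gluedPlucker_ne_zero y.2 hr)
  exact (congrArg (sectionCoord r) h).trans (sectionCoord_smul r hc _)

theorem isMorphism_glueOpen :
    IsMorphism ((affine (ForestPair S)).restrict (openConeProduct S))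
      ((projective (Pairs (Fin n))).restrict (centralFiber Γ S \ boundaryDivisor n))
      (glueOpen hΓ hS hr) := by
  have h1 : ∀ y, (fun q => MvPolynomial.eval y (MvPolynomial.monomial (gluedExp S q) 1)) =
    gluedPlucker S y := fun y => funext fun q => eval_gluedExp y q
  refine isMorphism_affine_projective _ (fun q => MvPolynomial.monomial (gluedExp S q) 1)
    (fun y => ?_) fun y => ?_
  · rw [h1]
    exact gluedPlucker_ne_zero y.2 hr
  · simp only [h1]
    rfl

theorem isMorphism_sectionOpen :
    IsMorphism ((projective (Pairs (Fin n))).restrict (centralFiber Γ S \ boundaryDivisor n))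
      ((affine (ForestPair S)).restrict (normalizedCone S)) (sectionOpen hΓ hS hn hr) := by
  refine isMorphism_projective_affine _ fun q => ⟨1, .X ⟨(q.2.1.1.1, q.2.1.2.1), q.2.2⟩,
    .X (sectionDenom r q), MvPolynomial.isHomogeneous_X _ _, MvPolynomial.isHomogeneous_X _ _,
    fun x => ?_⟩
  rw [MvPolynomial.eval_X, MvPolynomial.eval_X]
  obtain ⟨y, hy, h⟩ := exists_open_gluedPlucker_eq hΓ hS hn x.2
  refine ⟨?_, rfl⟩
  rw [← h]
  exact gluedPlucker_sectionDenom_ne_zero hS hy hr q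

theorem isMorphism_normalizedIncl :
    IsMorphism ((affine (ForestPair S)).restrict (normalizedCone S))
      ((affine (ForestPair S)).restrict (openConeProduct S)) normalizedIncl :=
  isMorphism_affine_affine _ .X fun _ _ => (MvPolynomial.eval_X _).symm

/-- The open part of the central fibre as the variety of normalized points. -/
noncomputable def normalizedIso :
    Iso ((projective (Pairs (Fin n))).restrict (centralFiber Γ S \ boundaryDivisor n))
      ((affine (ForestPair S)).restrict (normalizedCone S)) :=
  Iso.ofMorphisms
    { toFun := sectionOpen hΓ hS hn hr
      invFun := fun y => glueOpen hΓ hS hr (normalizedIncl y)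
      left_inv := glueOpen_sectionOpen hΓ hS hn hr
      right_inv := fun y => Subtype.ext ((sectionCoord_rep_glueOpen hΓ hS hr _).trans
        (sectionCoord_gluedPlucker_of_normalized hS y.2 hr)) }
    (isMorphism_sectionOpen hΓ hS hn hr)
    ((isMorphism_glueOpen hΓ hS hr).comp isMorphism_normalizedIncl)

end OpenPart

/-- A quotient with a section. -/
def SpaceWithFunctions.quotIso {X Y : SpaceWithFunctions} {r : X.carrier → X.carrier → Prop}
    {φ : X.carrier → Y.carrier} {ψ : Y.carrier → X.carrier} (hφ : IsMorphism X Y φ)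
    (hψ : IsMorphism Y X ψ) (h1 : ∀ y, φ (ψ y) = y) (h2 : ∀ x x', r x x' → φ x = φ x')
    (h3 : ∀ x, r x (ψ (φ x))) : Iso (X.quot r) Y where
  toEquiv :=
    { toFun := Quot.lift φ h2
      invFun := fun y => Quot.mk r (ψ y)
      left_inv := fun x => by
        induction x using Quot.ind
        exact (Quot.sound (h3 _)).symm
      right_inv := h1 }
  isOpen_iff U := ⟨hφ.isOpen_preimage U, fun hU => by
    have h4 := hψ.isOpen_preimage _ hU
    have h5 : ψ ⁻¹' (φ ⁻¹' U) = U := by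
      ext y
      rw [Set.mem_preimage, Set.mem_preimage, h1]
    exact h5 ▸ h4⟩
  regular_iff U hU f := ⟨hφ.regular_comp U hU f, fun hf => by
    have h4 := hψ.regular_comp _ (hφ.isOpen_preimage U hU) _ hf
    have h5 : ψ ⁻¹' (φ ⁻¹' U) = U := by
      ext y
      rw [Set.mem_preimage, Set.mem_preimage, h1]
    have h6 : (f ∘ φ) ∘ ψ = f := funext fun y => congrArg f (h1 y)
    exact h6 ▸ h5 ▸ h4⟩

/-- The gluing map has a regular section, and every point lies in the orbit of the section value
over its image. So open sets and regular functions descend without any further invariant theory. -/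
theorem exists_geometricQuotient_iso {Γ : Finset (Fin n × Fin n)} (hΓ : S ⊆ Γ)
    (hS : IsDissection S) (hn : 3 ≤ n) {r : Pairs (Fin n)} (hr : ∀ k, r.1.1 ≤ k ∧ k ≤ r.1.2) :
    ∃ Φ : Iso (geometricQuotient (gluingAct S) (openConeProduct S))
        ((projective (Pairs (Fin n))).restrict (centralFiber Γ S \ boundaryDivisor n)),
      ∀ y : openConeProduct S, ∃ hy : gluedPlucker S y.1 ≠ 0,
        (Φ.toEquiv (Quot.mk _ y)).1 = Projectivization.mk ℂ (gluedPlucker S y.1) hy := by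
  refine ⟨quotIso (isMorphism_glueOpen hΓ hS hr)
    (isMorphism_normalizedIncl.comp (isMorphism_sectionOpen hΓ hS hn hr))
    (glueOpen_sectionOpen hΓ hS hn hr) ?_ ?_, fun y => ⟨gluedPlucker_ne_zero y.2 hr, rfl⟩⟩
  · rintro y z ⟨h, hh⟩
    exact Subtype.ext (mk_gluedPlucker_gluingAct hS hn hh _ _)
  · intro y
    obtain ⟨h, hh⟩ := exists_gluingAct_eq_sectionCoord hS y.2 hr
    exact ⟨h, hh.trans (sectionCoord_rep_glueOpen hΓ hS hr y).symm⟩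

/-! ## Normalized Grassmannians -/

/-- The points of the cone over `Gr°(2, ℂ^I)` with `p_{q₀} = 1`. -/
def normalizedGrass (I : Type) [LinearOrder I] (q₀ : Pairs I) : Set (Pairs I → ℂ) :=
  {p | p ∈ grassCone I ∧ (∀ q : Pairs I, CyclicallyAdjacent q.1.1 q.1.2 → p q ≠ 0) ∧ p q₀ = 1}

theorem smul_mem_grassCone {I : Type} [LinearOrder I] {p : Pairs I → ℂ} (hp : p ∈ grassCone I)
    (c : ℂ) : c • p ∈ grassCone I := fun i j k l hij hjk hkl => by
  simp only [Pi.smul_apply, smul_eq_mul]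
  linear_combination c ^ 2 * hp i j k l hij hjk hkl

/-- Two mutually inverse polynomial maps. -/
def affineIso {κ ι : Type} {s : Set (κ → ℂ)} {t : Set (ι → ℂ)} (e : s ≃ t)
    (P : ι → MvPolynomial κ ℂ) (Q : κ → MvPolynomial ι ℂ)
    (hP : ∀ x i, (e x).1 i = MvPolynomial.eval x.1 (P i))
    (hQ : ∀ y i, (e.symm y).1 i = MvPolynomial.eval y.1 (Q i)) :
    Iso ((affine κ).restrict s) ((affine ι).restrict t) :=
  Iso.ofMorphisms e (isMorphism_affine_affine e P hP) (isMorphism_affine_affine e.symm Q hQ)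

/-- The points of `Gr°(2, ℂ^I)`. -/
def openGrassSet (I : Type) [LinearOrder I] : Set (ℙ ℂ (Pairs I → ℂ)) :=
  {x | x.rep ∈ grassCone I ∧ ∀ q : Pairs I, CyclicallyAdjacent q.1.1 q.1.2 → x.rep q ≠ 0}

/-- Representatives of the points of `Gr°(2, ℂ^I)`. -/
noncomputable def openGrassEquiv {I : Type} [LinearOrder I] (q₀ : Pairs I)
    (h₀ : CyclicallyAdjacent q₀.1.1 q₀.1.2) : openGrassSet I ≃ normalizedGrass I q₀ where
  toFun x := ⟨(x.1.rep q₀)⁻¹ • x.1.rep, smul_mem_grassCone x.2.1 _,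
    fun q hq => mul_ne_zero (inv_ne_zero (x.2.2 q₀ h₀)) (x.2.2 q hq),
    inv_mul_cancel₀ (x.2.2 q₀ h₀)⟩
  invFun p := ⟨Projectivization.mk ℂ p.1 fun h0 =>
      one_ne_zero (p.2.2.2.symm.trans (congrFun h0 q₀)), by
    obtain ⟨c, hc, h⟩ := exists_rep_mk_eq_smul p.1 fun h0 =>
      one_ne_zero (p.2.2.2.symm.trans (congrFun h0 q₀))
    constructor
    · rw [h]
      exact smul_mem_grassCone p.2.1 c
    · intro q hq
      rw [h]
      exact mul_ne_zero hc (p.2.2.1 q hq)⟩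
  left_inv x := by
    refine Subtype.ext ?_
    have h1 : Projectivization.mk ℂ x.1.rep x.1.rep_nonzero = x.1 := x.1.mk_rep
    refine Eq.trans ?_ h1
    exact (Projectivization.mk_eq_mk_iff' _ _ _ _ _).2 ⟨_, rfl⟩
  right_inv p := by
    obtain ⟨c, hc, h⟩ := exists_rep_mk_eq_smul p.1 fun h0 =>
      one_ne_zero (p.2.2.2.symm.trans (congrFun h0 q₀))
    refine Subtype.ext ?_
    dsimp only
    rw [h, Pi.smul_apply, p.2.2.2, smul_smul, smul_eq_mul, mul_one, inv_mul_cancel₀ hc, one_smul]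

/-- `Gr°(2, ℂ^I)` as an affine variety. -/
noncomputable def openGrassIso {I : Type} [LinearOrder I] (q₀ : Pairs I)
    (h₀ : CyclicallyAdjacent q₀.1.1 q₀.1.2) :
    Iso (openGrass I) ((affine (Pairs I)).restrict (normalizedGrass I q₀)) :=
  Iso.ofMorphisms (X := (projective (Pairs I)).restrict (openGrassSet I)) (openGrassEquiv q₀ h₀)
    (isMorphism_projective_affine (openGrassEquiv q₀ h₀) fun q => ⟨1, .X q, .X q₀,
      MvPolynomial.isHomogeneous_X _ _, MvPolynomial.isHomogeneous_X _ _, fun x => by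
        rw [MvPolynomial.eval_X, MvPolynomial.eval_X]
        exact ⟨x.2.2 q₀ h₀, (div_eq_inv_mul _ _).symm⟩⟩)
    (isMorphism_affine_projective (openGrassEquiv q₀ h₀).symm .X
      (fun p h0 => one_ne_zero (p.2.2.2.symm.trans (by
        have h1 := congrFun h0 q₀
        rwa [MvPolynomial.eval_X] at h1))) fun p => by
        simp only [MvPolynomial.eval_X]
        rfl)

/-- Subsets of affine spaces that correspond under a bijection of the coordinates. -/
def reindexEquiv {κ ι : Type} (e : κ ≃ ι) {s : Set (κ → ℂ)} {t : Set (ι → ℂ)}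
    (h : ∀ x, x ∈ t ↔ x ∘ e ∈ s) : s ≃ t where
  toFun x := ⟨x.1 ∘ e.symm, (h _).2 (by
    rw [Function.comp_assoc, Equiv.symm_comp_self]
    exact x.2)⟩
  invFun x := ⟨x.1 ∘ e, (h _).1 x.2⟩
  left_inv x := Subtype.ext (funext fun i => congrArg x.1 (e.symm_apply_apply i))
  right_inv x := Subtype.ext (funext fun i => congrArg x.1 (e.apply_symm_apply i))

/-- Affine varieties that correspond under a bijection of the coordinates. -/
noncomputable def affineReindex {κ ι : Type} (e : κ ≃ ι) {s : Set (κ → ℂ)} {t : Set (ι → ℂ)}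
    (h : ∀ x, x ∈ t ↔ x ∘ e ∈ s) : Iso ((affine κ).restrict s) ((affine ι).restrict t) :=
  affineIso (reindexEquiv e h) (fun i => .X (e.symm i)) (fun i => .X (e i))
    (fun _ _ => by rw [MvPolynomial.eval_X]; rfl) (fun _ _ => by rw [MvPolynomial.eval_X]; rfl)

theorem cyclicallyAdjacent_orderIso {I J : Type} [LinearOrder I] [LinearOrder J] (f : I ≃o J)
    (i j : I) : CyclicallyAdjacent (f i) (f j) ↔ CyclicallyAdjacent i j := by
  unfold CyclicallyAdjacent
  simp only [f.surjective.forall, f.lt_iff_lt, f.le_iff_le]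

/-- The bijection of pairs induced by an isomorphism of orders. -/
def pairsCongr {I J : Type} [LinearOrder I] [LinearOrder J] (f : I ≃o J) : Pairs I ≃ Pairs J :=
  (f.toEquiv.prodCongr f.toEquiv).subtypeEquiv fun _ => f.lt_iff_lt.symm

theorem mem_normalizedGrass_comp {I J : Type} [LinearOrder I] [LinearOrder J] (f : I ≃o J)
    (q₀ : Pairs I) (p : Pairs J → ℂ) :
    p ∈ normalizedGrass J (pairsCongr f q₀) ↔ p ∘ pairsCongr f ∈ normalizedGrass I q₀ := by
  refine and_congr ?_ (and_congr ?_ Iff.rfl)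
  · constructor
    · exact fun h i j k l hij hjk hkl => h (f i) (f j) (f k) (f l) (f.lt_iff_lt.2 hij)
        (f.lt_iff_lt.2 hjk) (f.lt_iff_lt.2 hkl)
    · intro h i j k l hij hjk hkl
      obtain ⟨i, rfl⟩ := f.surjective i
      obtain ⟨j, rfl⟩ := f.surjective j
      obtain ⟨k, rfl⟩ := f.surjective k
      obtain ⟨l, rfl⟩ := f.surjective l
      exact h i j k l (f.lt_iff_lt.1 hij) (f.lt_iff_lt.1 hjk) (f.lt_iff_lt.1 hkl)
  · rw [(pairsCongr f).surjective.forall]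
    exact forall_congr' fun q => imp_congr (cyclicallyAdjacent_orderIso f _ _) Iff.rfl

/-- `Gr°(2, ℂ^I)` only depends on the order type of `I`. -/
noncomputable def openGrassCongr {I J : Type} [LinearOrder I] [LinearOrder J] (f : I ≃o J)
    (q₀ : Pairs I) (h₀ : CyclicallyAdjacent q₀.1.1 q₀.1.2) : Iso (openGrass I) (openGrass J) :=
  (openGrassIso q₀ h₀).trans ((affineReindex (pairsCongr f) (mem_normalizedGrass_comp f q₀)).trans
    (openGrassIso (pairsCongr f q₀) ((cyclicallyAdjacent_orderIso f _ _).2 h₀)).symm)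

/-! ## Tori -/

/-- The points with non-vanishing coordinates. -/
def torusSet (κ : Type) : Set (κ → ℂ) := {τ | ∀ i, τ i ≠ 0}

/-- The torus with coordinates `κ`. -/
noncomputable def torus (κ : Type) : SpaceWithFunctions := (affine κ).restrict (torusSet κ)

/-- A bijection of the coordinates of tori. -/
noncomputable def torusCongr {κ ι : Type} (e : κ ≃ ι) : Iso (torus κ) (torus ι) :=
  affineReindex e fun x => by
    change (∀ i, x i ≠ 0) ↔ ∀ i, x (e i) ≠ 0
    exact e.surjective.forall

/-- The subtorus on which some of the coordinates are `1`. -/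
def subtorusSet {κ : Type} (Q : κ → Prop) : Set (κ → ℂ) :=
  {τ | (∀ e, τ e ≠ 0) ∧ ∀ e, Q e → τ e = 1}

open Classical in
/-- The free coordinates of a subtorus. -/
noncomputable def subtorusEquiv {κ : Type} (Q : κ → Prop) :
    subtorusSet Q ≃ torusSet {e // ¬ Q e} where
  toFun τ := ⟨fun e => τ.1 e.1, fun e => τ.2.1 e.1⟩
  invFun τ := ⟨fun e => if h : Q e then 1 else τ.1 ⟨e, h⟩, fun e => by
    dsimp only
    split_ifs with h
    · exact one_ne_zero
    · exact τ.2 _, fun e he => dif_pos he⟩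
  left_inv τ := Subtype.ext (funext fun e => by
    dsimp only
    split_ifs with h
    · exact (τ.2.2 e h).symm
    · rfl)
  right_inv τ := Subtype.ext (funext fun e => dif_neg e.2)

open Classical in
/-- A subtorus on which some of the coordinates are `1`. -/
noncomputable def subtorusIso {κ : Type} (Q : κ → Prop) :
    Iso ((affine κ).restrict (subtorusSet Q)) (torus {e // ¬ Q e}) :=
  affineIso (subtorusEquiv Q) (fun e => .X e.1) (fun e => if h : Q e then 1 else .X ⟨e, h⟩)
    (fun _ _ => by rw [MvPolynomial.eval_X]; rfl) fun τ e => by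
      change (if h : Q e then 1 else τ.1 ⟨e, h⟩) = _
      split_ifs with h
      · exact (map_one _).symm
      · exact (MvPolynomial.eval_X _).symm

/-! ## The open part as a product -/

theorem card_ge_four_of_ne {V : Finset (Fin n)} {i j k l : Fin n} (hi : i ∈ V) (hj : j ∈ V)
    (hk : k ∈ V) (hl : l ∈ V) (hij : i < j) (hjk : j < k) (hkl : k < l) : 4 ≤ V.card := by
  have h1 : ({i, j, k, l} : Finset (Fin n)).card = 4 := by
    rw [Finset.card_eq_succ]
    refine ⟨i, {j, k, l}, ?_, rfl, Finset.card_eq_three.2 ⟨j, k, l, hjk.ne, (hjk.trans hkl).ne,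
      hkl.ne, rfl⟩⟩
    simp only [Finset.mem_insert, Finset.mem_singleton]
    grind
  rw [← h1]
  refine Finset.card_le_card fun x hx => ?_
  simp only [Finset.mem_insert, Finset.mem_singleton] at hx
  rcases hx with rfl | rfl | rfl | rfl <;> assumption

theorem cyclicallyAdjacent_of_card_eq_three {V : Finset (Fin n)} (hV : V.card = 3)
    (q : Pairs V) : CyclicallyAdjacent q.1.1 q.1.2 := by
  by_contra hc
  rw [CyclicallyAdjacent, not_or] at hc
  push Not at hc
  obtain ⟨⟨k, hk1, hk2⟩, m, hm⟩ := hc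
  have h4 : ¬ 4 ≤ V.card := by omega
  rcases lt_or_ge m q.1.1 with h | h
  · exact h4 (card_ge_four_of_ne m.2 q.1.1.2 k.2 q.1.2.2 h hk1 hk2)
  · exact h4 (card_ge_four_of_ne q.1.1.2 k.2 q.1.2.2 m.2 hk1 hk2 (hm h))

/-- The free coordinates of the triangles of a dissection. -/
abbrev TriangleIndex (V₀ : Cell S) : Type :=
  {q : ForestPair S // q.1 ≠ V₀ ∧ q.2 ≠ topPair q.1}

section Product

variable (V₀ : Cell S)

open Classical in
/-- A point of the product from its coordinates. -/
noncomputable def ofCoords {R : Type} [One R]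
    (z : Pairs (V₀.1 : Finset (Fin n)) ⊕ TriangleIndex V₀ → R) : ForestPair S → R :=
  fun q => if h : q.1 = V₀ then z (.inl (h ▸ q.2))
    else if h' : q.2 = topPair q.1 then 1 else z (.inr ⟨q, h, h'⟩)

theorem ofCoords_self {R : Type} [One R]
    (z : Pairs (V₀.1 : Finset (Fin n)) ⊕ TriangleIndex V₀ → R)
    (q : Pairs (V₀.1 : Finset (Fin n))) : ofCoords V₀ z ⟨V₀, q⟩ = z (.inl q) := dif_pos rfl

theorem ofCoords_topPair {R : Type} [One R]
    (z : Pairs (V₀.1 : Finset (Fin n)) ⊕ TriangleIndex V₀ → R) {α : Cell S} (h : α ≠ V₀) :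
    ofCoords V₀ z ⟨α, topPair α⟩ = 1 :=
  (dif_neg h).trans (dif_pos rfl)

theorem ofCoords_triangle {R : Type} [One R]
    (z : Pairs (V₀.1 : Finset (Fin n)) ⊕ TriangleIndex V₀ → R) (q : TriangleIndex V₀) :
    ofCoords V₀ z q.1 = z (.inr q) :=
  (dif_neg q.2.1).trans (dif_neg q.2.2)

theorem map_ofCoords {R R' : Type} [One R] [One R'] (f : R → R') (hf : f 1 = 1)
    (z : Pairs (V₀.1 : Finset (Fin n)) ⊕ TriangleIndex V₀ → R) (q : ForestPair S) :
    f (ofCoords V₀ z q) = ofCoords V₀ (f ∘ z) q := by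
  unfold ofCoords
  split_ifs
  · rfl
  · exact hf
  · rfl

theorem ofCoords_comp_eq {R : Type} [One R] {y : ForestPair S → R}
    (hy : ∀ α, y ⟨α, topPair α⟩ = 1) :
    ofCoords V₀ (Sum.elim (fun q => y ⟨V₀, q⟩) fun q => y q.1) = y := by
  funext ⟨α, q⟩
  by_cases h : α = V₀
  · subst h
    exact ofCoords_self _ _ _
  · by_cases h' : q = topPair α
    · rw [h', ofCoords_topPair V₀ _ h, hy]
    · exact ofCoords_triangle V₀ _ ⟨⟨α, q⟩, h, h'⟩

/-- Plücker relations need four edges, so a triangle imposes none. All its pairs of edges are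
adjacent, so its two free coordinates range over all non-zero values. -/
theorem ofCoords_mem (hV : ∀ α : Cell S, α ≠ V₀ → α.1.card = 3)
    {z : Pairs (V₀.1 : Finset (Fin n)) ⊕ TriangleIndex V₀ → ℂ}
    (hz : z ∈ prodSet (normalizedGrass _ (topPair V₀)) (torusSet (TriangleIndex V₀))) :
    ofCoords V₀ z ∈ normalizedCone S := by
  have hne : ∀ α, α ≠ V₀ → ∀ q, ofCoords V₀ z ⟨α, q⟩ ≠ 0 := fun α hα q => by
    by_cases h' : q = topPair α
    · rw [h', ofCoords_topPair V₀ _ hα]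
      exact one_ne_zero
    · exact ne_of_eq_of_ne (ofCoords_triangle V₀ z ⟨⟨α, q⟩, hα, h'⟩) (hz.2 _)
  refine ⟨⟨fun α => ?_, fun α q hq => ?_⟩, fun α => ?_⟩
  · by_cases h : α = V₀
    · subst h
      have h1 : (fun q => ofCoords α z ⟨α, q⟩) = z ∘ Sum.inl :=
        funext fun q => ofCoords_self α z q
      rw [h1]
      exact hz.1.1
    · intro i j k l hij hjk hkl
      have h1 := card_ge_four_of_ne i.2 j.2 k.2 l.2 hij hjk hkl
      rw [hV α h] at h1
      omega
  · by_cases h : α = V₀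
    · subst h
      rw [ofCoords_self]
      exact hz.1.2.1 q hq
    · exact hne α h q
  · by_cases h : α = V₀
    · subst h
      rw [ofCoords_self]
      exact hz.1.2.2
    · exact ofCoords_topPair V₀ z h

/-- The coordinates of the normalized points of a dissection into `V₀` and triangles. -/
noncomputable def normalizedConeEquiv (hV : ∀ α : Cell S, α ≠ V₀ → α.1.card = 3) :
    normalizedCone S ≃
      prodSet (normalizedGrass _ (topPair V₀)) (torusSet (TriangleIndex V₀)) where
  toFun y := ⟨Sum.elim (fun q => y.1 ⟨V₀, q⟩) fun q => y.1 q.1,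
    ⟨y.2.1.1 V₀, y.2.1.2 V₀, y.2.2 V₀⟩,
    fun q => y.2.1.2 _ _ (cyclicallyAdjacent_of_card_eq_three (hV _ q.2.1) _)⟩
  invFun z := ⟨ofCoords V₀ z.1, ofCoords_mem V₀ hV z.2⟩
  left_inv y := Subtype.ext (ofCoords_comp_eq V₀ y.2.2)
  right_inv z := Subtype.ext (funext fun i => by
    rcases i with q | q
    · exact ofCoords_self V₀ z.1 q
    · exact ofCoords_triangle V₀ z.1 q)

/-- The normalized points of a dissection into `V₀` and triangles. -/
noncomputable def normalizedConeIso (hV : ∀ α : Cell S, α ≠ V₀ → α.1.card = 3) :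
    Iso ((affine (ForestPair S)).restrict (normalizedCone S))
      ((affine (Pairs (V₀.1 : Finset (Fin n)) ⊕ TriangleIndex V₀)).restrict
        (prodSet (normalizedGrass _ (topPair V₀)) (torusSet (TriangleIndex V₀)))) :=
  affineIso (normalizedConeEquiv V₀ hV)
    (Sum.elim (fun q => MvPolynomial.X (⟨V₀, q⟩ : ForestPair S)) fun q => MvPolynomial.X q.1)
    (ofCoords V₀ MvPolynomial.X)
    (fun y i => by
      rcases i with q | q
      · exact (MvPolynomial.eval_X (f := y.1) _).symm
      · exact (MvPolynomial.eval_X (f := y.1) _).symm)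
    (fun z q => by
      rw [map_ofCoords V₀ (MvPolynomial.eval z.1) (map_one _)]
      have h1 : (MvPolynomial.eval z.1 ∘ MvPolynomial.X) = z.1 :=
        funext fun i => MvPolynomial.eval_X _
      rw [h1]
      rfl)

end Product

theorem card_pairs_of_card_eq_three {V : Finset (Fin n)} (hV : V.card = 3) :
    Fintype.card (Pairs V) = 3 := by
  have f : V ≃o Fin 3 := (V.orderIsoOfFin hV).symm
  rw [Fintype.card_congr (pairsCongr f)]
  decide

theorem card_triangleIndex (V₀ : Cell S) (hV : ∀ α : Cell S, α ≠ V₀ → α.1.card = 3) :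
    Fintype.card (TriangleIndex V₀) = 2 * (Fintype.card (Cell S) - 1) := by
  let e : TriangleIndex V₀ ≃ Σ α : {α : Cell S // α ≠ V₀},
      {q : Pairs (α.1.1 : Finset (Fin n)) // q ≠ topPair α.1} :=
    { toFun := fun q => ⟨⟨q.1.1, q.2.1⟩, ⟨q.1.2, q.2.2⟩⟩
      invFun := fun q => ⟨⟨q.1.1, q.2.1⟩, q.1.2, q.2.2⟩
      left_inv := fun _ => rfl
      right_inv := fun _ => rfl }
  rw [Fintype.card_congr e, Fintype.card_sigma, Finset.sum_const_nat (m := 2), Finset.card_univ,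
    Fintype.card_subtype_compl, Fintype.card_subtype_eq, mul_comm]
  intro α _
  rw [Fintype.card_subtype_compl, Fintype.card_subtype_eq, card_pairs_of_card_eq_three (hV _ α.2)]

/-- The open part of the central fibre as a product. -/
theorem nonempty_openPart_iso {Γ : Finset (Fin n × Fin n)} (hΓ : S ⊆ Γ) (hS : IsDissection S)
    (hn : 3 ≤ n) {r : Pairs (Fin n)} (hr : ∀ k, r.1.1 ≤ k ∧ k ≤ r.1.2) (V₀ : Cell S)
    (hV : ∀ α : Cell S, α ≠ V₀ → α.1.card = 3) {ι : Type} [Fintype ι]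
    (hι : Fintype.card ι = 2 * (Fintype.card (Cell S) - 1)) :
    Nonempty (Iso ((projective (Pairs (Fin n))).restrict (centralFiber Γ S \ boundaryDivisor n))
      (prod (openGrass (V₀.1 : Finset (Fin n))) (torus ι))) := by
  have e : TriangleIndex V₀ ≃ ι :=
    Fintype.equivOfCardEq ((card_triangleIndex V₀ hV).trans hι.symm)
  exact ⟨(normalizedIso hΓ hS hn hr).trans ((normalizedConeIso V₀ hV).trans
    ((affineProdIso _ _).symm.trans (Iso.prodCongr
      (openGrassIso (topPair V₀) (cyclicallyAdjacent_topPair V₀)).symm (torusCongr e))))⟩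

/-! ## Counting cells -/

/-- The vertices of a cell other than the first and the last one. -/
def innerVertices (α : Cell S) : Finset (Fin n) := (α.1.erase (lo α)).erase (hi α)

theorem mem_innerVertices {α : Cell S} {v : Fin n} :
    v ∈ innerVertices α ↔ v ∈ α.1 ∧ lo α < v ∧ v < hi α := by
  rw [innerVertices, Finset.mem_erase, Finset.mem_erase]
  constructor
  · rintro ⟨h1, h2, h3⟩
    exact ⟨h3, lt_of_le_of_ne (lo_le h3) h2.symm, lt_of_le_of_ne (le_hi h3) h1⟩
  · rintro ⟨h1, h2, h3⟩
    exact ⟨h3.ne, h2.ne', h1⟩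

theorem card_innerVertices (α : Cell S) : (innerVertices α).card = α.1.card - 2 := by
  rw [innerVertices, Finset.card_erase_of_mem, Finset.card_erase_of_mem (lo_mem α),
    Nat.sub_sub]
  exact Finset.mem_erase.2 ⟨(lo_lt_hi α).ne', hi_mem α⟩

theorem exists_mem_innerVertices (hS : IsDissection S) {r : Pairs (Fin n)}
    (hr : ∀ k, r.1.1 ≤ k ∧ k ≤ r.1.2) {v : Fin n} (h1 : r.1.1 < v) (h2 : v < r.1.2) :
    ∃ α : Cell S, v ∈ innerVertices α := by
  obtain ⟨g, hg, hgQ, hmin⟩ := exists_least_lid hS (fun g => g.1 < v ∧ v < g.2) v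
    ⟨r.1, Or.inr ⟨r.2, hr⟩, h1, h2⟩ fun e he => ⟨he.1.le, he.2⟩
  obtain ⟨α, h3, h4⟩ := exists_cell hS hg ⟨v, hgQ⟩
  refine ⟨α, mem_innerVertices.2 ⟨(mem_cell_iff hS α v).2 ⟨?_, ?_, fun f hf hf1 hf2 => ?_⟩, ?_, ?_⟩⟩
  · rw [h3]
    exact hgQ.1.le
  · rw [h4]
    exact hgQ.2.le
  · rw [h3, h4]
    exact hmin f (Or.inl hf) ⟨hf1, hf2⟩
  · rw [h3]
    exact hgQ.1
  · rw [h4]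
    exact hgQ.2

theorem disjoint_innerVertices (hS : IsDissection S) {α β : Cell S} (hne : α ≠ β) :
    Disjoint (innerVertices α) (innerVertices β) := by
  rw [Finset.disjoint_left]
  intro v hα hβ
  rw [mem_innerVertices] at hα hβ
  rcases cell_cases hS hne with ⟨x, y, h⟩ | ⟨x, y, h⟩ | h | h
  · have h1 := h.2.2.1 v hα.1
    have h2 := h.2.2.2
    grind
  · have h1 := h.2.2.1 v hβ.1
    have h2 := h.2.2.2
    grind
  · grind
  · grind

/-- Every vertex other than the first and last of the polygon is an inner vertex of exactly one
cell, the one under the least lid passing strictly over it. -/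
theorem sum_card_cells (hS : IsDissection S) {r : Pairs (Fin n)}
    (hr : ∀ k, r.1.1 ≤ k ∧ k ≤ r.1.2) : ∑ α : Cell S, (α.1.card - 2) = n - 2 := by
  have h1 : Finset.univ.biUnion (innerVertices (S := S)) =
      ((Finset.univ : Finset (Fin n)).erase r.1.1).erase r.1.2 := by
    ext v
    simp only [Finset.mem_biUnion, Finset.mem_erase, Finset.mem_univ, true_and, and_true]
    constructor
    · rintro ⟨α, hα⟩
      rw [mem_innerVertices] at hα
      exact ⟨(hα.2.2.trans_le (hr _).2).ne, ((hr _).1.trans_lt hα.2.1).ne'⟩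
    · rintro ⟨h2, h3⟩
      exact exists_mem_innerVertices hS hr (lt_of_le_of_ne (hr v).1 (Ne.symm h3))
        (lt_of_le_of_ne (hr v).2 h2)
  have h2 := Finset.card_biUnion (s := Finset.univ) (t := innerVertices (S := S))
    fun α _ β _ hne => disjoint_innerVertices hS hne
  rw [h1, Finset.card_erase_of_mem (Finset.mem_erase.2 ⟨r.2.ne', Finset.mem_univ _⟩),
    Finset.card_erase_of_mem (Finset.mem_univ _), Finset.card_univ, Fintype.card_fin,
    Nat.sub_sub] at h2
  rw [h2]
  exact Finset.sum_congr rfl fun α _ => (card_innerVertices α).symm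

/-- Cells correspond to their lids, which are the diagonals in `S` and the side `r`. -/
theorem card_cell (hS : IsDissection S) (hn : 3 ≤ n) {r : Pairs (Fin n)}
    (hr : ∀ k, r.1.1 ≤ k ∧ k ≤ r.1.2) : Fintype.card (Cell S) = S.card + 1 := by
  have hrS : r.1 ∉ S := fun h => (hS.isDiagonal _ h).2 (Or.inr hr)
  rw [← Finset.card_insert_of_notMem hrS, ← Finset.card_univ]
  refine Finset.card_bij (fun α _ => (lo α, hi α)) (fun α _ => ?_) (fun α _ β _ h => ?_)
    fun e he => ?_
  · rw [Finset.mem_insert]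
    rcases isLid_cell α with h | h
    · exact Or.inr h
    · exact Or.inl (Prod.ext (le_antisymm (h.2 _).1 (hr _).1) (le_antisymm (hr _).2 (h.2 _).2))
  · rw [Prod.mk.injEq] at h
    exact cell_ext hS h.1 h.2
  · obtain ⟨α, h1, h2⟩ : ∃ α : Cell S, lo α = e.1 ∧ hi α = e.2 := by
      rcases Finset.mem_insert.1 he with rfl | he
      · obtain ⟨ρ, v, hv, -⟩ := exists_isOuter hS hn r.1.1
        obtain ⟨m, -, hm1, hm2⟩ := exists_mid ρ
        exact exists_cell hS (Or.inr ⟨r.2, hr⟩)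
          ⟨m, (hr _).1.trans_lt hm1, hm2.trans_le (hr _).2⟩
      · exact exists_cell hS (Or.inl he) (hS.exists_between he)
    exact ⟨α, Finset.mem_univ _, Prod.ext h1 h2⟩

/-! ## Triangulations -/

theorem IsTriangulation.isDissection {Γ : Finset (Fin n × Fin n)} (hΓ : IsTriangulation Γ)
    (hS : S ⊆ Γ) : IsDissection S where
  isDiagonal e he := hΓ.1 e (hS he)
  nonCrossing e he f hf := hΓ.2.1 e (hS he) f (hS hf)

/-- With two inner vertices `x < y`, the chord from the first vertex to `y` crosses no diagonal of
`Γ`, since a diagonal hiding one vertex of a cell hides the whole cell. By maximality it lies in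
`Γ`, yet it is not an edge of the cell. -/
theorem IsTriangulation.card_cell_eq_three {Γ : Finset (Fin n × Fin n)} (hΓ : IsTriangulation Γ)
    (α : Cell Γ) : α.1.card = 3 := by
  have hS := hΓ.isDissection subset_rfl
  have h3 := α.2.1
  by_contra hne
  have h4 : 1 < (innerVertices α).card := by
    rw [card_innerVertices]
    omega
  obtain ⟨x, hx, y, hy, hxy⟩ : ∃ x ∈ innerVertices α, ∃ y ∈ innerVertices α, x < y := by
    obtain ⟨x, hx, y, hy, hxy⟩ := Finset.one_lt_card.1 h4
    rcases lt_or_gt_of_ne hxy with h | h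
    · exact ⟨x, hx, y, hy, h⟩
    · exact ⟨y, hy, x, hx, h⟩
  rw [mem_innerVertices] at hx hy
  have hmem : (lo α, y) ∈ Γ := by
    refine hΓ.2.2 _ ⟨hy.2.1, ?_⟩ fun f hf => ?_
    · rintro (h | h)
      · exact h x ⟨hx.2.1, hxy⟩
      · exact absurd (h (hi α)).2 (not_le.2 hy.2.2)
    · rw [nonCrossing_iff hy.2.1 (hS.lt hf)]
      have h5 := fun h h' => cut_off hS hf (lo_mem α) h h'
      have h6 := fun h h' => cut_off hS hf hy.1 h h'
      have h7 := hS.lt hf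
      simp only
      grind
  rcases α.2.2.2 (lowVertex α) ⟨y, hy.1⟩ hmem with h | h
  · have h5 := nextVertex_le (v := lowVertex α) hx.1 hx.2.1
    rw [h] at h5
    exact absurd hxy (not_lt.2 h5)
  · have h5 := lt_nextVertex (α := α) (v := ⟨y, hy.1⟩) hy.2.2
    rw [h] at h5
    exact absurd h5 (not_lt.2 hy.2.1.le)

theorem IsTriangulation.card_eq {Γ : Finset (Fin n × Fin n)} (hΓ : IsTriangulation Γ)
    (hn : 3 ≤ n) {r : Pairs (Fin n)} (hr : ∀ k, r.1.1 ≤ k ∧ k ≤ r.1.2) : Γ.card = n - 3 := by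
  have hS := hΓ.isDissection subset_rfl
  have h1 := sum_card_cells hS hr
  have h2 := card_cell hS hn hr
  simp only [hΓ.card_cell_eq_three, Finset.sum_const, Finset.card_univ, h2, smul_eq_mul] at h1
  omega

/-! ## Whitehead moves -/

theorem IsWhiteheadMove.inter_eq {Γ Γ' : Finset (Fin n × Fin n)} {a b c d : Fin n}
    (hΓ' : IsTriangulation Γ') (hW : IsWhiteheadMove Γ Γ' a b c d) :
    Γ ∩ Γ' = Γ.erase (a, c) := by
  obtain ⟨hab, hbc, hcd, hac, hbd, he⟩ := hW
  ext e
  rw [Finset.mem_inter, Finset.mem_erase]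
  constructor
  · rintro ⟨h1, h2⟩
    refine ⟨?_, h1⟩
    rintro rfl
    have h3 := (nonCrossing_iff (hab.trans hbc) (hbc.trans hcd)).1 (hΓ'.2.1 _ h2 _ hbd)
    simp only at h3
    grind
  · intro h
    have h1 : e ∈ Γ'.erase (b, d) := he ▸ Finset.mem_erase.2 h
    exact ⟨h.2, Finset.mem_of_mem_erase h1⟩

/-- A diagonal of `Γ` other than `ac` also lies in `Γ'`, hence crosses neither `ac` nor `bd`, and
therefore no edge of the quadrilateral. Maximality of `Γ` does the rest. -/
theorem IsWhiteheadMove.mem_or_adjacent {Γ Γ' : Finset (Fin n × Fin n)} {a b c d : Fin n}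
    (hΓ : IsTriangulation Γ) (hΓ' : IsTriangulation Γ') (hW : IsWhiteheadMove Γ Γ' a b c d)
    {e : Fin n × Fin n} (he : e = (a, b) ∨ e = (b, c) ∨ e = (c, d) ∨ e = (a, d)) :
    CyclicallyAdjacent e.1 e.2 ∨ e ∈ Γ ∩ Γ' := by
  have hI := hW.inter_eq hΓ'
  obtain ⟨hab, hbc, hcd, hac, hbd, hE⟩ := hW
  have hlt : e.1 < e.2 := by
    rcases he with rfl | rfl | rfl | rfl
    · exact hab
    · exact hbc
    · exact hcd
    · exact (hab.trans hbc).trans hcd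
  by_cases hadj : CyclicallyAdjacent e.1 e.2
  · exact Or.inl hadj
  · refine Or.inr ?_
    rw [hI, Finset.mem_erase]
    constructor
    · rintro rfl
      simp only [Prod.mk.injEq] at he
      grind
    · refine hΓ.2.2 e ⟨hlt, hadj⟩ fun f hf => ?_
      have hfl := (hΓ.1 f hf).1
      rw [nonCrossing_iff hlt hfl]
      have h1 := (nonCrossing_iff (hab.trans hbc) hfl).1 (hΓ.2.1 _ hac _ hf)
      have h2 : f = (a, c) ∨ f.1 < f.2 ∧ ((f.1 ≤ b ∧ d ≤ f.2) ∨ (b ≤ f.1 ∧ f.2 ≤ d) ∨ d ≤ f.1 ∨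
          f.2 ≤ b) := by
        by_cases hfe : f = (a, c)
        · exact Or.inl hfe
        · have h3 : f ∈ Γ'.erase (b, d) := hE ▸ Finset.mem_erase.2 ⟨hfe, hf⟩
          exact Or.inr ⟨hfl, (nonCrossing_iff (hbc.trans hcd) hfl).1
            (hΓ'.2.1 _ hbd _ (Finset.mem_of_mem_erase h3))⟩
      simp only at h1
      rcases h2 with rfl | ⟨-, h2⟩
      · rcases he with rfl | rfl | rfl | rfl <;> simp only <;> grind
      · rcases he with rfl | rfl | rfl | rfl <;> simp only <;> grind

theorem nextVertex_eq {V : Finset (Fin n)} {v : V} {w : Fin n} (hw : w ∈ V) (hvw : v.1 < w)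
    (h : ∀ x ∈ V, x ≤ v.1 ∨ w ≤ x) : nextVertex V v = w :=
  le_antisymm (nextVertex_le hw hvw) ((h _ (nextVertex_mem V v)).resolve_left
    (not_le.2 (lt_nextVertex_of_exists ⟨w, hw, hvw⟩)))

theorem IsWhiteheadMove.isCell {Γ Γ' : Finset (Fin n × Fin n)} {a b c d : Fin n}
    (hΓ : IsTriangulation Γ) (hΓ' : IsTriangulation Γ') (hW : IsWhiteheadMove Γ Γ' a b c d) :
    IsCell (Γ ∩ Γ') {a, b, c, d} := by
  have eab := hW.mem_or_adjacent hΓ hΓ' (e := (a, b)) (Or.inl rfl)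
  have ebc := hW.mem_or_adjacent hΓ hΓ' (e := (b, c)) (Or.inr (Or.inl rfl))
  have ecd := hW.mem_or_adjacent hΓ hΓ' (e := (c, d)) (Or.inr (Or.inr (Or.inl rfl)))
  have ead := hW.mem_or_adjacent hΓ hΓ' (e := (a, d)) (Or.inr (Or.inr (Or.inr rfl)))
  have hac : (a, c) ∉ Γ ∩ Γ' := by
    rw [hW.inter_eq hΓ']
    exact Finset.notMem_erase _ _
  have hbd : (b, d) ∉ Γ ∩ Γ' := by
    rw [hW.inter_eq hΓ', hW.2.2.2.2.2]
    exact Finset.notMem_erase _ _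
  have hdiss := hΓ.isDissection (S := Γ ∩ Γ') Finset.inter_subset_left
  obtain ⟨hab, hbc, hcd, -, -, -⟩ := hW
  have hmem : ∀ x, x ∈ ({a, b, c, d} : Finset (Fin n)) ↔ x = a ∨ x = b ∨ x = c ∨ x = d :=
    fun x => by simp only [Finset.mem_insert, Finset.mem_singleton]
  generalize ({a, b, c, d} : Finset (Fin n)) = V at hmem ⊢
  have ha : a ∈ V := (hmem a).2 (by simp)
  have hb : b ∈ V := (hmem b).2 (by simp)
  have hc : c ∈ V := (hmem c).2 (by simp)
  have hd : d ∈ V := (hmem d).2 (by simp)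
  have na : nextVertex V ⟨a, ha⟩ = b := nextVertex_eq hb hab fun x hx => by
    have := (hmem x).1 hx
    grind
  have nb : nextVertex V ⟨b, hb⟩ = c := nextVertex_eq hc hbc fun x hx => by
    have := (hmem x).1 hx
    grind
  have nc : nextVertex V ⟨c, hc⟩ = d := nextVertex_eq hd hcd fun x hx => by
    have := (hmem x).1 hx
    grind
  have nd : nextVertex V ⟨d, hd⟩ = a := nextVertex_eq_min (fun x hx => by
    have := (hmem x).1 hx
    grind) ha fun x hx => by
    have := (hmem x).1 hx
    grind
  refine ⟨?_, ?_, ?_⟩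
  · exact (card_ge_four_of_ne ha hb hc hd hab hbc hcd).trans' (by norm_num)
  · rintro ⟨v, hv⟩
    rcases (hmem v).1 hv with rfl | rfl | rfl | rfl
    · rw [na, IsSide, min_eq_left hab.le, max_eq_right hab.le]
      exact eab
    · rw [nb, IsSide, min_eq_left hbc.le, max_eq_right hbc.le]
      exact ebc
    · rw [nc, IsSide, min_eq_left hcd.le, max_eq_right hcd.le]
      exact ecd
    · have had := ((hab.trans hbc).trans hcd).le
      rw [nd, IsSide, min_eq_right had, max_eq_left had]
      exact ead
  · rintro ⟨v, hv⟩ ⟨w, hw⟩ hvw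
    have hlt : v < w := hdiss.lt hvw
    simp only at hvw
    -- Of the six chords between the four vertices, four are edges and two are the exchanged
    -- diagonals, which are not common; the other cases contradict `v < w`.
    rcases (hmem v).1 hv with rfl | rfl | rfl | rfl <;>
      rcases (hmem w).1 hw with rfl | rfl | rfl | rfl <;>
      first
        | exact Or.inl na
        | exact Or.inl nb
        | exact Or.inl nc
        | exact Or.inr nd
        | exact absurd hvw hac
        | exact absurd hvw hbd
        | grind

/-! ## The edges of the dual tree -/

/-- The sides of the polygon. -/
def sides (n : ℕ) : Finset (Fin n × Fin n) :=
  Finset.univ.filter fun e => e.1 < e.2 ∧ IsSide e.1 e.2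

theorem mem_sides_iff_isSide {e : Fin n × Fin n} :
    e ∈ sides n ↔ e.1 < e.2 ∧ IsSide e.1 e.2 :=
  Finset.mem_filter.trans (and_iff_right (Finset.mem_univ _))

theorem mem_sides {e : Fin n × Fin n} :
    e ∈ sides n ↔ e.1 < e.2 ∧ CyclicallyAdjacent e.1 e.2 := by
  refine mem_sides_iff_isSide.trans ⟨fun h => ⟨h.1, ?_⟩, fun h => ⟨h.1, ?_⟩⟩
  · have h1 := h.2
    rwa [IsSide, min_eq_left h.1.le, max_eq_right h.1.le] at h1
  · rw [IsSide, min_eq_left h.1.le, max_eq_right h.1.le]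
    exact h.2

theorem card_sides (hn : 3 ≤ n) : (sides n).card = n := by
  let f : Fin n → Fin n × Fin n := fun i =>
    if h : i.1 + 1 < n then (i, ⟨i.1 + 1, h⟩) else (⟨0, by omega⟩, i)
  have hf : ∀ i : Fin n, (f i).1.1 = (if i.1 + 1 < n then i.1 else 0) ∧
      (f i).2.1 = (if i.1 + 1 < n then i.1 + 1 else i.1) := fun i => by
    simp only [f]
    split_ifs <;> exact ⟨rfl, rfl⟩
  have hcard : (Finset.univ : Finset (Fin n)).card = n := Finset.card_fin n
  refine Eq.trans ?_ hcard
  refine (Finset.card_bij (fun i _ => f i) (fun i _ => ?_) (fun i _ j _ h => ?_)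
    fun e he => ?_).symm
  · obtain ⟨h1, h2⟩ := hf i
    have hi := i.2
    rw [mem_sides, CyclicallyAdjacent]
    simp only [Fin.lt_def, Fin.le_def, h1, h2]
    split_ifs with h
    · exact ⟨by omega, Or.inl fun k => by omega⟩
    · exact ⟨by omega, Or.inr fun k => by omega⟩
  · obtain ⟨h1, h2⟩ := hf i
    obtain ⟨h3, h4⟩ := hf j
    rw [h] at h1 h2
    have hi := i.2
    have hj := j.2
    refine Fin.ext ?_
    split_ifs at * <;> omega
  · rw [mem_sides, CyclicallyAdjacent] at he
    obtain ⟨h1, h2 | h2⟩ := he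
    · refine ⟨e.1, Finset.mem_univ _, ?_⟩
      have h3 : e.1.1 + 1 < n := by
        have := e.2.2
        rw [Fin.lt_def] at h1
        omega
      have h4 := h2 ⟨e.1.1 + 1, h3⟩
      obtain ⟨h5, h6⟩ := hf e.1
      rw [if_pos h3] at h5 h6
      refine Prod.ext (Fin.ext h5) (Fin.ext (h6.trans ?_))
      simp only [Fin.lt_def] at h1 h4
      omega
    · refine ⟨e.2, Finset.mem_univ _, ?_⟩
      have h3 := (h2 ⟨0, by omega⟩).1
      have h4 := (h2 ⟨n - 1, by omega⟩).2
      simp only [Fin.le_def] at h3 h4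
      obtain ⟨h5, h6⟩ := hf e.2
      have h7 := e.2.2
      rw [if_neg (by omega)] at h5 h6
      exact Prod.ext (Fin.ext (by omega)) (Fin.ext h6)

theorem card_treeEdge_compl (hS : IsDissection S) (hn : 3 ≤ n) {F : Finset (Fin n × Fin n)}
    (hF : F ⊆ S ∪ sides n) (Q : TreeEdge S → Prop) (hQ : ∀ e, Q e ↔ e.1 ∈ F)
    [Fintype {e // ¬ Q e}] : Fintype.card {e // ¬ Q e} = S.card + n - F.card := by
  have h1 : Disjoint S (sides n) := Finset.disjoint_left.2 fun e he he' =>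
    (hS.isDiagonal e he).2 (mem_sides.1 he').2
  have h0 : S.card + n - F.card = ((S ∪ sides n) \ F).card := by
    rw [Finset.card_sdiff_of_subset hF, Finset.card_union_of_disjoint h1, card_sides hn]
  rw [h0, ← Fintype.card_coe]
  refine Fintype.card_congr
    { toFun := fun e => ⟨e.1.1, ?_⟩
      invFun := fun e => ⟨⟨e.1, ?_⟩, ?_⟩
      left_inv := fun _ => rfl
      right_inv := fun _ => rfl }
  · exact Finset.mem_sdiff.2 ⟨Finset.mem_union.2 (e.1.2.imp id mem_sides_iff_isSide.2),
      fun h => e.2 ((hQ _).2 h)⟩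
  · exact (Finset.mem_union.1 (Finset.mem_sdiff.1 e.2).1).imp id mem_sides_iff_isSide.1
  · exact fun h => (Finset.mem_sdiff.1 e.2).2 ((hQ _).1 h)

/-- The identity. -/
def SpaceWithFunctions.Iso.refl (X : SpaceWithFunctions) : Iso X X :=
  ⟨Equiv.refl _, fun _ => Iff.rfl, fun _ _ _ => Iff.rfl⟩

/-- The total excess of the cells over triangles is one, and the quadrilateral uses it up. -/
theorem card_eq_three_of_sum {V₀ : Cell S} (h₀ : V₀.1.card = 4)
    (hsum : ∑ α : Cell S, (α.1.card - 2) = Fintype.card (Cell S) + 1) (α : Cell S)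
    (hα : α ≠ V₀) : α.1.card = 3 := by
  have h1 : ∀ β : Cell S, β.1.card - 2 = (β.1.card - 3) + 1 := fun β => by
    have := β.2.1
    omega
  rw [Finset.sum_congr rfl fun β _ => h1 β, Finset.sum_add_distrib, Finset.sum_const,
    smul_eq_mul, mul_one, Finset.card_univ, add_comm, Nat.add_left_cancel_iff,
    ← Finset.add_sum_erase _ _ (Finset.mem_univ V₀), h₀, Nat.add_eq_left,
    Finset.sum_eq_zero_iff] at hsum
  have h2 := hsum α (Finset.mem_erase.2 ⟨hα, Finset.mem_univ _⟩)
  have h3 := α.2.1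
  omega

end PolygonDegeneration

theorem mainTheorem7 {n : ℕ} (Γ Γ' : Finset (Fin n × Fin n)) (a b c d : Fin n)
    (hΓ : IsTriangulation Γ) (hΓ' : IsTriangulation Γ') (hW : IsWhiteheadMove Γ Γ' a b c d) :
    -- the two triangulations induce the same family over `ℂ ^ (Γ ∩ Γ')`
    subfamily Γ (Γ ∩ Γ') = subfamily Γ' (Γ ∩ Γ') ∧
    -- the common diagonals cut the polygon into the quadrilateral `abcd` and `n - 4` triangles
    IsCell (Γ ∩ Γ') {a, b, c, d} ∧
    (∀ α : Cell (Γ ∩ Γ'), α.1 ≠ {a, b, c, d} → α.1.card = 3) ∧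
    Fintype.card (Cell (Γ ∩ Γ')) = 1 + (n - 4) ∧
    -- the central fiber is the GIT quotient, embedded by the glued Plücker coordinates
    (∃ Φ : Iso
        (gitQuotient (gluingAct (Γ ∩ Γ')) (MonoidHom.fst ℂˣ (↥(Γ ∩ Γ') → ℂˣ))
          (coneProduct (Γ ∩ Γ')))
        ((projective (Pairs (Fin n))).restrict (centralFiber Γ (Γ ∩ Γ'))),
      ∀ y : semistable (gluingAct (Γ ∩ Γ')) (MonoidHom.fst ℂˣ (↥(Γ ∩ Γ') → ℂˣ))
          (coneProduct (Γ ∩ Γ')),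
        ∃ hy : gluedPlucker (Γ ∩ Γ') y.1 ≠ 0,
          (Φ.toEquiv (Quot.mk _ y)).1 = Projectivization.mk ℂ (gluedPlucker (Γ ∩ Γ') y.1) hy) ∧
    -- the complement of the divisor is the geometric quotient, by the same formula
    (∃ Φ : Iso
        (geometricQuotient (gluingAct (Γ ∩ Γ')) (openConeProduct (Γ ∩ Γ')))
        ((projective (Pairs (Fin n))).restrict
          (centralFiber Γ (Γ ∩ Γ') \ boundaryDivisor n)),
      ∀ y : openConeProduct (Γ ∩ Γ'),
        ∃ hy : gluedPlucker (Γ ∩ Γ') y.1 ≠ 0,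
          (Φ.toEquiv (Quot.mk _ y)).1 = Projectivization.mk ℂ (gluedPlucker (Γ ∩ Γ') y.1) hy) ∧
    -- the complement of the divisor is a product of `Gr°` of the quadrilateral and a torus
    Nonempty (Iso
      ((projective (Pairs (Fin n))).restrict (centralFiber Γ (Γ ∩ Γ') \ boundaryDivisor n))
      (prod (openGrass ↥({a, b, c, d} : Finset (Fin n)))
        (complementaryTorus (Γ ∩ Γ') a b c d))) ∧
    Nonempty (Iso
      ((projective (Pairs (Fin n))).restrict (centralFiber Γ (Γ ∩ Γ') \ boundaryDivisor n))
      (prod (openGrass (Fin 4)) (algTorus (2 * (n - 4))))) := by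

  obtain ⟨hab, hbc, hcd, hac, hbd, hE⟩ := id hW
  have hn : 4 ≤ n := by
    have := d.2
    rw [Fin.lt_def] at hab hbc hcd
    omega
  have hn3 : 3 ≤ n := by omega
  have hsub : Γ ∩ Γ' ⊆ Γ := Finset.inter_subset_left
  have hsub' : Γ ∩ Γ' ⊆ Γ' := Finset.inter_subset_right
  have hS : IsDissection (Γ ∩ Γ') := hΓ.isDissection hsub
  obtain ⟨r, hr⟩ : ∃ r : Pairs (Fin n), ∀ k, r.1.1 ≤ k ∧ k ≤ r.1.2 := by
    obtain ⟨r, hr⟩ := exists_root (n := n) (by omega)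
    exact ⟨⟨r, ((hr a).1.trans_lt hab).trans_le (hr b).2⟩, hr⟩
  have hcell := hW.isCell hΓ hΓ'
  have hcard4 : ({a, b, c, d} : Finset (Fin n)).card = 4 :=
    le_antisymm Finset.card_le_four
      (card_ge_four_of_ne (by simp) (by simp) (by simp) (by simp) hab hbc hcd)
  have hScard : (Γ ∩ Γ').card = n - 4 := by
    rw [hW.inter_eq hΓ', Finset.card_erase_of_mem hac, hΓ.card_eq hn3 hr, Nat.sub_sub]
  have hcells : Fintype.card (Cell (Γ ∩ Γ')) = 1 + (n - 4) := by
    rw [card_cell hS hn3 hr, hScard, add_comm]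
  let V₀ : Cell (Γ ∩ Γ') := ⟨{a, b, c, d}, hcell⟩
  have htri : ∀ α : Cell (Γ ∩ Γ'), α ≠ V₀ → α.1.card = 3 :=
    card_eq_three_of_sum hcard4 (by
      rw [sum_card_cells hS hr, hcells]
      omega)
  -- A torus depends only on its number of coordinates, so both descriptions of the torus factor are
  -- instances of one isomorphism.
  have hopen {ι : Type} [Fintype ι] (hι : Fintype.card ι = 2 * (n - 4)) :=
    nonempty_openPart_iso hsub hS hn3 hr V₀ htri (ι := ι)
      (by rw [hι, hcells, Nat.add_sub_cancel_left])
  refine ⟨(subfamily_eq_family hsub).trans (subfamily_eq_family hsub').symm, hcell,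
    fun α hα => htri α fun h => hα (congrArg Subtype.val h), hcells,
    exists_gitQuotient_iso hsub hS hn3, exists_geometricQuotient_iso hsub hS hn3 hr, ?_, ?_⟩
  · classical
    let F : Finset (Fin n × Fin n) := {(a, b), (b, c), (c, d), (a, d)}
    have hFmem : ∀ e, e ∈ F ↔ e = (a, b) ∨ e = (b, c) ∨ e = (c, d) ∨ e = (a, d) := fun e => by
      simp only [F, Finset.mem_insert, Finset.mem_singleton]
    have hF : F ⊆ (Γ ∩ Γ') ∪ sides n := fun e he => by
      have he' := (hFmem e).1 he
      have hlt : e.1 < e.2 := by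
        rcases he' with rfl | rfl | rfl | rfl
        exacts [hab, hbc, hcd, (hab.trans hbc).trans hcd]
      rw [Finset.mem_union, mem_sides]
      exact (hW.mem_or_adjacent hΓ hΓ' he').symm.imp id fun h => ⟨hlt, h⟩
    have hFcard : F.card = 4 := by
      rw [Finset.card_insert_of_notMem, Finset.card_insert_of_notMem,
        Finset.card_insert_of_notMem, Finset.card_singleton]
      all_goals
        simp only [Finset.mem_insert, Finset.mem_singleton, Prod.mk.injEq]
        grind
    let Q : TreeEdge (Γ ∩ Γ') → Prop := fun e =>
      e.1 = (a, b) ∨ e.1 = (b, c) ∨ e.1 = (c, d) ∨ e.1 = (a, d)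
    -- The dual tree has `n - 4` inner edges and `n` leaves; fixing the four edges of the
    -- quadrilateral leaves `2 * (n - 4)` free coordinates.
    obtain ⟨Φ⟩ := hopen (ι := {e // ¬ Q e}) (by
      rw [card_treeEdge_compl hS hn3 hF Q fun e => (hFmem _).symm, hFcard, hScard]
      omega)
    exact ⟨Φ.trans (Iso.prodCongr (Iso.refl _) (subtorusIso Q).symm)⟩
  · obtain ⟨Φ⟩ := hopen (ι := Fin (2 * (n - 4))) (Fintype.card_fin _)
    exact ⟨Φ.trans (Iso.prodCongr (openGrassCongr (Finset.orderIsoOfFin _ hcard4).symm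
      (topPair V₀) (cyclicallyAdjacent_topPair V₀)) (Iso.refl _))⟩
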